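/- Let $V$ be a smooth manifold (Hausdorff, second countable, of dimension $n$) with a smooth free action of the circle $\mathbb{S}^1$, and let $X(x)=\frac{d}{dt}\big|_{t=0}\, e^{it}\cdot x$ be its fundamental vector field. Let $\mathbb{S}^1$ act on $T^*V$ by $u\cdot(x,\varphi)=(u\cdot x,\ \varphi\circ (T_x\rho(u))^{-1})$, where $\rho(u)(x)=u\cdot x$, and put $H(x,\varphi)=\langle\varphi,X(x)\rangle$ on $T^*V$ and $\widetilde H(x,\varphi,z)=H(x,\varphi)-\tfrac12|z|^2$ on $T^*V\times\mathbb{C}$. Let $\mathbb{S}^1$ act on $T^*V\times\mathbb{C}$ by $u\cdot(x,\varphi,z)=(u\cdot(x,\varphi),\bar u z)$; this action preserves $\widetilde H^{-1}(\xi)$ and $H^{-1}(\xi)\times\mathbb{C}$. For $\xi\in\mathbb{R}$ let $$Q_\xi=H^{-1}(\xi)/\mathbb{S}^1,\qquad W_\xi=\widetilde H^{-1}(\xi)/\mathbb{S}^1\ \text{ (the symplectic cut)},\qquad H^{-1}(\xi)\times_{\mathbb{S}^1}\mathbb{C}=(H^{-1}(\xi)\times\mathbb{C})/\mathbb{S}^1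 .$$ Then $H^{-1}(\xi)$ and $\widetilde H^{-1}(\xi)$ are smooth embedded submanifolds of $T^*V$ and $T^*V\times\mathbb{C}$, of dimensions $2n-1$ and $2n+1$; the three quotients are smooth (Hausdorff, second countable) manifolds, of dimensions $2n-2$, $2n$ and $2n$, whose quotient projections are smooth submersions; and, for these smooth structures: - $H^{-1}(\xi)\to Q_\xi$ is a smooth principal circle bundle; - $H^{-1}(\xi)\times_{\mathbb{S}^1}\mathbb{C}\to Q_\xi$, $[a,z]\mapsto[a]$, is a smooth complex line bundle, for complex vector space structures on its fibres such that $z\mapsto[a,z]$ is linear for every $a\in H^{-1}(\xi)$; - $W_\xi$ is the total space of this line bundle: there is a diffeomorphism $\Phi: W_\xi\to H^{-1}(\xi)\times_{\mathbb{S}^1}\mathbb{C}$ such that $\Phi([x,\varphi,0])=[(x,\varphi),0]$ for all $(x,\varphi)\in H^{-1}(\xi)$, i.e. $Q_\xi\subset W_\xi$ corresponds to the zero section. -/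

import Mathlib

open scoped Manifold ContDiff

noncomputable section

namespace CircleCut

/-! ### The cotangent lift of a circle action and its Hamiltonian -/

section Cotangent

/-- The total space of the cotangent bundle `T*V`: pairs `(x, φ)` with `φ` a linear form on
`T_x V`. Topology and smooth structure are those of the bundle of continuous linear maps from
the tangent bundle to the trivial line bundle. -/
abbrev Cotangent (n : ℕ) (V : Type*) [TopologicalSpace V]
    [ChartedSpace (EuclideanSpace ℝ (Fin n)) V] : Type _ :=
  Bundle.TotalSpace (EuclideanSpace ℝ (Fin n) →L[ℝ] ℝ)
    (fun x : V ↦ TangentSpace (𝓡 n) x →L[ℝ] Bundle.Trivial V ℝ x)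

/-- The model with corners of `T*V`. -/
abbrev cotangentModel (n : ℕ) :
    ModelWithCorners ℝ (EuclideanSpace ℝ (Fin n) × (EuclideanSpace ℝ (Fin n) →L[ℝ] ℝ))
      (ModelProd (EuclideanSpace ℝ (Fin n)) (EuclideanSpace ℝ (Fin n) →L[ℝ] ℝ)) :=
  (𝓡 n).prod 𝓘(ℝ, EuclideanSpace ℝ (Fin n) →L[ℝ] ℝ)

variable {n : ℕ} {V : Type*} [TopologicalSpace V] [ChartedSpace (EuclideanSpace ℝ (Fin n)) V]
  [MulAction Circle V]

variable (n) in
/-- The fundamental vector field of the circle action,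
`X(x) = d/dt (exp(it) • x)` at `t = 0` (a tangent vector at `exp(0) • x`, which is `x`). -/
def fundamentalField (x : V) : TangentSpace (𝓡 n) x :=
  mfderiv 𝓘(ℝ, ℝ) (𝓡 n) (fun t : ℝ ↦ Circle.exp t • x) 0 (1 : ℝ)

/-- The lifted action `u · (x, φ) = (u • x, φ ∘ (T_x ρ(u))⁻¹)`, where `ρ(u) x = u • x`. -/
def cotangentSMul (u : Circle) (a : Cotangent n V) : Cotangent n V :=
  ⟨u • a.1, ContinuousLinearMap.comp (a.2 : TangentSpace (𝓡 n) a.1 →L[ℝ] ℝ)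
    (mfderiv (𝓡 n) (𝓡 n) (fun y : V ↦ u • y) a.1).inverse⟩

/-- The Hamiltonian `H(x, φ) = ⟨φ, X(x)⟩` on `T*V`. -/
def hamiltonian (a : Cotangent n V) : ℝ := a.2 (fundamentalField n a.1)

/-- The Hamiltonian `H(x, φ) - |z|² / 2` on `T*V × ℂ`. -/
def cutHamiltonian (a : Cotangent n V × ℂ) : ℝ := hamiltonian a.1 - 1 / 2 * ‖a.2‖ ^ 2

section Invariance

variable [ContMDiffSMul (𝓡 1) (𝓡 n) ∞ Circle V]

theorem mdifferentiable_smul (u : Circle) :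
    MDifferentiable (𝓡 n) (𝓡 n) (fun y : V ↦ u • y) :=
  (Diffeomorph.smul (𝓡 1) (𝓡 n) ∞ u : V ≃ₘ^∞⟮𝓡 n, 𝓡 n⟯ V).contMDiff.mdifferentiable (by simp)

theorem mdifferentiable_exp_smul (x : V) :
    MDifferentiable 𝓘(ℝ, ℝ) (𝓡 n) (fun t : ℝ ↦ Circle.exp t • x) := by
  have h : ContMDiff 𝓘(ℝ, ℝ) (𝓡 n) ∞ (fun t : ℝ ↦ Circle.exp t • x) :=
    ContMDiff.smul (I := 𝓡 1) contMDiff_circleExp contMDiff_const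
  exact h.mdifferentiable (by simp)

theorem isInvertible_mfderiv_smul (u : Circle) (x : V) :
    (mfderiv (𝓡 n) (𝓡 n) (fun y : V ↦ u • y) x).IsInvertible :=
  ⟨(Diffeomorph.smul (𝓡 1) (𝓡 n) ∞ u : V ≃ₘ^∞⟮𝓡 n, 𝓡 n⟯ V).mfderivToContinuousLinearEquiv
    (by simp) x, rfl⟩

theorem mfderiv_smul_fundamentalField (u : Circle) (x : V) :
    mfderiv (𝓡 n) (𝓡 n) (fun y : V ↦ u • y) x (fundamentalField n x) =
      fundamentalField n (u • x) := by
  have hc : (fun t : ℝ ↦ Circle.exp t • (u • x)) =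
      (fun y : V ↦ u • y) ∘ (fun t : ℝ ↦ Circle.exp t • x) := by
    funext t
    simp only [Function.comp_apply, smul_smul, mul_comm]
  have h0 : Circle.exp 0 • x = x := by simp
  unfold fundamentalField
  rw [hc]
  have := mfderiv_comp_apply (I := 𝓘(ℝ, ℝ)) (I' := 𝓡 n) (I'' := 𝓡 n) (0 : ℝ)
    (mdifferentiable_smul (n := n) u _) (mdifferentiable_exp_smul (n := n) x 0) (1 : ℝ)
  refine Eq.trans ?_ this.symm
  have key : ∀ (y : V) (_ : y = x) (v : EuclideanSpace ℝ (Fin n)),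
      (mfderiv (𝓡 n) (𝓡 n) (fun y : V ↦ u • y) x v : EuclideanSpace ℝ (Fin n)) =
        mfderiv (𝓡 n) (𝓡 n) (fun y : V ↦ u • y) y v := by
    rintro y rfl v
    rfl
  exact key _ h0 _

/-- The Hamiltonian is invariant under the lifted circle action. -/
theorem hamiltonian_smul (u : Circle) (a : Cotangent n V) :
    hamiltonian (cotangentSMul u a) = hamiltonian a := by
  have h := isInvertible_mfderiv_smul (n := n) u a.1
  have h2 := mfderiv_smul_fundamentalField (n := n) u a.1
  change a.2 ((mfderiv (𝓡 n) (𝓡 n) (fun y : V ↦ u • y) a.1).inverse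
    (fundamentalField n (u • a.1))) = a.2 (fundamentalField n a.1)
  rw [← h2, h.inverse_apply_self]

theorem cutHamiltonian_smul (u : Circle) (a : Cotangent n V × ℂ) :
    cutHamiltonian (cotangentSMul u a.1, (starRingEnd ℂ) (u : ℂ) * a.2) = cutHamiltonian a := by
  simp only [cutHamiltonian, hamiltonian_smul, norm_mul, RCLike.norm_conj, Circle.norm_coe, one_mul]

end Invariance

end Cotangent

/-! ### Levels, reduced space, symplectic cut, associated line bundle -/

section Cut

variable (n : ℕ) (V : Type*) [TopologicalSpace V] [ChartedSpace (EuclideanSpace ℝ (Fin n)) V]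
  [MulAction Circle V] (ξ : ℝ)

/-- The level `H⁻¹(ξ)` in `T*V`. -/
abbrev Level : Type _ := {a : Cotangent n V // hamiltonian a = ξ}

/-- The level `{H(x, φ) - |z|² / 2 = ξ}` in `T*V × ℂ`. -/
abbrev CutLevel : Type _ := {a : Cotangent n V × ℂ // cutHamiltonian a = ξ}

variable [ContMDiffSMul (𝓡 1) (𝓡 n) ∞ Circle V]

variable {n V ξ}

/-- The circle action on `H⁻¹(ξ)`. -/
def levelSMul (u : Circle) (a : Level n V ξ) : Level n V ξ :=
  ⟨cotangentSMul u a.1, (hamiltonian_smul u a.1).trans a.2⟩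

/-- The circle action `u · (x, φ, z) = (u • x, u · φ, ū z)` on `{H - |z|² / 2 = ξ}`. -/
def cutSMul (u : Circle) (a : CutLevel n V ξ) : CutLevel n V ξ :=
  ⟨(cotangentSMul u a.1.1, (starRingEnd ℂ) (u : ℂ) * a.1.2), (cutHamiltonian_smul u a.1).trans a.2⟩

/-- The circle action `u · (x, φ, z) = (u • x, u · φ, ū z)` on `H⁻¹(ξ) × ℂ`. -/
def assocSMul (u : Circle) (a : Level n V ξ × ℂ) : Level n V ξ × ℂ :=
  (levelSMul u a.1, (starRingEnd ℂ) (u : ℂ) * a.2)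

variable (n V ξ)

/-- The reduced space `Q_ξ = H⁻¹(ξ) / S¹` (with the quotient topology). -/
abbrev ReducedSpace : Type _ := Quot fun a b : Level n V ξ ↦ ∃ u : Circle, levelSMul u a = b

/-- The cut space `W_ξ = {H - |z|² / 2 = ξ} / S¹` (with the quotient topology). -/
abbrev CutSpace : Type _ := Quot fun a b : CutLevel n V ξ ↦ ∃ u : Circle, cutSMul u a = b

/-- The associated bundle `H⁻¹(ξ) ×_{S¹} ℂ` (with the quotient topology). -/
abbrev AssocBundle : Type _ := Quot fun a b : Level n V ξ × ℂ ↦ ∃ u : Circle, assocSMul u a = b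

variable {n V ξ}

/-- The projection `H⁻¹(ξ) → Q_ξ`. -/
def levelMk (a : Level n V ξ) : ReducedSpace n V ξ := Quot.mk _ a

/-- The projection `{H - |z|² / 2 = ξ} → W_ξ`. -/
def cutMk (a : CutLevel n V ξ) : CutSpace n V ξ := Quot.mk _ a

/-- The projection `H⁻¹(ξ) × ℂ → H⁻¹(ξ) ×_{S¹} ℂ`. -/
def assocMk (a : Level n V ξ × ℂ) : AssocBundle n V ξ := Quot.mk _ a

/-- The bundle projection `H⁻¹(ξ) ×_{S¹} ℂ → Q_ξ`, `[a, z] ↦ [a]`. -/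
def assocProj : AssocBundle n V ξ → ReducedSpace n V ξ :=
  Quot.lift (fun a ↦ levelMk a.1) fun _ _ ⟨u, hu⟩ ↦ Quot.sound ⟨u, congrArg Prod.fst hu⟩

/-- The inclusion `(x, φ) ↦ (x, φ, 0)` of `H⁻¹(ξ)` in `{H - |z|² / 2 = ξ}`. -/
def levelInclusion (a : Level n V ξ) : CutLevel n V ξ :=
  ⟨(a.1, 0), by simp [cutHamiltonian, a.2]⟩

/-- The inclusion `Q_ξ → W_ξ`, `[x, φ] ↦ [x, φ, 0]`. -/
def reducedInclusion : ReducedSpace n V ξ → CutSpace n V ξ :=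
  Quot.lift (fun a ↦ cutMk (levelInclusion a)) fun _ _ ⟨u, hu⟩ ↦ Quot.sound
    ⟨u, by subst hu; simp [cutSMul, levelInclusion, levelSMul]⟩

/-- The vector `[a, z]`, as an element of the fibre of `H⁻¹(ξ) ×_{S¹} ℂ → Q_ξ` over `[a]`. -/
def assocFiberMk (a : Level n V ξ) (z : ℂ) :
    (assocProj ⁻¹' {levelMk a} : Set (AssocBundle n V ξ)) :=
  ⟨assocMk (a, z), rfl⟩

end Cut

/-! ### Smooth circle bundles and complex line bundles -/

section Bundles

variable (d k : ℕ) {P M : Type*} [TopologicalSpace P] [ChartedSpace (EuclideanSpace ℝ (Fin d)) P]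
  [TopologicalSpace M] [ChartedSpace (EuclideanSpace ℝ (Fin k)) M]

/-- `π : P → M` is a smooth principal circle bundle for the circle action `act` on `P`: it has
smooth equivariant local trivializations `π⁻¹(U) ≃ U × S¹`. -/
def IsPrincipalCircleBundle (act : Circle → P → P) (π : P → M) : Prop :=
  ∀ b : M, ∃ τ : Bundle.Trivialization Circle π, b ∈ τ.baseSet ∧
    ContMDiffOn (𝓡 d) ((𝓡 k).prod (𝓡 1)) ∞ τ τ.source ∧
    ContMDiffOn ((𝓡 k).prod (𝓡 1)) (𝓡 d) ∞ τ.toOpenPartialHomeomorph.symm τ.target ∧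
    ∀ u : Circle, ∀ a ∈ τ.source, act u a ∈ τ.source ∧ τ (act u a) = ((τ a).1, u * (τ a).2)

/-- `π : P → M`, whose fibres carry complex vector space structures, is a smooth complex line
bundle: it has smooth local trivializations `π⁻¹(U) ≃ U × ℂ` that are `ℂ`-linear on the fibres. -/
def IsComplexLineBundle (π : P → M) [∀ b, AddCommGroup (π ⁻¹' {b})]
    [∀ b, Module ℂ (π ⁻¹' {b})] : Prop :=
  ∀ b : M, ∃ τ : Bundle.Trivialization ℂ π, b ∈ τ.baseSet ∧
    ContMDiffOn (𝓡 d) ((𝓡 k).prod 𝓘(ℝ, ℂ)) ∞ τ τ.source ∧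
    ContMDiffOn ((𝓡 k).prod 𝓘(ℝ, ℂ)) (𝓡 d) ∞ τ.toOpenPartialHomeomorph.symm τ.target ∧
    ∀ c ∈ τ.baseSet, IsLinearMap ℂ (fun v : (π ⁻¹' {c} : Set P) ↦ (τ v.1).2)

end Bundles

end CircleCut

end

open CircleCut Manifold

/-!
The proof rests on charts in which the action and the Hamiltonians take a normal form.

*Slices.* A free action of the compact group `S¹` has slices: the fundamental vector field `X`
vanishes nowhere (`fundamentalField_ne_zero`), a small hypersurface transverse to `X` meets every
orbit at most once, and its translates form an invariant open set that is equivariantly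
diffeomorphic to `S¹ × ℝⁿ⁻¹` (`exists_circleChart`). Such an equivariant chart gives an invariant
frame of `TV` whose first vector is `X`. In the coordinates of `T*V` given by the chart and the
components in the frame, the lifted action is the multiplication of the circle coordinate, and `H`
is one of the other coordinates (`SliceChart.adaptedChart`). Rotating `z` by the circle coordinate
gives coordinates of `T*V × ℂ` with the same properties for `H - |z|² / 2`
(`SliceChart.cutAdaptedChart`). So both levels are coordinate slices, hence embedded submanifolds
(`exists_chartedSpace_levelSet`), and they are covered by equivariant charts onto `S¹ × G` for a
vector space `G`.

*Quotients.* A manifold covered by equivariant charts has an orbit space that is a manifold with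
charts in `G`; the orbit map is a submersion and a principal circle bundle
(`exists_chartedSpace_orbitSpace`, `isPrincipalCircleBundle_orbitMk`). The orbit space is Hausdorff
as the circle is compact. For `P × ℂ` with the action `u · (a, z) = (u · a, ū z)`, rotating `z` by
the circle coordinate of `a` gives equivariant charts that are at the same time linear
trivializations of the associated line bundle (`isComplexLineBundle_assocOrbitProj`).

*The cut.* An invariant partition of unity, pulled back from `V / S¹`, gives an invariant `1`-form
`θ` on `V` with `θ(X) = 1` (`exists_connection`). As `H(x, φ + r θ_x) = H(x, φ) + r`, the map
`(x, φ, z) ↦ (x, φ - |z|² / 2 θ_x, z)` is an equivariant diffeomorphism of `{H - |z|² / 2 = ξ}` to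
`H⁻¹(ξ) × ℂ`, which is the identity where `z = 0` (`cutToAssoc`). It descends to the orbit spaces
and gives `Φ`.

If `V` is nonempty, then `n ≥ 1`, as `X` does not vanish. If `V` is empty, so are all spaces
involved; this is the only case in which the subtractions in `2 * n - 1` and `2 * n - 2` can be
truncated.
-/

noncomputable section

namespace CircleCut

open Set Manifold Filter Topology Bundle

/-! ### Partial diffeomorphisms and charts -/

section PartialDiffeo

variable {E H M E' H' M' E'' H'' M'' E₃ H₃ M₃ : Type*}
  [NormedAddCommGroup E] [NormedSpace ℝ E] [TopologicalSpace H] {I : ModelWithCorners ℝ E H}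
  [TopologicalSpace M] [ChartedSpace H M]
  [NormedAddCommGroup E'] [NormedSpace ℝ E'] [TopologicalSpace H'] {I' : ModelWithCorners ℝ E' H'}
  [TopologicalSpace M'] [ChartedSpace H' M']
  [NormedAddCommGroup E''] [NormedSpace ℝ E''] [TopologicalSpace H'']
  {I'' : ModelWithCorners ℝ E'' H''} [TopologicalSpace M''] [ChartedSpace H'' M'']
  [NormedAddCommGroup E₃] [NormedSpace ℝ E₃] [TopologicalSpace H₃]
  {I₃ : ModelWithCorners ℝ E₃ H₃} [TopologicalSpace M₃] [ChartedSpace H₃ M₃]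

variable (I I') in
/-- An open partial homeomorphism between manifolds that is smooth in both directions. -/
structure IsPartialDiffeo (e : OpenPartialHomeomorph M M') : Prop where
  contMDiffOn : ContMDiffOn I I' ∞ e e.source
  contMDiffOn_symm : ContMDiffOn I' I ∞ e.symm e.target

namespace IsPartialDiffeo

theorem symm {e : OpenPartialHomeomorph M M'} (h : IsPartialDiffeo I I' e) :
    IsPartialDiffeo I' I e.symm :=
  ⟨h.2, h.1⟩

theorem trans {e : OpenPartialHomeomorph M M'} {f : OpenPartialHomeomorph M' M''}
    (he : IsPartialDiffeo I I' e) (hf : IsPartialDiffeo I' I'' f) :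
    IsPartialDiffeo I I'' (e ≫ₕ f) := by
  refine ⟨hf.1.comp (he.1.mono fun x hx ↦ ?_) fun x hx ↦ ?_,
    he.2.comp (hf.2.mono fun x hx ↦ ?_) fun x hx ↦ ?_⟩ <;>
  simp only [OpenPartialHomeomorph.trans_source, OpenPartialHomeomorph.trans_target] at hx <;>
  exact (by first | exact hx.1 | exact hx.2)

theorem prod {e : OpenPartialHomeomorph M M'} {f : OpenPartialHomeomorph M'' M₃}
    (he : IsPartialDiffeo I I' e) (hf : IsPartialDiffeo I'' I₃ f) :
    IsPartialDiffeo (I.prod I'') (I'.prod I₃) (e.prod f) :=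
  ⟨he.1.prodMap hf.1, he.2.prodMap hf.2⟩

theorem refl : IsPartialDiffeo I I (OpenPartialHomeomorph.refl M) :=
  ⟨contMDiffOn_id, contMDiffOn_id⟩

theorem contMDiffAt {e : OpenPartialHomeomorph M M'} (h : IsPartialDiffeo I I' e) {x : M}
    (hx : x ∈ e.source) : ContMDiffAt I I' ∞ e x :=
  h.1.contMDiffAt (e.open_source.mem_nhds hx)

theorem contMDiffAt_symm {e : OpenPartialHomeomorph M M'} (h : IsPartialDiffeo I I' e) {x : M'}
    (hx : x ∈ e.target) : ContMDiffAt I' I ∞ e.symm x :=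
  h.symm.contMDiffAt hx

theorem of_diffeomorph (f : M ≃ₘ^∞⟮I, I'⟯ M') :
    IsPartialDiffeo I I' f.toHomeomorph.toOpenPartialHomeomorph :=
  ⟨f.contMDiff.contMDiffOn, f.symm.contMDiff.contMDiffOn⟩

theorem chartAt [IsManifold I ∞ M] (x : M) : IsPartialDiffeo I I (chartAt H x) :=
  ⟨contMDiffOn_chart, contMDiffOn_chart_symm⟩

theorem model [I.Boundaryless] :
    IsPartialDiffeo I 𝓘(ℝ, E) I.toHomeomorph.toOpenPartialHomeomorph :=
  ⟨(I.contMDiff (n := ∞)).contMDiffOn, by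
    have := I.contMDiffOn_symm (n := ∞)
    rw [I.range_eq_univ] at this
    exact this.mono (subset_univ _)⟩

theorem linear (L : E ≃L[ℝ] E') :
    IsPartialDiffeo 𝓘(ℝ, E) 𝓘(ℝ, E') L.toHomeomorph.toOpenPartialHomeomorph :=
  ⟨L.contDiff.contMDiff.contMDiffOn, L.symm.contDiff.contMDiff.contMDiffOn⟩

/-- A linear isomorphism from `E × E''`, where the product is regarded as a manifold modelled on the
product of two models; this differs from the model `𝓘(ℝ, E × E'')` of a normed space. -/
theorem linear_prod (L : (E × E'') ≃L[ℝ] E') :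
    IsPartialDiffeo (𝓘(ℝ, E).prod 𝓘(ℝ, E'')) 𝓘(ℝ, E') L.toHomeomorph.toOpenPartialHomeomorph :=
  ⟨(L.contDiff.contMDiff.comp (contMDiff_fst.prodMk_space contMDiff_snd)).contMDiffOn,
    ((contDiff_fst.comp L.symm.contDiff).contMDiff.prodMk
      (contDiff_snd.comp L.symm.contDiff).contMDiff).contMDiffOn⟩

theorem mem_maximalAtlas [IsManifold I ∞ M] {e : OpenPartialHomeomorph M H}
    (h : IsPartialDiffeo I I e) : e ∈ IsManifold.maximalAtlas I ∞ M :=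
  e.mem_maximalAtlas_of_contMDiffOn h.1 h.2

end IsPartialDiffeo

variable (I) in
/-- The chart at `m`, read in the vector space `E'` through a linear isomorphism `L` from the model
space of a boundaryless manifold. -/
def linearChart [I.Boundaryless] (L : E ≃L[ℝ] E') (m : M) : OpenPartialHomeomorph M E' :=
  chartAt H m ≫ₕ I.toHomeomorph.toOpenPartialHomeomorph ≫ₕ
    L.toHomeomorph.toOpenPartialHomeomorph

theorem mem_linearChart_source [I.Boundaryless] (L : E ≃L[ℝ] E') (m : M) :
    m ∈ (linearChart I L m).source := by
  simp [linearChart]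

theorem isPartialDiffeo_linearChart [I.Boundaryless] [IsManifold I ∞ M] (L : E ≃L[ℝ] E') (m : M) :
    IsPartialDiffeo I 𝓘(ℝ, E') (linearChart I L m) :=
  (IsPartialDiffeo.chartAt m).trans (IsPartialDiffeo.model.trans (IsPartialDiffeo.linear L))

end PartialDiffeo

section Construction

variable {E₀ H₀ M₀ X E : Type*} [NormedAddCommGroup E₀] [NormedSpace ℝ E₀] [TopologicalSpace H₀]
  {I₀ : ModelWithCorners ℝ E₀ H₀} [I₀.Boundaryless] [TopologicalSpace M₀] [ChartedSpace H₀ M₀]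
  [IsManifold I₀ ∞ M₀] [TopologicalSpace X] [NormedAddCommGroup E] [NormedSpace ℝ E]

/-- Local homeomorphisms onto open subsets of a model manifold `M₀`, with smooth transition maps,
define a manifold structure, modelled on any vector space linearly isomorphic to the model space of
`M₀`. -/
theorem exists_chartedSpace_of_transitions {ι : Type*} (C : ι → OpenPartialHomeomorph X M₀)
    (hcov : ∀ x, ∃ i, x ∈ (C i).source)
    (htr : ∀ i j, ContMDiffOn I₀ I₀ ∞ (C j ∘ (C i).symm) ((C i).symm ≫ₕ C j).source)
    (L : E₀ ≃L[ℝ] E) :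
    ∃ _ : ChartedSpace E X, IsManifold 𝓘(ℝ, E) ∞ X ∧
      ∀ i, IsPartialDiffeo 𝓘(ℝ, E) I₀ (C i) := by
  choose ix hix using hcov
  let T : M₀ → OpenPartialHomeomorph M₀ E := linearChart I₀ L
  have hT : ∀ m, IsPartialDiffeo I₀ 𝓘(ℝ, E) (T m) := isPartialDiffeo_linearChart L
  let cs : ChartedSpace E X :=
    { atlas := {e | ∃ i m, e = C i ≫ₕ T m}
      chartAt := fun x ↦ C (ix x) ≫ₕ T (C (ix x) x)
      mem_chart_source := fun x ↦ by
        simp only [OpenPartialHomeomorph.trans_source]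
        exact ⟨hix x, mem_linearChart_source L _⟩
      chart_mem_atlas := fun x ↦ ⟨_, _, rfl⟩ }
  have hcompat : ∀ i m j m', ContMDiffOn 𝓘(ℝ, E) 𝓘(ℝ, E) ∞
      ((C i ≫ₕ T m).symm ≫ₕ (C j ≫ₕ T m')) ((C i ≫ₕ T m).symm ≫ₕ (C j ≫ₕ T m')).source := by
    intro i m j m'
    have h := (hT m').1.comp ((htr i j).comp
      ((hT m).2.mono (t := ((C i ≫ₕ T m).symm ≫ₕ (C j ≫ₕ T m')).source) fun x hx ↦ ?_)
      fun x hx ↦ ?_) fun x hx ↦ ?_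
    · exact h
    all_goals simp only [mfld_simps] at hx ⊢
    · exact hx.1.1
    · exact ⟨hx.1.2, hx.2.1⟩
    · exact hx.2.2
  have hmfd : IsManifold 𝓘(ℝ, E) ∞ X := by
    refine isManifold_of_contDiffOn _ _ _ ?_
    rintro _ _ ⟨i, m, rfl⟩ ⟨j, m', rfl⟩
    have := contMDiffOn_iff_contDiffOn.1 (hcompat i m j m')
    simpa only [mfld_simps] using this
  refine ⟨cs, hmfd, fun i ↦ ?_⟩
  have hch : ∀ m, IsPartialDiffeo 𝓘(ℝ, E) 𝓘(ℝ, E) (C i ≫ₕ T m) := fun m ↦ by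
    have hm : C i ≫ₕ T m ∈ IsManifold.maximalAtlas 𝓘(ℝ, E) ∞ X :=
      (contDiffGroupoid ∞ 𝓘(ℝ, E)).subset_maximalAtlas ⟨i, m, rfl⟩
    exact ⟨contMDiffOn_of_mem_maximalAtlas hm, contMDiffOn_symm_of_mem_maximalAtlas hm⟩
  constructor
  · intro x hx
    have h := ((hch (C i x)).trans (hT (C i x)).symm).contMDiffAt (x := x)
      (by simp [hx, T, mem_linearChart_source])
    refine (h.congr_of_eventuallyEq ?_).contMDiffWithinAt
    have : (C i ≫ₕ T (C i x)).source ∈ nhds x :=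
      (C i ≫ₕ T (C i x)).open_source.mem_nhds (by simp [hx, T, mem_linearChart_source])
    filter_upwards [this] with y hy
    simp only [mfld_simps] at hy ⊢
    exact ((T (C i x)).left_inv hy.2).symm
  · intro y hy
    have h := ((hT y).trans (hch y).symm).contMDiffAt (x := y)
      (by simp [hy, T, mem_linearChart_source])
    refine (h.congr_of_eventuallyEq ?_).contMDiffWithinAt
    have : (T y).source ∈ nhds y := (T y).open_source.mem_nhds (mem_linearChart_source L y)
    filter_upwards [this] with z hz
    simp only [mfld_simps]
    rw [(T y).left_inv hz]

end Construction

/-! ### Level sets in adapted charts -/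

section LevelSet

variable {E₀ H₀ M₀ E : Type*} [NormedAddCommGroup E₀] [NormedSpace ℝ E₀] [TopologicalSpace H₀]
  {I₀ : ModelWithCorners ℝ E₀ H₀} [I₀.Boundaryless] [TopologicalSpace M₀] [ChartedSpace H₀ M₀]
  [IsManifold I₀ ∞ M₀] [NormedAddCommGroup E] [NormedSpace ℝ E]
  {E' H' N : Type*} [NormedAddCommGroup E'] [NormedSpace ℝ E'] [TopologicalSpace H']
  {J : ModelWithCorners ℝ E' H'} [J.Boundaryless] [TopologicalSpace N] [ChartedSpace H' N]
  [IsManifold J ∞ N]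

/-- A chart `N → M₀ × ℝ` in which the set `{h = ξ}` is the slice `M₀ × {0}`, restricted to that
set. -/
def levelChart {h : N → ℝ} {ξ : ℝ} (K : OpenPartialHomeomorph N (M₀ × ℝ))
    (hK : ∀ a ∈ K.source, (K a).2 = h a - ξ) (hKt : K.target = univ) :
    OpenPartialHomeomorph {a : N // h a = ξ} M₀ where
  toFun a := (K a.1).1
  invFun m := ⟨K.symm (m, 0), by
    have h1 : (m, (0 : ℝ)) ∈ K.target := hKt ▸ mem_univ _
    have h2 := hK _ (K.map_target h1)
    rw [K.right_inv h1] at h2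
    exact (sub_eq_zero.1 h2.symm)⟩
  source := {a | a.1 ∈ K.source}
  target := univ
  map_source' _ _ := mem_univ _
  map_target' m _ := K.map_target (hKt ▸ mem_univ _)
  left_inv' a ha := by
    have h2 : (K a.1).2 = 0 := by rw [hK _ ha, a.2, sub_self]
    refine Subtype.ext ?_
    change K.symm ((K a.1).1, 0) = a.1
    rw [← h2, Prod.mk.eta, K.left_inv ha]
  right_inv' m _ := by
    change (K (K.symm (m, 0))).1 = m
    rw [K.right_inv (hKt ▸ mem_univ _)]
  open_source := K.open_source.preimage continuous_subtype_val
  open_target := isOpen_univ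
  continuousOn_toFun := continuous_fst.comp_continuousOn
    (K.continuousOn.comp continuous_subtype_val.continuousOn fun _ ha ↦ ha)
  continuousOn_invFun := by
    refine Continuous.continuousOn (Continuous.subtype_mk ?_ _)
    exact (hKt ▸ K.continuousOn_symm).comp_continuous (by fun_prop) fun _ ↦ mem_univ _

/-- A level set `{h = ξ}` covered by charts of the ambient manifold in which it is a slice is a
manifold, smoothly embedded. -/
theorem exists_chartedSpace_levelSet {ι : Type*} {h : N → ℝ} {ξ : ℝ}
    (K : ι → OpenPartialHomeomorph N (M₀ × ℝ))
    (hK : ∀ i, ∀ a ∈ (K i).source, (K i a).2 = h a - ξ) (hKt : ∀ i, (K i).target = univ)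
    (hKd : ∀ i, IsPartialDiffeo J (I₀.prod 𝓘(ℝ, ℝ)) (K i))
    (hcov : ∀ a, ∃ i, a ∈ (K i).source) (L : E₀ ≃L[ℝ] E) (L' : (E × ℝ) ≃L[ℝ] E') :
    ∃ _ : ChartedSpace E {a : N // h a = ξ}, IsManifold 𝓘(ℝ, E) ∞ {a : N // h a = ξ} ∧
      IsSmoothEmbedding 𝓘(ℝ, E) J ∞ (Subtype.val : {a : N // h a = ξ} → N) ∧
      ∀ i, IsPartialDiffeo 𝓘(ℝ, E) I₀ (levelChart (K i) (hK i) (hKt i)) := by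
  let C := fun i ↦ levelChart (K i) (hK i) (hKt i)
  obtain ⟨cs, hm, hC⟩ := exists_chartedSpace_of_transitions (I₀ := I₀) C
    (fun x ↦ hcov x.1) (fun i j ↦ by
      have h1 : ContMDiff I₀ J ∞ (fun m : M₀ ↦ (K i).symm (m, 0)) := by
        have := (hKd i).2
        rw [hKt i, contMDiffOn_univ] at this
        exact this.comp (contMDiff_id.prodMk contMDiff_const)
      have h2 := contMDiff_fst.comp_contMDiffOn ((hKd j).1.comp h1.contMDiffOn
        (s := ((C i).symm ≫ₕ C j).source) fun x hx ↦ ?_)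
      · exact h2
      · rw [OpenPartialHomeomorph.trans_source] at hx
        exact hx.2) L
  refine ⟨cs, hm, ⟨?_, Topology.IsEmbedding.subtypeVal⟩, hC⟩
  refine IsImmersionOfComplement.isImmersion (F := ℝ) fun a ↦ ?_
  obtain ⟨i, hi⟩ := hcov a.1
  let T : OpenPartialHomeomorph M₀ E := linearChart I₀ L (C i a)
  have hT : IsPartialDiffeo I₀ 𝓘(ℝ, E) T := isPartialDiffeo_linearChart L _
  have hTm : C i a ∈ T.source := mem_linearChart_source L _
  -- in charts, the inclusion is `v ↦ (v, 0)`
  refine IsImmersionAtOfComplement.mk_of_continuousAt continuous_subtype_val.continuousAt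
    L' (C i ≫ₕ T) (K i ≫ₕ T.prod (OpenPartialHomeomorph.refl ℝ) ≫ₕ
      L'.toHomeomorph.toOpenPartialHomeomorph ≫ₕ
      J.toHomeomorph.toOpenPartialHomeomorph.symm) ?_ ?_ ?_ ?_ ?_
  · rw [OpenPartialHomeomorph.trans_source]
    exact ⟨hi, hTm⟩
  · simp only [mfld_simps]
    exact ⟨hi, hTm⟩
  · exact ((hC i).trans hT).mem_maximalAtlas
  · refine IsPartialDiffeo.mem_maximalAtlas (I := J) ?_
    refine (hKd i).trans ((hT.prod IsPartialDiffeo.refl).trans (IsPartialDiffeo.trans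
      (I' := 𝓘(ℝ, E')) ?_ IsPartialDiffeo.model.symm))
    exact IsPartialDiffeo.linear_prod L'
  · intro v hv
    have hv' : v ∈ T.target := by
      simp only [mfld_simps] at hv
      exact hv.1
    have h1 : K i ((K i).symm (T.symm v, 0)) = (T.symm v, 0) :=
      (K i).right_inv (hKt i ▸ mem_univ _)
    simp only [mfld_simps, Function.comp_apply, ModelWithCorners.toHomeomorph]
    change J (J.symm (L' (T.prod (OpenPartialHomeomorph.refl ℝ)
      (K i ((K i).symm (T.symm v, 0)))))) = L' (v, 0)
    rw [h1, J.right_inv (J.range_eq_univ ▸ mem_univ _)]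
    simp [T.right_inv hv']

end LevelSet

/-! ### Orbit spaces of circle actions with equivariant charts -/

section Orbits

variable {P : Type*} [TopologicalSpace P] {act : Circle → P → P}

/-- The orbit space of a map `Circle → P → P`, which is an action in all uses below. -/
abbrev OrbitSpace (act : Circle → P → P) : Type _ := Quot fun a b : P ↦ ∃ u : Circle, act u a = b

/-- The orbit of a point. -/
abbrev orbitMk (act : Circle → P → P) (a : P) : OrbitSpace act := Quot.mk _ a

variable {G : Type*} [NormedAddCommGroup G]

variable (act G) in
/-- An equivariant chart: a homeomorphism of an invariant open subset of `P` onto `Circle × G` that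
turns `act` into the multiplication in the first factor. -/
structure CircleChart extends OpenPartialHomeomorph P (Circle × G) where
  target_eq : target = univ
  smul_mem : ∀ u, ∀ a ∈ source, act u a ∈ source
  map_smul : ∀ u, ∀ a ∈ source, toFun (act u a) = (u * (toFun a).1, (toFun a).2)

namespace CircleChart

variable (c : CircleChart act G) {a : P}

theorem mem_target (p : Circle × G) : p ∈ c.target := c.target_eq ▸ mem_univ _

theorem apply_smul (u : Circle) (ha : a ∈ c.source) :
    c.toOpenPartialHomeomorph (act u a) =
      (u * (c.toOpenPartialHomeomorph a).1, (c.toOpenPartialHomeomorph a).2) :=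
  c.map_smul u a ha

theorem apply_symm (p : Circle × G) :
    c.toOpenPartialHomeomorph (c.toOpenPartialHomeomorph.symm p) = p :=
  c.toOpenPartialHomeomorph.right_inv (c.mem_target p)

theorem symm_mem (p : Circle × G) : c.toOpenPartialHomeomorph.symm p ∈ c.source :=
  c.toOpenPartialHomeomorph.map_target (c.mem_target p)

theorem smul_eq (u : Circle) (ha : a ∈ c.source) : act u a = c.toOpenPartialHomeomorph.symm
    (u * (c.toOpenPartialHomeomorph a).1, (c.toOpenPartialHomeomorph a).2) := by
  rw [← c.apply_smul u ha, c.toOpenPartialHomeomorph.left_inv (c.smul_mem u a ha)]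

theorem smul_symm (u : Circle) (p : Circle × G) :
    act u (c.toOpenPartialHomeomorph.symm p) = c.toOpenPartialHomeomorph.symm (u * p.1, p.2) := by
  rw [c.smul_eq u (c.symm_mem p), c.apply_symm]

theorem one_smul (ha : a ∈ c.source) : act 1 a = a := by
  rw [c.smul_eq 1 ha, one_mul, c.toOpenPartialHomeomorph.left_inv ha]

theorem smul_smul (u v : Circle) (ha : a ∈ c.source) : act u (act v a) = act (u * v) a := by
  rw [c.smul_eq v ha, c.smul_symm, c.smul_eq _ ha, mul_assoc]

theorem eq_one_of_smul_eq {u : Circle} (ha : a ∈ c.source) (h : act u a = a) : u = 1 := by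
  have := congrArg Prod.fst (c.apply_smul u ha)
  rw [h] at this
  exact mul_eq_right.1 this.symm

theorem continuousAt_smul (u : Circle) (ha : a ∈ c.source) :
    ContinuousAt (fun p : Circle × P ↦ act p.1 p.2) (u, a) := by
  have h1 : ContinuousAt (fun p : Circle × P ↦ c.toOpenPartialHomeomorph p.2) (u, a) :=
    ContinuousAt.comp (f := Prod.snd) (c.toOpenPartialHomeomorph.continuousAt ha) continuousAt_snd
  have h2 : ContinuousAt (fun p : Circle × P ↦
      (p.1 * (c.toOpenPartialHomeomorph p.2).1, (c.toOpenPartialHomeomorph p.2).2)) (u, a) :=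
    (continuousAt_fst.mul h1.fst).prodMk h1.snd
  have h3 : ContinuousAt (fun p : Circle × P ↦ c.toOpenPartialHomeomorph.symm
      (p.1 * (c.toOpenPartialHomeomorph p.2).1, (c.toOpenPartialHomeomorph p.2).2)) (u, a) :=
    ContinuousAt.comp (g := c.toOpenPartialHomeomorph.symm)
      (c.toOpenPartialHomeomorph.continuousAt_symm (c.mem_target _)) h2
  refine h3.congr ?_
  filter_upwards [(c.open_source.preimage continuous_snd).mem_nhds
    (show (u, a) ∈ Prod.snd ⁻¹' c.source from ha)] with p hp
  exact (c.smul_eq p.1 hp).symm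

end CircleChart

variable (act G) in
/-- `P` is covered by equivariant charts; in particular `act` is a free continuous action. -/
def HasCircleCharts : Prop := ∀ a : P, ∃ c : CircleChart act G, a ∈ c.source

namespace HasCircleCharts

variable (h : HasCircleCharts act G)
include h

theorem one_smul (a : P) : act 1 a = a := by
  obtain ⟨c, ha⟩ := h a
  exact c.one_smul ha

theorem smul_smul (u v : Circle) (a : P) : act u (act v a) = act (u * v) a := by
  obtain ⟨c, ha⟩ := h a
  exact c.smul_smul u v ha

theorem inv_smul_smul (u : Circle) (a : P) : act u⁻¹ (act u a) = a := by
  rw [h.smul_smul, inv_mul_cancel, h.one_smul]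

theorem eq_one_of_smul_eq {u : Circle} {a : P} (hu : act u a = a) : u = 1 := by
  obtain ⟨c, ha⟩ := h a
  exact c.eq_one_of_smul_eq ha hu

theorem continuous_smul : Continuous fun p : Circle × P ↦ act p.1 p.2 :=
  continuous_iff_continuousAt.2 fun p ↦ by
    obtain ⟨c, ha⟩ := h p.2
    exact c.continuousAt_smul p.1 ha

theorem orbitMk_eq_iff {a b : P} : orbitMk act a = orbitMk act b ↔ ∃ u, act u a = b := by
  refine Equivalence.quot_mk_eq_iff (r := fun a b : P ↦ ∃ u : Circle, act u a = b)
    ⟨fun a ↦ ⟨1, h.one_smul a⟩, ?_, ?_⟩ a b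
  · rintro a _ ⟨u, rfl⟩
    exact ⟨u⁻¹, h.inv_smul_smul u a⟩
  · rintro a _ _ ⟨u, rfl⟩ ⟨v, rfl⟩
    exact ⟨v * u, (h.smul_smul v u a).symm⟩

theorem orbitMk_smul (u : Circle) (a : P) : orbitMk act (act u a) = orbitMk act a :=
  (h.orbitMk_eq_iff.2 ⟨u, rfl⟩).symm

theorem isOpenQuotientMap : IsOpenQuotientMap (orbitMk act) := by
  refine ⟨Quot.mk_surjective, continuous_quot_mk, fun U hU ↦ ?_⟩
  -- the saturation of `U` is the union of its translates
  have : IsOpen (orbitMk act ⁻¹' (orbitMk act '' U)) := by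
    have : orbitMk act ⁻¹' (orbitMk act '' U) = ⋃ u : Circle, act u ⁻¹' U := by
      ext b
      simp only [mem_preimage, mem_image, mem_iUnion]
      refine ⟨fun ⟨a, ha, hab⟩ ↦ ?_, fun ⟨u, hu⟩ ↦ ⟨_, hu, h.orbitMk_smul u b⟩⟩
      obtain ⟨u, rfl⟩ := h.orbitMk_eq_iff.1 hab.symm
      exact ⟨u, ha⟩
    rw [this]
    exact isOpen_iUnion fun u ↦ hU.preimage
      (h.continuous_smul.comp (Continuous.prodMk_right u))
  exact isOpen_coinduced.2 this

/-- The orbit space of a compact group acting on a Hausdorff space is Hausdorff: the orbit relation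
is the projection along the compact group of the closed set `{(u, a, b) | u a = b}`. -/
theorem t2Space [T2Space P] : T2Space (OrbitSpace act) := by
  rw [t2Space_iff_of_isOpenQuotientMap h.isOpenQuotientMap]
  -- the orbit relation is the projection of this set along the compact factor `Circle`
  have h1 : IsClosed {p : Circle × P × P | act p.1 p.2.1 = p.2.2} := by
    refine isClosed_eq (h.continuous_smul.comp (by fun_prop : Continuous
      fun p : Circle × P × P ↦ (p.1, p.2.1))) (by fun_prop)
  convert isClosedMap_snd_of_compactSpace _ h1
  ext p
  simp [h.orbitMk_eq_iff]

theorem secondCountableTopology [SecondCountableTopology P] :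
    SecondCountableTopology (OrbitSpace act) :=
  h.isOpenQuotientMap.isQuotientMap.secondCountableTopology h.isOpenQuotientMap.isOpenMap

end HasCircleCharts

namespace CircleChart

variable (c : CircleChart act G)

/-- The second component of an equivariant chart, on orbits. Outside of the orbits in the source of
the chart the value is irrelevant. -/
def orbitFun (q : OrbitSpace act) : G := (c.toOpenPartialHomeomorph q.out).2

theorem mem_source_iff (h : HasCircleCharts act G) {a b : P}
    (hab : orbitMk act a = orbitMk act b) : a ∈ c.source ↔ b ∈ c.source := by
  obtain ⟨u, rfl⟩ := h.orbitMk_eq_iff.1 hab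
  refine ⟨c.smul_mem u a, fun hb ↦ ?_⟩
  rw [← h.inv_smul_smul u a]
  exact c.smul_mem _ _ hb

theorem orbitMk_mem_iff (h : HasCircleCharts act G) {a : P} :
    orbitMk act a ∈ orbitMk act '' c.source ↔ a ∈ c.source := by
  refine ⟨?_, mem_image_of_mem _⟩
  rintro ⟨b, hb, hab⟩
  exact (c.mem_source_iff h hab).1 hb

theorem orbitFun_mk (h : HasCircleCharts act G) {a : P} (ha : a ∈ c.source) :
    c.orbitFun (orbitMk act a) = (c.toOpenPartialHomeomorph a).2 := by
  obtain ⟨u, hu⟩ := h.orbitMk_eq_iff.1 (Quot.out_eq (orbitMk act a)).symm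
  rw [orbitFun, ← hu, c.apply_smul u ha]

/-- The chart of the orbit space induced by an equivariant chart. -/
def orbitChart (h : HasCircleCharts act G) : OpenPartialHomeomorph (OrbitSpace act) G where
  toFun := c.orbitFun
  invFun y := orbitMk act (c.toOpenPartialHomeomorph.symm (1, y))
  source := orbitMk act '' c.source
  target := univ
  map_source' _ _ := mem_univ _
  map_target' y _ := mem_image_of_mem _ (c.symm_mem _)
  left_inv' := by
    rintro _ ⟨a, ha, rfl⟩
    rw [c.orbitFun_mk h ha]
    refine h.orbitMk_eq_iff.2 ⟨(c.toOpenPartialHomeomorph a).1, ?_⟩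
    rw [c.smul_symm, mul_one, Prod.mk.eta, c.toOpenPartialHomeomorph.left_inv ha]
  right_inv' y _ := by
    rw [c.orbitFun_mk h (c.symm_mem _), c.apply_symm]
  open_source := h.isOpenQuotientMap.isOpenMap _ c.open_source
  open_target := isOpen_univ
  continuousOn_toFun := by
    rw [continuousOn_open_iff (h.isOpenQuotientMap.isOpenMap _ c.open_source)]
    intro t ht
    have : orbitMk act '' c.source ∩ c.orbitFun ⁻¹' t = orbitMk act ''
        (c.source ∩ c.toOpenPartialHomeomorph ⁻¹' (univ ×ˢ t)) := by
      ext q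
      constructor
      · rintro ⟨⟨a, ha, rfl⟩, hq⟩
        rw [mem_preimage, c.orbitFun_mk h ha] at hq
        exact ⟨a, ⟨ha, mem_univ _, hq⟩, rfl⟩
      · rintro ⟨a, ⟨ha, -, hq⟩, rfl⟩
        refine ⟨⟨a, ha, rfl⟩, ?_⟩
        rwa [mem_preimage, c.orbitFun_mk h ha]
    rw [this]
    exact h.isOpenQuotientMap.isOpenMap _
      (c.toOpenPartialHomeomorph.isOpen_inter_preimage (isOpen_univ.prod ht))
  continuousOn_invFun := by
    refine Continuous.continuousOn (continuous_quot_mk.comp ?_)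
    exact (c.target_eq ▸ c.toOpenPartialHomeomorph.continuousOn_symm).comp_continuous
      (by fun_prop) fun _ ↦ mem_univ _

theorem mk_mem_orbitChart_source (h : HasCircleCharts act G) {a : P} :
    orbitMk act a ∈ (c.orbitChart h).source ↔ a ∈ c.source :=
  c.orbitMk_mem_iff h

theorem orbitChart_mk (h : HasCircleCharts act G) {a : P} (ha : a ∈ c.source) :
    c.orbitChart h (orbitMk act a) = (c.toOpenPartialHomeomorph a).2 :=
  c.orbitFun_mk h ha

theorem orbitMk_symm (h : HasCircleCharts act G) (u : Circle) (y : G) :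
    orbitMk act (c.toOpenPartialHomeomorph.symm (u, y)) = (c.orbitChart h).symm y :=
  h.orbitMk_eq_iff.2 ⟨u⁻¹, by rw [c.smul_symm, inv_mul_cancel]⟩

/-- The trivialization of the orbit map defined by an equivariant chart. -/
def trivialization (h : HasCircleCharts act G) : Bundle.Trivialization Circle (orbitMk act) where
  toFun a := (orbitMk act a, (c.toOpenPartialHomeomorph a).1)
  invFun p := c.toOpenPartialHomeomorph.symm (p.2, c.orbitChart h p.1)
  source := c.source
  target := (c.orbitChart h).source ×ˢ univ
  baseSet := (c.orbitChart h).source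
  map_source' a ha := ⟨mem_image_of_mem _ ha, mem_univ _⟩
  map_target' p _ := c.symm_mem _
  left_inv' a ha := by
    rw [c.orbitChart_mk h ha, Prod.mk.eta, c.toOpenPartialHomeomorph.left_inv ha]
  right_inv' p hp := by
    rw [c.apply_symm, c.orbitMk_symm h, (c.orbitChart h).left_inv hp.1]
  open_source := c.open_source
  open_target := (c.orbitChart h).open_source.prod isOpen_univ
  continuousOn_toFun := continuous_quot_mk.continuousOn.prodMk
    (continuous_fst.comp_continuousOn c.toOpenPartialHomeomorph.continuousOn)
  continuousOn_invFun := by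
    refine (c.target_eq ▸ c.toOpenPartialHomeomorph.continuousOn_symm).comp
      (continuousOn_snd.prodMk ((c.orbitChart h).continuousOn.comp continuousOn_fst
        fun p hp ↦ hp.1)) fun _ _ ↦ mem_univ _
  open_baseSet := (c.orbitChart h).open_source
  source_eq := by
    ext a
    exact (c.orbitMk_mem_iff h).symm
  target_eq := rfl
  proj_toFun _ _ := rfl

end CircleChart

/-! ### Smooth structure of the orbit space -/

variable [NormedSpace ℝ G] {EJ HJ : Type*} [NormedAddCommGroup EJ] [NormedSpace ℝ EJ]
  [TopologicalSpace HJ] {J : ModelWithCorners ℝ EJ HJ} [ChartedSpace HJ P]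
  {ι : Type*} {C : ι → CircleChart act G}

theorem contMDiff_symm_section {c : CircleChart act G}
    (hc : IsPartialDiffeo J ((𝓡 1).prod 𝓘(ℝ, G)) c.toOpenPartialHomeomorph) (u : Circle) :
    ContMDiff 𝓘(ℝ, G) J ∞ fun y ↦ c.toOpenPartialHomeomorph.symm (u, y) := by
  have := hc.2
  rw [c.target_eq, contMDiffOn_univ] at this
  exact this.comp (contMDiff_const.prodMk contMDiff_id)

/-- The orbit space of a manifold covered by smooth equivariant charts is a manifold, and the
orbit map is a submersion. -/
theorem exists_chartedSpace_orbitSpace [J.Boundaryless] [IsManifold J ∞ P]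
    (h : HasCircleCharts act G)
    (hcov : ∀ a, ∃ i, a ∈ (C i).source)
    (hC : ∀ i, IsPartialDiffeo J ((𝓡 1).prod 𝓘(ℝ, G)) (C i).toOpenPartialHomeomorph)
    {k : ℕ} (L : G ≃L[ℝ] EuclideanSpace ℝ (Fin k))
    (L' : (EuclideanSpace ℝ (Fin 1) × G) ≃L[ℝ] EJ) :
    ∃ _ : ChartedSpace (EuclideanSpace ℝ (Fin k)) (OrbitSpace act),
      IsManifold (𝓡 k) ∞ (OrbitSpace act) ∧ IsSubmersion J (𝓡 k) ∞ (orbitMk act) ∧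
      ∀ i, IsPartialDiffeo (𝓡 k) 𝓘(ℝ, G) ((C i).orbitChart h) := by
  obtain ⟨cs, hm, hQ⟩ := exists_chartedSpace_of_transitions (I₀ := 𝓘(ℝ, G))
    (fun i ↦ (C i).orbitChart h)
    (fun q ↦ by
      obtain ⟨a, rfl⟩ := Quot.mk_surjective q
      obtain ⟨i, hi⟩ := hcov a
      exact ⟨i, mem_image_of_mem _ hi⟩)
    (fun i j ↦ by
      have h2 := contMDiff_snd.comp_contMDiffOn ((hC j).1.comp
        (contMDiff_symm_section (hC i) 1).contMDiffOn
        (s := (((C i).orbitChart h).symm ≫ₕ (C j).orbitChart h).source) fun y hy ↦ ?_)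
      · refine h2.congr fun y hy ↦ ?_
        rw [OpenPartialHomeomorph.trans_source] at hy
        exact (C j).orbitChart_mk h (((C j).mk_mem_orbitChart_source h).1 hy.2)
      · rw [OpenPartialHomeomorph.trans_source] at hy
        exact ((C j).mk_mem_orbitChart_source h).1 hy.2) L
  refine ⟨cs, hm, ?_, hQ⟩
  refine IsSubmersionOfComplement.isSubmersion (F := EuclideanSpace ℝ (Fin 1)) fun a ↦ ?_
  obtain ⟨i, hi⟩ := hcov a
  set c := (C i).toOpenPartialHomeomorph with hc
  let T : OpenPartialHomeomorph Circle (EuclideanSpace ℝ (Fin 1)) :=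
    chartAt (EuclideanSpace ℝ (Fin 1)) (c a).1
  have hTm : (c a).1 ∈ T.source := mem_chart_source _ _
  -- in the charts `dom` and `cod`, the orbit map is the projection `(t, y) ↦ y`
  let dom : OpenPartialHomeomorph P HJ := c ≫ₕ T.prod (OpenPartialHomeomorph.refl G) ≫ₕ
    L'.toHomeomorph.toOpenPartialHomeomorph ≫ₕ J.toHomeomorph.toOpenPartialHomeomorph.symm
  let cod : OpenPartialHomeomorph (OrbitSpace act) (EuclideanSpace ℝ (Fin k)) :=
    (C i).orbitChart h ≫ₕ L.toHomeomorph.toOpenPartialHomeomorph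
  refine IsSubmersionAtOfComplement.mk_of_continuousAt continuous_quot_mk.continuousAt
    (L'.symm.trans ((ContinuousLinearEquiv.prodComm ℝ _ _).trans
      (L.prodCongr (ContinuousLinearEquiv.refl ℝ _)))) dom cod ?_ ?_ ?_ ?_ ?_
  · simp only [dom, mfld_simps]
    exact ⟨hi, hTm⟩
  · simp only [cod, mfld_simps]
    exact ((C i).mk_mem_orbitChart_source h).2 hi
  · refine IsPartialDiffeo.mem_maximalAtlas (I := J) ?_
    exact (hC i).trans (((IsPartialDiffeo.chartAt (I := 𝓡 1) _).prod IsPartialDiffeo.refl).trans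
      ((IsPartialDiffeo.linear_prod L').trans IsPartialDiffeo.model.symm))
  · exact ((hQ i).trans (IsPartialDiffeo.linear L)).mem_maximalAtlas
  · intro v hv
    have hv' : (L'.symm v).1 ∈ T.target := by
      simp only [dom, mfld_simps] at hv
      have : (L'.symm (J (J.symm v))).1 ∈ T.target := hv.2.1
      rw [J.right_inv (J.range_eq_univ ▸ mem_univ _)] at this
      exact this
    have e1 : (dom.extend J).symm v =
        c.symm (T.symm (L'.symm v).1, (L'.symm v).2) := by
      simp only [dom, mfld_simps, Function.comp_apply]
      change c.symm ((T.prod (OpenPartialHomeomorph.refl G)).symm (L'.symm (J (J.symm v)))) = _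
      rw [J.right_inv (J.range_eq_univ ▸ mem_univ _)]
      rfl
    change L ((C i).orbitChart h (orbitMk act ((dom.extend J).symm v))) = L (L'.symm v).2
    rw [e1, (C i).orbitChart_mk h ((C i).symm_mem _), (C i).apply_symm]

variable {k : ℕ} [ChartedSpace (EuclideanSpace ℝ (Fin k)) (OrbitSpace act)]
  {E' H' M' : Type*} [NormedAddCommGroup E'] [NormedSpace ℝ E'] [TopologicalSpace H']
  {I' : ModelWithCorners ℝ E' H'} [TopologicalSpace M'] [ChartedSpace H' M']

/-- A map on the orbit space is smooth if its composition with the orbit map is. -/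
theorem contMDiff_of_comp_orbitMk (h : HasCircleCharts act G)
    (hcov : ∀ a, ∃ i, a ∈ (C i).source)
    (hC : ∀ i, IsPartialDiffeo J ((𝓡 1).prod 𝓘(ℝ, G)) (C i).toOpenPartialHomeomorph)
    (hQ : ∀ i, IsPartialDiffeo (𝓡 k) 𝓘(ℝ, G) ((C i).orbitChart h))
    {g : OrbitSpace act → M'} (hg : ContMDiff J I' ∞ (g ∘ orbitMk act)) :
    ContMDiff (𝓡 k) I' ∞ g := by
  intro q
  obtain ⟨a, rfl⟩ := Quot.mk_surjective q
  obtain ⟨i, hi⟩ := hcov a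
  have hi' : orbitMk act a ∈ ((C i).orbitChart h).source := mem_image_of_mem _ hi
  have h1 := (hg.comp (contMDiff_symm_section (hC i) 1)).contMDiffAt.comp _
    ((hQ i).contMDiffAt hi')
  refine h1.congr_of_eventuallyEq ?_
  filter_upwards [((C i).orbitChart h).open_source.mem_nhds hi'] with q hq
  exact congrArg g (((C i).orbitChart h).left_inv hq).symm

end Orbits

section Principal

variable {d k : ℕ} {P G : Type*} [TopologicalSpace P] [ChartedSpace (EuclideanSpace ℝ (Fin d)) P]
  {act : Circle → P → P} [NormedAddCommGroup G] [NormedSpace ℝ G]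
  [ChartedSpace (EuclideanSpace ℝ (Fin k)) (OrbitSpace act)] {ι : Type*}
  {C : ι → CircleChart act G}

/-- The orbit map of a manifold covered by smooth equivariant charts is a principal bundle: each
such chart is a local trivialization. -/
theorem isPrincipalCircleBundle_orbitMk (h : HasCircleCharts act G)
    (hcov : ∀ a, ∃ i, a ∈ (C i).source)
    (hC : ∀ i, IsPartialDiffeo (𝓡 d) ((𝓡 1).prod 𝓘(ℝ, G)) (C i).toOpenPartialHomeomorph)
    (hmk : ContMDiff (𝓡 d) (𝓡 k) ∞ (orbitMk act))
    (hQ : ∀ i, IsPartialDiffeo (𝓡 k) 𝓘(ℝ, G) ((C i).orbitChart h)) :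
    IsPrincipalCircleBundle d k act (orbitMk act) := by
  intro q
  obtain ⟨a, rfl⟩ := Quot.mk_surjective q
  obtain ⟨i, hi⟩ := hcov a
  refine ⟨(C i).trivialization h, mem_image_of_mem _ hi, ?_, ?_, fun u a ha ↦
    ⟨(C i).smul_mem u a ha, ?_⟩⟩
  · exact hmk.contMDiffOn.prodMk (contMDiff_fst.comp_contMDiffOn (hC i).1)
  · have h1 := (hC i).2
    rw [(C i).target_eq, contMDiffOn_univ] at h1
    exact h1.comp_contMDiffOn (contMDiffOn_snd.prodMk ((hQ i).1.comp contMDiffOn_fst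
      fun p hp ↦ hp.1))
  · exact Prod.ext (h.orbitMk_smul u a) (congrArg Prod.fst ((C i).apply_smul u ha))

end Principal

/-! ### Slices for a free circle action -/

section LocalDiffeo

variable {E H M E' H' M' : Type*}
  [NormedAddCommGroup E] [NormedSpace ℝ E] [TopologicalSpace H] {I : ModelWithCorners ℝ E H}
  [TopologicalSpace M] [ChartedSpace H M]
  [NormedAddCommGroup E'] [NormedSpace ℝ E'] [TopologicalSpace H'] {I' : ModelWithCorners ℝ E' H'}
  [TopologicalSpace M'] [ChartedSpace H' M']

theorem IsPartialDiffeo.isLocalDiffeomorphAt {e : OpenPartialHomeomorph M M'}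
    (h : IsPartialDiffeo I I' e) {f : M → M'} {x : M} (hx : x ∈ e.source)
    (hf : EqOn f e e.source) : IsLocalDiffeomorphAt I I' ∞ f x :=
  ⟨⟨e.toPartialEquiv, e.open_source, e.open_target, h.1, h.2⟩, hx, hf⟩

theorem exists_isPartialDiffeo_of_isLocalDiffeomorphAt {f : M → M'} {x : M}
    (h : IsLocalDiffeomorphAt I I' ∞ f x) : ∃ e : OpenPartialHomeomorph M M',
      IsPartialDiffeo I I' e ∧ x ∈ e.source ∧ EqOn f e e.source := by
  obtain ⟨Φ, hx, hf⟩ := h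
  exact ⟨Φ.toOpenPartialHomeomorph, ⟨Φ.contMDiffOn_toFun, Φ.contMDiffOn_invFun⟩, hx, hf⟩

/-- The inverse function theorem, with the inverse smooth on a whole neighbourhood: the derivative
is assumed to be invertible on an open set, not only at one point. -/
theorem exists_isPartialDiffeo_of_hasFDerivAt [CompleteSpace E] {f : E → E'} {O : Set E}
    (hO : IsOpen O) (hf : ContDiffOn ℝ ∞ f O)
    (hf' : ∀ x ∈ O, ∃ A : E ≃L[ℝ] E', HasFDerivAt f (A : E →L[ℝ] E') x) {x : E} (hx : x ∈ O) :
    ∃ e : OpenPartialHomeomorph E E', IsPartialDiffeo 𝓘(ℝ, E) 𝓘(ℝ, E') e ∧ x ∈ e.source ∧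
      e.source ⊆ O ∧ EqOn f e e.source := by
  have hfa : ∀ y ∈ O, ContDiffAt ℝ ∞ f y := fun y hy ↦ hf.contDiffAt (hO.mem_nhds hy)
  obtain ⟨A, hA⟩ := hf' x hx
  let e := ((hfa x hx).toOpenPartialHomeomorph f hA (by simp)).restrOpen O hO
  have hes : e.source ⊆ O := by
    intro y hy
    simp only [e, OpenPartialHomeomorph.restrOpen_source] at hy
    exact hy.2
  refine ⟨e, ⟨contMDiffOn_iff_contDiffOn.2 (hf.mono hes), contMDiffOn_iff_contDiffOn.2 ?_⟩, ?_, hes,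
    fun _ _ ↦ rfl⟩
  · intro y hy
    obtain ⟨B, hB⟩ := hf' _ (hes (e.map_target hy))
    exact (e.contDiffAt_symm hy hB (hfa _ (hes (e.map_target hy)))).contDiffWithinAt
  · simp only [e, OpenPartialHomeomorph.restrOpen_source]
    exact ⟨(hfa x hx).mem_toOpenPartialHomeomorph_source hA (by simp), hx⟩

end LocalDiffeo

section Slice

variable {n : ℕ} {V : Type*} [TopologicalSpace V] [ChartedSpace (EuclideanSpace ℝ (Fin n)) V]
  [MulAction Circle V] [ContMDiffSMul (𝓡 1) (𝓡 n) ∞ Circle V]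

/-- The fundamental vector field of a free circle action vanishes nowhere: otherwise all points of
an orbit near `x` would be equal to `x`. -/
theorem fundamentalField_ne_zero [IsManifold (𝓡 n) ∞ V]
    (hfree : ∀ (u : Circle) (x : V), u • x = x → u = 1) (x : V) : fundamentalField n x ≠ 0 := by
  intro h0
  let c : ℝ → V := fun t ↦ Circle.exp t • x
  have hc : ContMDiff 𝓘(ℝ, ℝ) (𝓡 n) ∞ c :=
    ContMDiff.smul (I := 𝓡 1) contMDiff_circleExp contMDiff_const
  have hX : ∀ t : ℝ, fundamentalField n (c t) = 0 := fun t ↦ by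
    rw [← mfderiv_smul_fundamentalField, h0, map_zero]
  -- the orbit curve through `x` is a translate of itself, hence has zero derivative everywhere
  have hd : ∀ t, HasMFDerivAt 𝓘(ℝ, ℝ) (𝓡 n) c t 0 := by
    intro t
    have h1 : HasMFDerivAt 𝓘(ℝ, ℝ) (𝓡 n) (fun s : ℝ ↦ Circle.exp s • c t) 0
        (0 : ℝ →L[ℝ] EuclideanSpace ℝ (Fin n)) := by
      have h2 := (mdifferentiable_exp_smul (n := n) (c t) 0).hasMFDerivAt
      have h3 : (mfderiv 𝓘(ℝ, ℝ) (𝓡 n) (fun s : ℝ ↦ Circle.exp s • c t) 0 :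
          ℝ →L[ℝ] EuclideanSpace ℝ (Fin n)) = 0 := by
        refine ContinuousLinearMap.ext_ring ?_
        exact hX t
      exact h3 ▸ h2
    have h4 : HasMFDerivAt 𝓘(ℝ, ℝ) 𝓘(ℝ, ℝ) (fun s : ℝ ↦ s - t) t
        (ContinuousLinearMap.id ℝ ℝ) :=
      ((hasFDerivAt_id t).sub_const t).hasMFDerivAt
    have h5 := HasMFDerivAt.comp (g := fun s : ℝ ↦ Circle.exp s • c t) t
      (by rw [sub_self]; exact h1) h4
    have h6 : (fun s : ℝ ↦ Circle.exp s • c t) ∘ (fun s : ℝ ↦ s - t) = c := by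
      funext s
      simp only [Function.comp_apply, c, smul_smul, ← Circle.exp_add, sub_add_cancel]
    rw [h6] at h5
    exact h5
  let φ := chartAt (EuclideanSpace ℝ (Fin n)) x
  have hc0 : c 0 = x := by simp [c]
  obtain ⟨ε, hε, hball⟩ := Metric.isOpen_iff.1 (φ.open_source.preimage hc.continuous) 0
    (by simp only [mem_preimage, hc0]; exact mem_chart_source _ x)
  have hd' : ∀ t ∈ Metric.ball (0 : ℝ) ε, HasDerivAt (φ ∘ c) 0 t := by
    intro t ht
    have h1 : MDifferentiableAt (𝓡 n) (𝓡 n) φ (c t) :=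
      ((IsPartialDiffeo.chartAt (I := 𝓡 n) x).contMDiffAt (hball ht)).mdifferentiableAt (by simp)
    have h2 : HasMFDerivAt 𝓘(ℝ, ℝ) 𝓘(ℝ, EuclideanSpace ℝ (Fin n)) (φ ∘ c) t
        (0 : ℝ →L[ℝ] EuclideanSpace ℝ (Fin n)) := by
      have h3 := h1.hasMFDerivAt.comp t (hd t)
      rwa [ContinuousLinearMap.comp_zero] at h3
    have h4 : HasFDerivAt (φ ∘ c) (0 : ℝ →L[ℝ] EuclideanSpace ℝ (Fin n)) t := h2.hasFDerivAt
    simpa using h4.hasDerivAt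
  have hconst : ∀ t ∈ Metric.ball (0 : ℝ) ε, (φ ∘ c) t = (φ ∘ c) 0 := fun t ht ↦
    Metric.isOpen_ball.is_const_of_deriv_eq_zero (convex_ball (0 : ℝ) ε).isPreconnected
      (fun s hs ↦ (hd' s hs).differentiableAt.differentiableWithinAt)
      (fun s hs ↦ (hd' s hs).deriv) ht (Metric.mem_ball_self hε)
  -- `exp(it)` with `0 < t < 1` fixes `x`, although it is not `1`
  obtain ⟨t, ht0, ht1⟩ : ∃ t, 0 < t ∧ t < min ε 1 := exists_between (by positivity)
  have htb : t ∈ Metric.ball (0 : ℝ) ε := by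
    rw [Metric.mem_ball, Real.dist_eq, sub_zero, abs_of_pos ht0]
    exact ht1.trans_le (min_le_left _ _)
  have h1 := φ.injOn (hball htb) (hball (Metric.mem_ball_self hε)) (hconst t htb)
  rw [hc0] at h1
  have h2 := hfree _ x h1
  have h3 := Circle.exp_injOn_Ico (a := 0) (b := 2 * Real.pi) (by simp)
    (show t ∈ Ico 0 (2 * Real.pi) from ⟨ht0.le, by
      have := Real.pi_gt_three
      have := ht1.trans_le (min_le_right _ _)
      linarith⟩) (show (0 : ℝ) ∈ Ico 0 (2 * Real.pi) from ⟨le_rfl, by positivity⟩)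
    (by rw [h2, Circle.exp_zero])
  exact ht0.ne' h3

/-- A vector and a hyperplane transverse to it. -/
theorem exists_transverse_hyperplane (hn : 1 ≤ n) (v : EuclideanSpace ℝ (Fin n)) (hv : v ≠ 0) :
    ∃ (ι : EuclideanSpace ℝ (Fin (n - 1)) →L[ℝ] EuclideanSpace ℝ (Fin n))
      (A : (ℝ × EuclideanSpace ℝ (Fin (n - 1))) ≃L[ℝ] EuclideanSpace ℝ (Fin n)),
      ∀ p, A p = p.1 • v + ι p.2 := by
  have : Fact (Module.finrank ℝ (EuclideanSpace ℝ (Fin n)) = n - 1 + 1) :=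
    ⟨by simp; omega⟩
  have hfr : Module.finrank ℝ (EuclideanSpace ℝ (Fin (n - 1))) =
      Module.finrank ℝ (ℝ ∙ v)ᗮ := by
    rw [Submodule.finrank_orthogonal_span_singleton (n := n - 1) hv, finrank_euclideanSpace_fin]
  let κ := ContinuousLinearEquiv.ofFinrankEq hfr
  let ι : EuclideanSpace ℝ (Fin (n - 1)) →L[ℝ] EuclideanSpace ℝ (Fin n) :=
    (ℝ ∙ v)ᗮ.subtypeL.comp (κ : EuclideanSpace ℝ (Fin (n - 1)) →L[ℝ] (ℝ ∙ v)ᗮ)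
  let B : (ℝ × EuclideanSpace ℝ (Fin (n - 1))) →L[ℝ] EuclideanSpace ℝ (Fin n) :=
    ((ContinuousLinearMap.fst ℝ ℝ _).smulRight v) + ι.comp (ContinuousLinearMap.snd ℝ ℝ _)
  have hB : Function.Injective B.toLinearMap := by
    rw [← LinearMap.ker_eq_bot, LinearMap.ker_eq_bot']
    rintro ⟨t, w⟩ h
    have h' : t • v + (κ w : EuclideanSpace ℝ (Fin n)) = 0 := h
    have h1 : inner ℝ v (κ w : EuclideanSpace ℝ (Fin n)) = 0 :=
      (Submodule.mem_orthogonal_singleton_iff_inner_right.1 (κ w).2)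
    have h2 : t = 0 := by
      have := congrArg (inner ℝ v) h'
      rw [inner_add_right, h1, inner_smul_right, inner_zero_right, add_zero] at this
      exact (mul_eq_zero.1 this).resolve_right (inner_self_ne_zero.2 hv)
    subst h2
    rw [zero_smul, zero_add] at h'
    have : κ w = 0 := Subtype.ext h'
    simpa using this
  exact ⟨ι, (LinearEquiv.ofInjectiveOfFinrankEq B.toLinearMap hB
    (by simp; omega)).toContinuousLinearEquiv, fun p ↦ rfl⟩

end Slice

section Slice

variable {n : ℕ} {V : Type*} [TopologicalSpace V] [ChartedSpace (EuclideanSpace ℝ (Fin n)) V]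
  [MulAction Circle V] [ContMDiffSMul (𝓡 1) (𝓡 n) ∞ Circle V] [IsManifold (𝓡 n) ∞ V]

/-- Through every point there is a local hypersurface `σ` transverse to the orbits, that is, the
map `(t, w) ↦ exp(it) • σ(w)` is a local diffeomorphism along `t = 0`. -/
theorem exists_transverse_section (hn : 1 ≤ n)
    (hfree : ∀ (u : Circle) (x : V), u • x = x → u = 1) (x₀ : V) :
    ∃ (σ : EuclideanSpace ℝ (Fin (n - 1)) → V) (r : ℝ), 0 < r ∧ σ 0 = x₀ ∧
      ContMDiffOn 𝓘(ℝ, EuclideanSpace ℝ (Fin (n - 1))) (𝓡 n) ∞ σ (Metric.ball 0 r) ∧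
      ∀ w ∈ Metric.ball 0 r, ∃ e : OpenPartialHomeomorph (ℝ × EuclideanSpace ℝ (Fin (n - 1))) V,
        IsPartialDiffeo 𝓘(ℝ, ℝ × EuclideanSpace ℝ (Fin (n - 1))) (𝓡 n) e ∧ (0, w) ∈ e.source ∧
        EqOn (fun p ↦ Circle.exp p.1 • σ p.2) e e.source := by
  have hφd : IsPartialDiffeo (𝓡 n) (𝓡 n) (chartAt (EuclideanSpace ℝ (Fin n)) x₀) :=
    IsPartialDiffeo.chartAt x₀
  have hx₀ : x₀ ∈ (chartAt (EuclideanSpace ℝ (Fin n)) x₀).source := mem_chart_source _ x₀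
  set φ := chartAt (EuclideanSpace ℝ (Fin n)) x₀
  -- the velocity of the orbit of `x₀`, in the chart `φ`
  have hφl : IsLocalDiffeomorphAt (𝓡 n) (𝓡 n) ∞ φ x₀ :=
    hφd.isLocalDiffeomorphAt hx₀ fun _ _ ↦ rfl
  obtain ⟨v, hv0, hv⟩ : ∃ v : EuclideanSpace ℝ (Fin n), v ≠ 0 ∧
      HasDerivAt (fun t : ℝ ↦ φ (Circle.exp t • x₀)) v 0 := by
    let B : EuclideanSpace ℝ (Fin n) ≃L[ℝ] EuclideanSpace ℝ (Fin n) :=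
      hφl.mfderivToContinuousLinearEquiv (by simp)
    refine ⟨B (fundamentalField n x₀), ?_, ?_⟩
    · intro h
      exact fundamentalField_ne_zero hfree x₀ ((map_eq_zero_iff B B.injective).1 h)
    · have h1 := (mdifferentiable_exp_smul (n := n) x₀ 0).hasMFDerivAt
      have h2 : HasMFDerivAt (𝓡 n) (𝓡 n) φ (Circle.exp 0 • x₀)
          (B : EuclideanSpace ℝ (Fin n) →L[ℝ] EuclideanSpace ℝ (Fin n)) := by
        rw [Circle.exp_zero, one_smul]
        exact (hφl.mdifferentiableAt (by simp)).hasMFDerivAt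
      have h3 : HasFDerivAt (φ ∘ fun t : ℝ ↦ Circle.exp t • x₀)
          ((B : EuclideanSpace ℝ (Fin n) →L[ℝ] EuclideanSpace ℝ (Fin n)).comp
            (mfderiv 𝓘(ℝ, ℝ) (𝓡 n) (fun t : ℝ ↦ Circle.exp t • x₀) 0 :
              ℝ →L[ℝ] EuclideanSpace ℝ (Fin n))) 0 := (h2.comp (0 : ℝ) h1).hasFDerivAt
      exact h3.hasDerivAt
  -- the section is an affine hyperplane in the chart, transverse to `v`
  obtain ⟨ι, A, hA⟩ := exists_transverse_hyperplane hn v hv0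
  let F := EuclideanSpace ℝ (Fin (n - 1))
  let σ : F → V := fun w ↦ φ.symm (φ x₀ + ι w)
  let W : Set F := {w | φ x₀ + ι w ∈ φ.target}
  have hcw : Continuous fun w : F ↦ φ x₀ + ι w := by fun_prop
  have hW : IsOpen W := φ.open_target.preimage hcw
  have h0W : (0 : F) ∈ W := by
    change φ x₀ + ι 0 ∈ φ.target
    rw [map_zero, add_zero]
    exact φ.map_source hx₀
  have hσ0 : σ 0 = x₀ := by
    change φ.symm (φ x₀ + ι 0) = x₀
    rw [map_zero, add_zero, φ.left_inv hx₀]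
  have hσ : ContMDiffOn 𝓘(ℝ, F) (𝓡 n) ∞ σ W := by
    refine hφd.2.comp (ContDiff.contMDiff ?_).contMDiffOn fun w hw ↦ hw
    exact contDiff_const.add ι.contDiff
  let Ψ : ℝ × F → V := fun p ↦ Circle.exp p.1 • σ p.2
  have hΨ : ContMDiffOn 𝓘(ℝ, ℝ × F) (𝓡 n) ∞ Ψ (univ ×ˢ W) :=
    ContMDiffOn.smul (I := 𝓡 1)
      (contMDiff_circleExp.comp contDiff_fst.contMDiff).contMDiffOn
      (hσ.comp contDiff_snd.contMDiff.contMDiffOn fun p hp ↦ hp.2)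
  -- `O` is the set on which `Ψ` can be read in the chart `φ`
  let O : Set (ℝ × F) := (univ ×ˢ W) ∩ Ψ ⁻¹' φ.source
  have hO : IsOpen O :=
    hΨ.continuousOn.isOpen_inter_preimage (isOpen_univ.prod hW) φ.open_source
  have h0O : (0 : ℝ × F) ∈ O := by
    refine ⟨⟨mem_univ _, h0W⟩, ?_⟩
    change Circle.exp 0 • σ 0 ∈ φ.source
    rwa [Circle.exp_zero, one_smul, hσ0]
  have hψ : ContDiffOn ℝ ∞ (φ ∘ Ψ) O :=
    contMDiffOn_iff_contDiffOn.1 (hφd.1.comp (hΨ.mono inter_subset_left) inter_subset_right)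
  have hψd : ∀ p ∈ O, HasFDerivAt (φ ∘ Ψ) (fderiv ℝ (φ ∘ Ψ) p) p := fun p hp ↦
    ((hψ.contDiffAt (hO.mem_nhds hp)).differentiableAt (by simp)).hasFDerivAt
  have hD : fderiv ℝ (φ ∘ Ψ) 0 = (A : (ℝ × F) →L[ℝ] EuclideanSpace ℝ (Fin n)) := by
    have h1 : fderiv ℝ (φ ∘ Ψ) 0 (1, 0) = v := by
      have h2 : HasFDerivAt (fun t : ℝ ↦ (t, (0 : F))) (ContinuousLinearMap.inl ℝ ℝ F) 0 :=
        (ContinuousLinearMap.inl ℝ ℝ F).hasFDerivAt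
      have h3 := (HasFDerivAt.comp (0 : ℝ) (hψd 0 h0O) h2).hasDerivAt
      have h4 : (φ ∘ Ψ) ∘ (fun t : ℝ ↦ (t, (0 : F))) = fun t ↦ φ (Circle.exp t • x₀) := by
        funext t
        simp only [Function.comp_apply, Ψ, hσ0]
      rw [h4] at h3
      exact h3.unique hv
    have h5 : (fderiv ℝ (φ ∘ Ψ) 0).comp (ContinuousLinearMap.inr ℝ ℝ F) = ι := by
      have h2 : HasFDerivAt (fun w : F ↦ ((0 : ℝ), w)) (ContinuousLinearMap.inr ℝ ℝ F) 0 :=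
        (ContinuousLinearMap.inr ℝ ℝ F).hasFDerivAt
      have h3 := HasFDerivAt.comp (0 : F) (hψd 0 h0O) h2
      refine h3.unique ((ι.hasFDerivAt.const_add (φ x₀)).congr_of_eventuallyEq ?_)
      filter_upwards [hW.mem_nhds h0W] with w hw
      simp only [Function.comp_apply, Ψ, σ, Circle.exp_zero, one_smul]
      exact φ.right_inv hw
    refine ContinuousLinearMap.ext fun p ↦ ?_
    have h6 : p = p.1 • ((1 : ℝ), (0 : F)) + ((0 : ℝ), p.2) := by ext <;> simp
    have h7 : fderiv ℝ (φ ∘ Ψ) 0 (0, p.2) = ι p.2 := DFunLike.congr_fun h5 p.2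
    conv_lhs => rw [h6]
    rw [map_add, map_smul, h1, h7]
    exact (hA p).symm
  -- the derivative of `φ ∘ Ψ` is invertible at `0`, hence on a neighbourhood
  let U : Set (ℝ × F) := O ∩ fderiv ℝ (φ ∘ Ψ) ⁻¹' range
    ((↑) : ((ℝ × F) ≃L[ℝ] EuclideanSpace ℝ (Fin n)) → (ℝ × F) →L[ℝ] EuclideanSpace ℝ (Fin n))
  have hU : IsOpen U := (hψ.continuousOn_fderiv_of_isOpen hO (by simp)).isOpen_inter_preimage hO
    ContinuousLinearEquiv.isOpen
  have h0U : ((0 : ℝ), (0 : F)) ∈ U := ⟨h0O, ⟨A, hD.symm⟩⟩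
  obtain ⟨r, hr, hrU⟩ := Metric.isOpen_iff.1
    (hU.preimage (Continuous.prodMk_right (0 : ℝ))) (0 : F) h0U
  refine ⟨σ, r, hr, hσ0, hσ.mono fun w hw ↦ (hrU hw).1.1.2, fun w hw ↦ ?_⟩
  obtain ⟨e, he, hwe, heU, hef⟩ := exists_isPartialDiffeo_of_hasFDerivAt hU
    (hψ.mono inter_subset_left)
    (fun p hp ↦ by
      obtain ⟨B, hB⟩ := hp.2
      exact ⟨B, hB ▸ hψd p hp.1⟩) (hrU hw)
  refine ⟨e ≫ₕ φ.symm, he.trans hφd.symm, ?_, fun p hp ↦ ?_⟩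
  · rw [OpenPartialHomeomorph.trans_source]
    refine ⟨hwe, ?_⟩
    rw [mem_preimage, ← hef hwe]
    exact φ.map_source (hrU hw).1.2
  · rw [OpenPartialHomeomorph.trans_source] at hp
    rw [OpenPartialHomeomorph.trans_apply, ← hef hp.1]
    exact (φ.left_inv (heU hp.1).1.2).symm

/-- If `r` is small, the transverse section over the ball of radius `r` meets every orbit at most
once. An element of the circle that moves a point of the section to the section is either close to
`1`, where local injectivity applies, or in a compact set of elements that move `x₀` away. -/
theorem exists_radius_injective {V : Type*} [TopologicalSpace V] [T2Space V]
    [MulAction Circle V] [ContinuousSMul Circle V]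
    {F : Type*} [NormedAddCommGroup F] [NormedSpace ℝ F]
    (hfree : ∀ (u : Circle) (x : V), u • x = x → u = 1) {σ : F → V} {r : ℝ} (hr : 0 < r)
    (hσ : ContinuousOn σ (Metric.ball 0 r)) {e : OpenPartialHomeomorph (ℝ × F) V}
    (he0 : (0, 0) ∈ e.source) (he : EqOn (fun p ↦ Circle.exp p.1 • σ p.2) e e.source) :
    ∃ s, 0 < s ∧ s ≤ r ∧ ∀ w ∈ Metric.ball (0 : F) s, ∀ w' ∈ Metric.ball (0 : F) s, ∀ u : Circle,
      u • σ w = σ w' → u = 1 ∧ w = w' := by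
  obtain ⟨ε, hε, hεe⟩ := Metric.isOpen_iff.1 e.open_source _ he0
  have hinj : InjOn (fun p : ℝ × F ↦ Circle.exp p.1 • σ p.2) (Metric.ball (0, 0) ε) :=
    (e.injOn.congr he.symm).mono hεe
  -- the elements of the circle that are not close to `1`
  let K : Set Circle := Circle.exp '' (Icc (-Real.pi) Real.pi \ Ioo (-ε) ε)
  have hK : IsCompact K := ((isCompact_Icc).diff isOpen_Ioo).image Circle.exp.continuous
  have hσ0 : ContinuousAt σ 0 := hσ.continuousAt (Metric.ball_mem_nhds _ hr)
  have hfar : ∀ᶠ p : F × F in 𝓝 (0, 0), ∀ u ∈ K, u • σ p.1 ≠ σ p.2 := by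
    refine hK.eventually_forall_of_forall_eventually fun u hu ↦ ?_
    have h1 : u • σ 0 ≠ σ 0 := by
      intro h
      have hu1 := hfree u _ h
      obtain ⟨t, ⟨ht, ht'⟩, rfl⟩ := hu
      have h2 : t = 0 := by
        have hpi := Real.pi_pos
        obtain ⟨m, hm⟩ := Circle.exp_eq_one.1 hu1
        have h3 : |(m : ℝ)| < 1 := by
          have : |t| ≤ Real.pi := abs_le.2 ht
          rw [hm, abs_mul, abs_of_pos (by positivity : 0 < 2 * Real.pi)] at this
          by_contra! h4
          nlinarith
        have h4 : m = 0 := by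
          rw [← Int.cast_abs] at h3
          exact Int.abs_lt_one_iff.1 (by exact_mod_cast h3)
        simpa [h4] using hm
      subst h2
      exact ht' ⟨by linarith, hε⟩
    have h2 : ContinuousAt (fun z : (F × F) × Circle ↦ z.2 • σ z.1.1) ((0, 0), u) :=
      continuousAt_snd.smul (ContinuousAt.comp (f := fun z : (F × F) × Circle ↦ z.1.1) hσ0
        (by fun_prop))
    have h3 : ContinuousAt (fun z : (F × F) × Circle ↦ σ z.1.2) ((0, 0), u) :=
      ContinuousAt.comp (f := fun z : (F × F) × Circle ↦ z.1.2) hσ0 (by fun_prop)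
    exact (h2.prodMk h3).eventually (isClosed_diagonal.isOpen_compl.eventually_mem h1)
  obtain ⟨s, hs, hsb⟩ := Metric.eventually_nhds_iff_ball.1 hfar
  refine ⟨min s (min r ε), by positivity, (min_le_right _ _).trans (min_le_left _ _),
    fun w hw w' hw' u hu ↦ ?_⟩
  simp only [mem_ball_zero_iff, lt_min_iff] at hw hw'
  by_cases huK : u ∈ K
  · refine absurd hu (hsb (w, w') ?_ u huK)
    rw [Prod.mk_zero_zero, mem_ball_zero_iff, Prod.norm_def]
    exact max_lt hw.1 hw'.1
  · have harg : Complex.arg u ∈ Ioo (-ε) ε := by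
      by_contra h
      exact huK ⟨_, ⟨⟨(Complex.neg_pi_lt_arg _).le, Complex.arg_le_pi _⟩, h⟩, Circle.exp_arg u⟩
    have h1 : ((Complex.arg u : ℝ), w) = ((0 : ℝ), w') := hinj ?_ ?_ ?_
    · have h2 : Complex.arg u = 0 := congrArg Prod.fst h1
      refine ⟨?_, congrArg Prod.snd h1⟩
      rw [← Circle.exp_arg u, h2, Circle.exp_zero]
    · rw [Prod.mk_zero_zero, mem_ball_zero_iff, Prod.norm_def]
      exact max_lt (abs_lt.2 harg) hw.2.2
    · rw [Prod.mk_zero_zero, mem_ball_zero_iff, Prod.norm_def]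
      exact max_lt (by simpa using hε) hw'.2.2
    · simpa [Circle.exp_arg] using hu

/-- The slice theorem for a free circle action: every point has an invariant open neighbourhood
that is equivariantly diffeomorphic to `Circle × ℝⁿ⁻¹`. The last part says that the inverse of the
diffeomorphism stays a local diffeomorphism when the circle is parametrized by `exp`. -/
theorem exists_circleChart [T2Space V] (hn : 1 ≤ n)
    (hfree : ∀ (u : Circle) (x : V), u • x = x → u = 1) (x₀ : V) :
    ∃ c : CircleChart (fun (u : Circle) (x : V) ↦ u • x) (EuclideanSpace ℝ (Fin (n - 1))),
      x₀ ∈ c.source ∧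
      IsPartialDiffeo (𝓡 n) ((𝓡 1).prod 𝓘(ℝ, EuclideanSpace ℝ (Fin (n - 1))))
        c.toOpenPartialHomeomorph ∧
      ∀ q : Circle × EuclideanSpace ℝ (Fin (n - 1)),
        IsLocalDiffeomorphAt 𝓘(ℝ, ℝ × EuclideanSpace ℝ (Fin (n - 1))) (𝓡 n) ∞
        (fun p : ℝ × EuclideanSpace ℝ (Fin (n - 1)) ↦
          c.toOpenPartialHomeomorph.symm (Circle.exp p.1 * q.1, q.2 + p.2)) 0 := by
  have : ContinuousSMul Circle V := ContMDiffSMul.continuousSMul (I := 𝓡 1) (I' := 𝓡 n) ∞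
  obtain ⟨σ, r, hr, hσ0, hσ, hloc⟩ := exists_transverse_section hn hfree x₀
  obtain ⟨e₀, -, he₀, he₀'⟩ := hloc 0 (Metric.mem_ball_self hr)
  obtain ⟨s, hs, hsr, hinj⟩ := exists_radius_injective hfree hr hσ.continuousOn he₀ he₀'
  let F := EuclideanSpace ℝ (Fin (n - 1))
  -- the section is defined on a ball only; `β` identifies the ball with the whole space
  let β : OpenPartialHomeomorph F F := OpenPartialHomeomorph.univBall 0 s
  have hβ : IsPartialDiffeo 𝓘(ℝ, F) 𝓘(ℝ, F) β := by
    refine ⟨OpenPartialHomeomorph.contDiff_univBall.contMDiff.contMDiffOn, ?_⟩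
    rw [OpenPartialHomeomorph.univBall_target _ hs]
    exact OpenPartialHomeomorph.contDiffOn_univBall_symm.contMDiffOn
  have hβs : ∀ y, y ∈ β.source := fun y ↦ by
    rw [OpenPartialHomeomorph.univBall_source]
    exact mem_univ y
  have hβm : ∀ y, β y ∈ Metric.ball (0 : F) s := fun y ↦ by
    rw [← OpenPartialHomeomorph.univBall_target _ hs]
    exact β.map_source (hβs y)
  let Θ : Circle × F → V := fun p ↦ p.1 • σ (β p.2)
  have hΘ : ContMDiff ((𝓡 1).prod 𝓘(ℝ, F)) (𝓡 n) ∞ Θ := by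
    refine ContMDiff.smul (I := 𝓡 1) contMDiff_fst ?_
    rw [← contMDiffOn_univ]
    exact hσ.comp (OpenPartialHomeomorph.contDiff_univBall.contMDiff.comp contMDiff_snd).contMDiffOn
      fun p _ ↦ Metric.ball_subset_ball hsr (hβm p.2)
  have hΘinj : Function.Injective Θ := by
    rintro ⟨u, y⟩ ⟨u', y'⟩ h
    have h1 : (u'⁻¹ * u) • σ (β y) = σ (β y') := by
      rw [mul_smul, inv_smul_eq_iff]
      exact h
    obtain ⟨h2, h3⟩ := hinj _ (hβm y) _ (hβm y') _ h1
    exact Prod.ext (inv_mul_eq_one.1 h2).symm (β.injOn (hβs y) (hβs y') h3)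
  let q : Circle × F → ℝ × F → Circle × F := fun a p ↦ (Circle.exp p.1 * a.1, a.2 + p.2)
  have hq : ∀ a, ContMDiff 𝓘(ℝ, ℝ × F) ((𝓡 1).prod 𝓘(ℝ, F)) ∞ (q a) := fun a ↦ by
    refine ContMDiff.prodMk ?_ (contDiff_const.add contDiff_snd).contMDiff
    exact (contMDiff_circleExp.comp contDiff_fst.contMDiff).mul contMDiff_const
  have hq0 : ∀ a, q a 0 = a := fun a ↦ by simp [q]
  have hlocΘ : ∀ a, IsLocalDiffeomorphAt 𝓘(ℝ, ℝ × F) (𝓡 n) ∞ (fun p ↦ Θ (q a p)) 0 := by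
    intro a
    obtain ⟨e, he, hae, hef⟩ := hloc (β a.2) (Metric.ball_subset_ball hsr (hβm _))
    have h1 : IsLocalDiffeomorphAt 𝓘(ℝ, ℝ × F) (𝓡 n) ∞
        (fun p ↦ Circle.exp p.1 • σ (β p.2)) (0, a.2) := by
      have hb : IsPartialDiffeo 𝓘(ℝ, ℝ × F) 𝓘(ℝ, ℝ × F)
          ((OpenPartialHomeomorph.refl ℝ).prod β) := by
        rw [modelWithCornersSelf_prod, ← chartedSpaceSelf_prod]
        exact IsPartialDiffeo.refl.prod hβ
      refine (hb.trans he).isLocalDiffeomorphAt ?_ fun p hp ↦ ?_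
      · rw [OpenPartialHomeomorph.trans_source]
        exact ⟨⟨mem_univ _, hβs _⟩, hae⟩
      · rw [OpenPartialHomeomorph.trans_source] at hp
        exact hef hp.2
    let tr : (ℝ × F) ≃ₘ^∞⟮𝓘(ℝ, ℝ × F), 𝓘(ℝ, ℝ × F)⟯ (ℝ × F) :=
      { toEquiv := Equiv.addLeft (0, a.2)
        contMDiff_toFun := (contDiff_const.add contDiff_id).contMDiff
        contMDiff_invFun := (contDiff_const.add contDiff_id).contMDiff }
    have h2 := tr.isLocalDiffeomorph 0
    have h3 := (Diffeomorph.smul (𝓡 1) (𝓡 n) ∞ a.1 :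
      V ≃ₘ^∞⟮𝓡 n, 𝓡 n⟯ V).isLocalDiffeomorph (Circle.exp 0 • σ (β a.2))
    have h4 : tr 0 = (0, a.2) := by
      change ((0 : ℝ), a.2) + (0 : ℝ × F) = _
      simp
    have h5 := (h2.comp (P := V) (K := 𝓡 n) (by rw [h4]; exact h1)).comp (P := V) (K := 𝓡 n)
      (g := fun x : V ↦ a.1 • x) (by
        simp only [Function.comp_apply, h4]; exact h3)
    -- by equivariance, it is enough to have a local diffeomorphism along `t = 0`
    convert h5 using 1
    funext p
    change (Circle.exp p.1 * a.1) • σ (β (a.2 + p.2)) =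
      a.1 • Circle.exp (0 + p.1) • σ (β (a.2 + p.2))
    rw [zero_add, smul_smul, mul_comm]
  have hopen : IsOpenMap Θ := by
    rw [isOpenMap_iff_nhds_le]
    intro a
    obtain ⟨e, -, h0, hef⟩ := exists_isPartialDiffeo_of_isLocalDiffeomorphAt (hlocΘ a)
    have h1 : map (fun p ↦ Θ (q a p)) (𝓝 0) = 𝓝 (Θ a) := by
      rw [Filter.map_congr (hef.eventuallyEq_of_mem (e.open_source.mem_nhds h0)), e.map_nhds_eq h0,
        ← hef h0]
      exact congrArg (fun b ↦ 𝓝 (Θ b)) (hq0 a)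
    rw [← h1, show (fun p ↦ Θ (q a p)) = Θ ∘ q a from rfl, ← Filter.map_map]
    refine Filter.map_mono ?_
    have := (hq a).continuous.tendsto 0
    rwa [hq0] at this
  have hemb : Topology.IsOpenEmbedding Θ :=
    .of_continuous_injective_isOpenMap hΘ.continuous hΘinj hopen
  let c := (hemb.toOpenPartialHomeomorph Θ).symm
  have hΘsmul : ∀ (u : Circle) p, u • Θ p = Θ (u * p.1, p.2) := fun u p ↦ smul_smul _ _ _
  have hleft : ∀ p, c (Θ p) = p := fun p ↦
    (hemb.toOpenPartialHomeomorph Θ).left_inv (mem_univ p)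
  have hcs : c.source = range Θ := by
    rw [OpenPartialHomeomorph.symm_source, hemb.toOpenPartialHomeomorph_target]
  refine ⟨⟨c, rfl, ?_, ?_⟩, ?_, ⟨?_, ?_⟩, hlocΘ⟩
  · intro u x hx
    change x ∈ c.source at hx
    change u • x ∈ c.source
    rw [hcs] at hx ⊢
    obtain ⟨p, rfl⟩ := hx
    exact ⟨_, (hΘsmul u p).symm⟩
  · intro u x hx
    change x ∈ c.source at hx
    change c (u • x) = (u * (c x).1, (c x).2)
    rw [hcs] at hx
    obtain ⟨p, rfl⟩ := hx
    rw [hΘsmul, hleft, hleft]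
  · change x₀ ∈ c.source
    rw [hcs]
    refine ⟨(1, 0), ?_⟩
    change (1 : Circle) • σ (β 0) = x₀
    rw [one_smul, OpenPartialHomeomorph.univBall_apply_zero, hσ0]
  · intro x hx
    change x ∈ c.source at hx
    rw [hcs] at hx
    obtain ⟨a, rfl⟩ := hx
    obtain ⟨e, he, h0, hef⟩ := exists_isPartialDiffeo_of_isLocalDiffeomorphAt (hlocΘ a)
    have hmem : Θ a ∈ e.target := by
      have h1 : e 0 = Θ a := (hef h0).symm.trans (congrArg Θ (hq0 a))
      exact h1 ▸ e.map_source h0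
    refine (((hq a).contMDiffAt.comp _ (he.contMDiffAt_symm hmem)).congr_of_eventuallyEq
      ?_).contMDiffWithinAt
    filter_upwards [e.open_target.mem_nhds hmem] with x hx
    have h2 : Θ (q a (e.symm x)) = x := (hef (e.map_target hx)).trans (e.right_inv hx)
    change c x = q a (e.symm x)
    rw [← hleft (q a (e.symm x)), h2]
  · exact hΘ.contMDiffOn

end Slice

/-! ### Topology of the cotangent bundle -/

section Topology

/-- A space over a Hausdorff space is Hausdorff if each fibre lies in a Hausdorff open set. -/
theorem t2Space_of_locally {X Y Z : Type*} [TopologicalSpace X] [TopologicalSpace Y]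
    [TopologicalSpace Z] [T2Space Y] [T2Space Z] {f : X → Y} (hf : Continuous f)
    (h : ∀ y, ∃ e : OpenPartialHomeomorph X Z, f ⁻¹' {y} ⊆ e.source) : T2Space X := by
  refine ⟨fun a b hab ↦ ?_⟩
  by_cases hy : f a = f b
  · obtain ⟨e, he⟩ := h (f b)
    have ha : a ∈ e.source := he hy
    have hb : b ∈ e.source := he rfl
    obtain ⟨u, v, hu, hv, hau, hbv, huv⟩ := t2_separation (e.injOn.ne ha hb hab)
    refine ⟨e.source ∩ e ⁻¹' u, e.source ∩ e ⁻¹' v, e.isOpen_inter_preimage hu,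
      e.isOpen_inter_preimage hv, ⟨ha, hau⟩, ⟨hb, hbv⟩, ?_⟩
    exact (huv.preimage e).mono inter_subset_right inter_subset_right
  · obtain ⟨u, v, hu, hv, hau, hbv, huv⟩ := t2_separation hy
    exact ⟨_, _, hu.preimage hf, hv.preimage hf, hau, hbv, huv.preimage f⟩

variable {B F : Type*} [TopologicalSpace B] [TopologicalSpace F] (E : B → Type*)
  [TopologicalSpace (TotalSpace F E)] [∀ b, TopologicalSpace (E b)] [FiberBundle F E]

theorem t2Space_totalSpace [T2Space B] [T2Space F] : T2Space (TotalSpace F E) :=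
  t2Space_of_locally (Z := B × F) (FiberBundle.continuous_proj F E) fun b ↦
    ⟨(trivializationAt F E b).toOpenPartialHomeomorph, by
      rintro a rfl
      exact (trivializationAt F E _).mem_source.2 (mem_baseSet_trivializationAt F E _)⟩

theorem secondCountableTopology_totalSpace [SecondCountableTopology B]
    [SecondCountableTopology F] : SecondCountableTopology (TotalSpace F E) := by
  obtain ⟨s, hs, hsU⟩ := TopologicalSpace.countable_cover_nhds
    (f := fun b : B ↦ (trivializationAt F E b).baseSet)
    fun b ↦ (trivializationAt F E b).open_baseSet.mem_nhds (mem_baseSet_trivializationAt F E b)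
  have : Countable s := hs.to_subtype
  have : ∀ b : s, SecondCountableTopology (trivializationAt F E b.1).source := fun b ↦
    (trivializationAt F E b.1).toOpenPartialHomeomorph.secondCountableTopology_source
  refine TopologicalSpace.secondCountableTopology_of_countable_cover
    (U := fun b : s ↦ (trivializationAt F E b.1).source)
    (fun b ↦ (trivializationAt F E b.1).open_source) (eq_univ_of_forall fun a ↦ ?_)
  have : a.proj ∈ ⋃ b ∈ s, (trivializationAt F E b).baseSet := hsU ▸ mem_univ _
  obtain ⟨b, hb, hab⟩ := mem_iUnion₂.1 this
  exact mem_iUnion.2 ⟨⟨b, hb⟩, (trivializationAt F E b).mem_source.2 hab⟩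

end Topology

/-! ### Coordinates on the cotangent bundle -/

section Frame

variable {n : ℕ} {V : Type*} [TopologicalSpace V] [ChartedSpace (EuclideanSpace ℝ (Fin n)) V]

/-- The linear form of a point of `T*V`, on the model space of `V` (to which all tangent spaces of
`V` are definitionally equal). -/
def covector (a : Cotangent n V) : EuclideanSpace ℝ (Fin n) →L[ℝ] ℝ := a.2

variable {F : Type*} [NormedAddCommGroup F] [NormedSpace ℝ F] [MulAction Circle V]

namespace CircleChart

variable (c : CircleChart (fun (u : Circle) (x : V) ↦ u • x) F)

/-- The frame `ℝ × F ≃ T_x V` at the point `x` with coordinates `q`, given by an equivariant chart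
`c`. It maps `(1, 0)` to the fundamental vector field and is invariant under the circle action. The
circle factor is parametrized by `t ↦ exp(it) q.1`, which avoids tangent vectors of the circle. -/
def frame (q : Circle × F) : (ℝ × F) →L[ℝ] EuclideanSpace ℝ (Fin n) :=
  mfderiv 𝓘(ℝ, ℝ × F) (𝓡 n)
    (fun p : ℝ × F ↦ c.toOpenPartialHomeomorph.symm (Circle.exp p.1 * q.1, q.2 + p.2)) 0

theorem contMDiff_symm
    (hc : IsPartialDiffeo (𝓡 n) ((𝓡 1).prod 𝓘(ℝ, F)) c.toOpenPartialHomeomorph) :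
    ContMDiff ((𝓡 1).prod 𝓘(ℝ, F)) (𝓡 n) ∞ c.toOpenPartialHomeomorph.symm := by
  have := hc.2
  rwa [c.target_eq, contMDiffOn_univ] at this

theorem exists_frame_equiv {q : Circle × F}
    (h : IsLocalDiffeomorphAt 𝓘(ℝ, ℝ × F) (𝓡 n) ∞ (fun p : ℝ × F ↦
      c.toOpenPartialHomeomorph.symm (Circle.exp p.1 * q.1, q.2 + p.2)) 0) :
    ∃ A : (ℝ × F) ≃L[ℝ] EuclideanSpace ℝ (Fin n),
      c.frame q = (A : (ℝ × F) →L[ℝ] EuclideanSpace ℝ (Fin n)) :=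
  ⟨h.mfderivToContinuousLinearEquiv (by simp), rfl⟩

theorem contMDiff_frame_curve
    (hc : IsPartialDiffeo (𝓡 n) ((𝓡 1).prod 𝓘(ℝ, F)) c.toOpenPartialHomeomorph)
    (q : Circle × F) : ContMDiff 𝓘(ℝ, ℝ × F) (𝓡 n) ∞
    (fun p : ℝ × F ↦ c.toOpenPartialHomeomorph.symm (Circle.exp p.1 * q.1, q.2 + p.2)) := by
  refine (c.contMDiff_symm hc).comp (ContMDiff.prodMk ?_
    (contDiff_const.add contDiff_snd).contMDiff)
  exact (contMDiff_circleExp.comp contDiff_fst.contMDiff).mul contMDiff_const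

theorem frame_fundamental
    (hc : IsPartialDiffeo (𝓡 n) ((𝓡 1).prod 𝓘(ℝ, F)) c.toOpenPartialHomeomorph)
    (q : Circle × F) :
    c.frame q (1, 0) = fundamentalField n (c.toOpenPartialHomeomorph.symm q) := by
  have h1 : HasMFDerivAt 𝓘(ℝ, ℝ × F) (𝓡 n)
      (fun p : ℝ × F ↦ c.toOpenPartialHomeomorph.symm (Circle.exp p.1 * q.1, q.2 + p.2)) 0
      (c.frame q) := ((c.contMDiff_frame_curve hc q).mdifferentiable (by simp) 0).hasMFDerivAt
  have h2 : HasMFDerivAt 𝓘(ℝ, ℝ) 𝓘(ℝ, ℝ × F) (fun t : ℝ ↦ (t, (0 : F))) 0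
      (ContinuousLinearMap.inl ℝ ℝ F) :=
    (ContinuousLinearMap.inl ℝ ℝ F).hasFDerivAt.hasMFDerivAt
  have h3 := HasMFDerivAt.comp (0 : ℝ) h1 h2
  have h4 : (fun p : ℝ × F ↦
      c.toOpenPartialHomeomorph.symm (Circle.exp p.1 * q.1, q.2 + p.2)) ∘
      (fun t : ℝ ↦ (t, (0 : F))) =
      fun t : ℝ ↦ Circle.exp t • c.toOpenPartialHomeomorph.symm q := by
    funext t
    simp only [Function.comp_apply, add_zero]
    exact (c.smul_symm (Circle.exp t) q).symm
  rw [h4] at h3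
  exact (congrArg (fun A : ℝ →L[ℝ] EuclideanSpace ℝ (Fin n) ↦ A 1) h3.mfderiv).symm

/-- The linear form at a point of `T*V`, expressed in the invariant frame of an equivariant
chart. -/
def frameForm (a : Cotangent n V) : (ℝ × F) →L[ℝ] ℝ :=
  (covector a).comp (c.frame (c.toOpenPartialHomeomorph a.1))

/-- The point of `T*V` with given base coordinates and given components in the invariant frame. -/
def ofFrameForm (p : (Circle × F) × ((ℝ × F) →L[ℝ] ℝ)) : Cotangent n V :=
  ⟨c.toOpenPartialHomeomorph.symm p.1,
    (p.2.comp (c.frame p.1).inverse : EuclideanSpace ℝ (Fin n) →L[ℝ] ℝ)⟩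

/-- As `(1, 0)` is mapped by the frame to the fundamental vector field, the Hamiltonian is the value
of the form at `(1, 0)` in these components. -/
theorem hamiltonian_eq_frameForm
    (hc : IsPartialDiffeo (𝓡 n) ((𝓡 1).prod 𝓘(ℝ, F)) c.toOpenPartialHomeomorph)
    {a : Cotangent n V} (ha : a.1 ∈ c.source) : hamiltonian a = c.frameForm a (1, 0) := by
  change covector a (fundamentalField n a.1) = covector a (c.frame _ (1, 0))
  rw [c.frame_fundamental hc, c.toOpenPartialHomeomorph.left_inv ha]

variable [ContMDiffSMul (𝓡 1) (𝓡 n) ∞ Circle V]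

/-- The frame is invariant under the circle action. -/
theorem frame_smul (hc : IsPartialDiffeo (𝓡 n) ((𝓡 1).prod 𝓘(ℝ, F)) c.toOpenPartialHomeomorph)
    (u : Circle) (q : Circle × F) : c.frame (u * q.1, q.2) =
      (mfderiv (𝓡 n) (𝓡 n) (fun y : V ↦ u • y) (c.toOpenPartialHomeomorph.symm q) :
        EuclideanSpace ℝ (Fin n) →L[ℝ] EuclideanSpace ℝ (Fin n)).comp (c.frame q) := by
  have h0 : c.toOpenPartialHomeomorph.symm
      (Circle.exp (0 : ℝ × F).1 * q.1, q.2 + (0 : ℝ × F).2) =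
      c.toOpenPartialHomeomorph.symm q := by simp
  have h1 : HasMFDerivAt 𝓘(ℝ, ℝ × F) (𝓡 n)
      (fun p : ℝ × F ↦ c.toOpenPartialHomeomorph.symm (Circle.exp p.1 * q.1, q.2 + p.2)) 0
      (c.frame q) := ((c.contMDiff_frame_curve hc q).mdifferentiable (by simp) 0).hasMFDerivAt
  have hu : HasMFDerivAt (𝓡 n) (𝓡 n) (fun y : V ↦ u • y) (c.toOpenPartialHomeomorph.symm
      (Circle.exp (0 : ℝ × F).1 * q.1, q.2 + (0 : ℝ × F).2))
      (mfderiv (𝓡 n) (𝓡 n) (fun y : V ↦ u • y) (c.toOpenPartialHomeomorph.symm q) :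
        EuclideanSpace ℝ (Fin n) →L[ℝ] EuclideanSpace ℝ (Fin n)) := by
    rw [h0]
    exact (mdifferentiable_smul (n := n) u _).hasMFDerivAt
  have h2 := HasMFDerivAt.comp (0 : ℝ × F) hu h1
  have h3 : (fun y : V ↦ u • y) ∘
      (fun p : ℝ × F ↦ c.toOpenPartialHomeomorph.symm (Circle.exp p.1 * q.1, q.2 + p.2)) =
      fun p : ℝ × F ↦ c.toOpenPartialHomeomorph.symm (Circle.exp p.1 * (u * q.1), q.2 + p.2) := by
    funext p
    simp only [Function.comp_apply, c.smul_symm, mul_left_comm]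
  rw [h3] at h2
  exact h2.mfderiv

/-- As the frame is invariant, the components of a linear form do not change under the lifted
action. -/
theorem frameForm_smul
    (hc : IsPartialDiffeo (𝓡 n) ((𝓡 1).prod 𝓘(ℝ, F)) c.toOpenPartialHomeomorph)
    (u : Circle) {a : Cotangent n V} (ha : a.1 ∈ c.source) :
    c.frameForm (cotangentSMul u a) = c.frameForm a := by
  have h1 := c.apply_smul u ha
  have h2 := isInvertible_mfderiv_smul (n := n) u a.1
  refine ContinuousLinearMap.ext fun v ↦ ?_
  change covector a ((mfderiv (𝓡 n) (𝓡 n) (fun y : V ↦ u • y) a.1).inverse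
    (c.frame (c.toOpenPartialHomeomorph (u • a.1)) v)) = covector a (c.frame _ v)
  rw [h1, c.frame_smul hc, c.toOpenPartialHomeomorph.left_inv ha]
  exact congrArg (covector a) (h2.inverse_apply_self _)

end CircleChart

end Frame

section Cotangent

variable {n : ℕ} {V : Type*} [TopologicalSpace V] [ChartedSpace (EuclideanSpace ℝ (Fin n)) V]

variable [IsManifold (𝓡 n) ∞ V]

/-- Coordinates of tangent vectors at `x` in the trivialization around `x₀`. -/
def tangentCoord (x₀ x : V) : EuclideanSpace ℝ (Fin n) →L[ℝ] EuclideanSpace ℝ (Fin n) :=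
  (trivializationAt (EuclideanSpace ℝ (Fin n)) (TangentSpace (𝓡 n)) x₀).continuousLinearMapAt ℝ x

/-- The tangent vector at `x` with given coordinates in the trivialization around `x₀`. -/
def tangentCoordSymm (x₀ x : V) : EuclideanSpace ℝ (Fin n) →L[ℝ] EuclideanSpace ℝ (Fin n) :=
  (trivializationAt (EuclideanSpace ℝ (Fin n)) (TangentSpace (𝓡 n)) x₀).symmL ℝ x

theorem eventually_mem_baseSet (x₀ : V) : ∀ᶠ x in 𝓝 x₀,
    x ∈ (trivializationAt (EuclideanSpace ℝ (Fin n)) (TangentSpace (𝓡 n)) x₀).baseSet :=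
  (trivializationAt (EuclideanSpace ℝ (Fin n)) (TangentSpace (𝓡 n)) x₀).open_baseSet.mem_nhds
    (mem_baseSet_trivializationAt (EuclideanSpace ℝ (Fin n)) (TangentSpace (𝓡 n)) x₀)

/-- The trivialization around `x₀`, at a point `x` near `x₀`, as a linear isomorphism. -/
theorem exists_tangentCoord_equiv {x₀ x : V}
    (hx : x ∈ (trivializationAt (EuclideanSpace ℝ (Fin n)) (TangentSpace (𝓡 n)) x₀).baseSet) :
    ∃ B : EuclideanSpace ℝ (Fin n) ≃L[ℝ] EuclideanSpace ℝ (Fin n),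
      tangentCoord x₀ x = (B : EuclideanSpace ℝ (Fin n) →L[ℝ] EuclideanSpace ℝ (Fin n)) ∧
        tangentCoordSymm x₀ x =
          (B.symm : EuclideanSpace ℝ (Fin n) →L[ℝ] EuclideanSpace ℝ (Fin n)) := by
  exact ⟨ContinuousLinearEquiv.equivOfInverse (tangentCoord x₀ x) (tangentCoordSymm x₀ x)
    (fun v ↦ Trivialization.symmL_continuousLinearMapAt _ hx v)
    (fun v ↦ Trivialization.continuousLinearMapAt_symmL _ hx v), rfl, rfl⟩

variable {EM HM M : Type*} [NormedAddCommGroup EM] [NormedSpace ℝ EM] [TopologicalSpace HM]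
  {I : ModelWithCorners ℝ EM HM} [TopologicalSpace M] [ChartedSpace HM M]

/-- A map to `T*V` is smooth if and only if its base point and its coordinates in a trivialization
are smooth. -/
theorem contMDiffAt_cotangent_iff {f : M → Cotangent n V} {m₀ : M} :
    ContMDiffAt I (cotangentModel n) ∞ f m₀ ↔ ContMDiffAt I (𝓡 n) ∞ (fun m ↦ (f m).1) m₀ ∧
      ContMDiffAt I 𝓘(ℝ, EuclideanSpace ℝ (Fin n) →L[ℝ] ℝ) ∞
        (fun m ↦ (covector (f m)).comp (tangentCoordSymm (f m₀).1 (f m).1)) m₀ := by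
  rw [contMDiffAt_hom_bundle]
  refine and_congr Iff.rfl (Eq.to_iff ?_)
  congr 1
  funext m
  refine ContinuousLinearMap.ext fun v ↦ ?_
  simp [ContinuousLinearMap.inCoordinates, tangentCoordSymm, covector]
  rfl

variable {F : Type*} [NormedAddCommGroup F] [NormedSpace ℝ F] [MulAction Circle V]

namespace CircleChart

variable (c : CircleChart (fun (u : Circle) (x : V) ↦ u • x) F)

/-- The frame is smooth, as a map `ℝ × F → T V` over `V`, read in a trivialization of `T V`. It is
the derivative in `p` of a map that is jointly smooth in `p` and `q`. -/
theorem contMDiffAt_frame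
    (hc : IsPartialDiffeo (𝓡 n) ((𝓡 1).prod 𝓘(ℝ, F)) c.toOpenPartialHomeomorph)
    (q₀ : Circle × F) : ContMDiffAt ((𝓡 1).prod 𝓘(ℝ, F))
      𝓘(ℝ, (ℝ × F) →L[ℝ] EuclideanSpace ℝ (Fin n)) ∞
      (fun q ↦ (tangentCoord (n := n) (c.toOpenPartialHomeomorph.symm q₀)
        (c.toOpenPartialHomeomorph.symm q)).comp (c.frame (n := n) q)) q₀ := by
  have h1 : ContMDiff (((𝓡 1).prod 𝓘(ℝ, F)).prod 𝓘(ℝ, ℝ × F)) (𝓡 n) ∞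
      (Function.uncurry fun (q : Circle × F) (p : ℝ × F) ↦
        c.toOpenPartialHomeomorph.symm (Circle.exp p.1 * q.1, q.2 + p.2)) := by
    refine (c.contMDiff_symm hc).comp (ContMDiff.prodMk ?_ ?_)
    · exact (contMDiff_circleExp.comp (contDiff_fst.contMDiff.comp contMDiff_snd)).mul
        (contMDiff_fst.comp contMDiff_fst)
    · exact (contMDiff_snd.comp contMDiff_fst).add (contDiff_snd.contMDiff.comp contMDiff_snd)
  have h2 := ContMDiffAt.mfderiv (x₀ := q₀) (m := ∞) (n := ∞)
    (fun (q : Circle × F) (p : ℝ × F) ↦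
        c.toOpenPartialHomeomorph.symm (Circle.exp p.1 * q.1, q.2 + p.2))
    (fun _ ↦ (0 : ℝ × F)) h1.contMDiffAt contMDiffAt_const (by simp)
  refine h2.congr_of_eventuallyEq (Filter.Eventually.of_forall fun q ↦ ?_)
  have h0 : ∀ q : Circle × F, c.toOpenPartialHomeomorph.symm
      (Circle.exp (0 : ℝ × F).1 * q.1, q.2 + (0 : ℝ × F).2) =
      c.toOpenPartialHomeomorph.symm q := fun q ↦ by simp
  have h3 : tangentCoord (n := n) (c.toOpenPartialHomeomorph.symm q₀)
      (c.toOpenPartialHomeomorph.symm q) = tangentCoord (n := n)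
        (c.toOpenPartialHomeomorph.symm
          (Circle.exp (0 : ℝ × F).1 * q₀.1, q₀.2 + (0 : ℝ × F).2))
        (c.toOpenPartialHomeomorph.symm
          (Circle.exp (0 : ℝ × F).1 * q.1, q.2 + (0 : ℝ × F).2)) := by
    rw [h0, h0]
  refine (congrArg (fun A : EuclideanSpace ℝ (Fin n) →L[ℝ] EuclideanSpace ℝ (Fin n) ↦
    A.comp (c.frame (n := n) q)) h3).trans ?_
  refine ContinuousLinearMap.ext fun v ↦ ?_
  simp only [inTangentCoordinates, ContinuousLinearMap.inCoordinates,
    TangentBundle.symmL_model_space]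
  rfl

theorem contMDiffAt_frameForm
    (hc : IsPartialDiffeo (𝓡 n) ((𝓡 1).prod 𝓘(ℝ, F)) c.toOpenPartialHomeomorph)
    {a₀ : Cotangent n V} (ha₀ : a₀.1 ∈ c.source) :
    ContMDiffAt (cotangentModel n) 𝓘(ℝ, (ℝ × F) →L[ℝ] ℝ) ∞ c.frameForm a₀ := by
  obtain ⟨h1, h2⟩ := contMDiffAt_cotangent_iff.1
    (contMDiffAt_id (I := cotangentModel n) (x := a₀) (n := ∞))
  have h3 : ContMDiffAt (cotangentModel n) ((𝓡 1).prod 𝓘(ℝ, F)) ∞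
      (fun a : Cotangent n V ↦ c.toOpenPartialHomeomorph a.1) a₀ :=
    ContMDiffAt.comp a₀ (hc.contMDiffAt ha₀) h1
  have h4 := ContMDiffAt.comp a₀ (c.contMDiffAt_frame hc (c.toOpenPartialHomeomorph a₀.1)) h3
  refine (h2.clm_comp h4).congr_of_eventuallyEq ?_
  have h5 : Tendsto (fun a : Cotangent n V ↦ a.1) (𝓝 a₀) (𝓝 a₀.1) := h1.continuousAt
  filter_upwards [h5.eventually (eventually_mem_baseSet (n := n) a₀.1),
    h5.eventually (c.open_source.mem_nhds ha₀)] with a ha ha'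
  obtain ⟨B, hB1, hB2⟩ := exists_tangentCoord_equiv (n := n) ha
  refine ContinuousLinearMap.ext fun v ↦ ?_
  simp only [Function.comp_apply, ContinuousLinearMap.comp_apply, frameForm, id_eq,
    c.toOpenPartialHomeomorph.left_inv ha', c.toOpenPartialHomeomorph.left_inv ha₀, hB1, hB2,
    ContinuousLinearEquiv.coe_coe, ContinuousLinearEquiv.symm_apply_apply]

theorem contMDiff_ofFrameForm
    (hc : IsPartialDiffeo (𝓡 n) ((𝓡 1).prod 𝓘(ℝ, F)) c.toOpenPartialHomeomorph)
    (hA : ∀ q, ∃ A : (ℝ × F) ≃L[ℝ] EuclideanSpace ℝ (Fin n),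
      c.frame q = (A : (ℝ × F) →L[ℝ] EuclideanSpace ℝ (Fin n))) :
    ContMDiff (((𝓡 1).prod 𝓘(ℝ, F)).prod 𝓘(ℝ, (ℝ × F) →L[ℝ] ℝ)) (cotangentModel n) ∞
      (c.ofFrameForm (n := n)) := by
  intro p₀
  refine contMDiffAt_cotangent_iff.2 ⟨((c.contMDiff_symm hc).comp contMDiff_fst).contMDiffAt, ?_⟩
  have h1 := ContMDiffAt.comp p₀ (c.contMDiffAt_frame hc p₀.1)
    (contMDiff_fst (I := (𝓡 1).prod 𝓘(ℝ, F)) (J := 𝓘(ℝ, (ℝ × F) →L[ℝ] ℝ)) (n := ∞)).contMDiffAt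
  have hmem : ∀ᶠ p in 𝓝 p₀, c.toOpenPartialHomeomorph.symm p.1 ∈
      (trivializationAt (EuclideanSpace ℝ (Fin n)) (TangentSpace (𝓡 n))
        (c.toOpenPartialHomeomorph.symm p₀.1)).baseSet :=
    (((c.contMDiff_symm hc).continuous.comp continuous_fst).tendsto p₀).eventually
      (eventually_mem_baseSet (n := n) _)
  -- the inverse of the frame, in coordinates, is the inverse of the frame in coordinates
  have h2 : ContMDiffAt (((𝓡 1).prod 𝓘(ℝ, F)).prod 𝓘(ℝ, (ℝ × F) →L[ℝ] ℝ))
      𝓘(ℝ, EuclideanSpace ℝ (Fin n) →L[ℝ] (ℝ × F)) ∞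
      (fun p ↦ ((c.frame (n := n) p.1).inverse).comp (tangentCoordSymm (n := n)
        (c.toOpenPartialHomeomorph.symm p₀.1) (c.toOpenPartialHomeomorph.symm p.1))) p₀ := by
    obtain ⟨A, hA'⟩ := hA p₀.1
    obtain ⟨B, hB1, hB2⟩ := exists_tangentCoord_equiv (n := n) hmem.self_of_nhds
    have : CompleteSpace (ℝ × F) := by
      have : FiniteDimensional ℝ (ℝ × F) := LinearEquiv.finiteDimensional A.symm.toLinearEquiv
      exact FiniteDimensional.complete ℝ _
    have h3 := contDiffAt_map_inverse (n := ∞) (A.trans B)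
    have h4 := ContMDiffAt.comp p₀ (g := ContinuousLinearMap.inverse)
      (by
        simp only [Function.comp_apply, hA', hB1]
        exact h3.contMDiffAt) h1
    refine h4.congr_of_eventuallyEq ?_
    filter_upwards [hmem] with p hp
    obtain ⟨A, hA'⟩ := hA p.1
    obtain ⟨B, hB1, hB2⟩ := exists_tangentCoord_equiv (n := n) hp
    simp only [Function.comp_apply, hA', hB1, hB2]
    rw [show (B : EuclideanSpace ℝ (Fin n) →L[ℝ] EuclideanSpace ℝ (Fin n)).comp
      (A : (ℝ × F) →L[ℝ] EuclideanSpace ℝ (Fin n)) = (A.trans B : (ℝ × F) ≃L[ℝ] _) from rfl,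
      ContinuousLinearMap.inverse_equiv, ContinuousLinearMap.inverse_equiv]
    rfl
  exact contMDiffAt_snd.clm_comp h2

/-- Coordinates on `T*V` over the source of an equivariant chart of `V`: the base point in the
chart, and the linear form expressed in the invariant frame. -/
def cotangentChart
    (hc : IsPartialDiffeo (𝓡 n) ((𝓡 1).prod 𝓘(ℝ, F)) c.toOpenPartialHomeomorph)
    (hA : ∀ q, ∃ A : (ℝ × F) ≃L[ℝ] EuclideanSpace ℝ (Fin n),
      c.frame q = (A : (ℝ × F) →L[ℝ] EuclideanSpace ℝ (Fin n))) :
    OpenPartialHomeomorph (Cotangent n V) ((Circle × F) × ((ℝ × F) →L[ℝ] ℝ)) where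
  toFun a := (c.toOpenPartialHomeomorph a.1, c.frameForm a)
  invFun := c.ofFrameForm
  source := {a | a.1 ∈ c.source}
  target := univ
  map_source' _ _ := mem_univ _
  map_target' p _ := c.symm_mem p.1
  left_inv' a ha := by
    obtain ⟨A, hA'⟩ := hA (c.toOpenPartialHomeomorph a.1)
    obtain ⟨x, φ⟩ := a
    have h1 : c.toOpenPartialHomeomorph.symm (c.toOpenPartialHomeomorph x) = x :=
      c.toOpenPartialHomeomorph.left_inv ha
    have h2 : ((c.frameForm ⟨x, φ⟩).comp (c.frame (c.toOpenPartialHomeomorph x)).inverse :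
        EuclideanSpace ℝ (Fin n) →L[ℝ] ℝ) = φ := by
      refine ContinuousLinearMap.ext fun v ↦ ?_
      simp only [frameForm, hA', ContinuousLinearMap.inverse_equiv]
      change φ (A (A.symm v)) = φ v
      rw [A.apply_symm_apply]
    have h3 : ∀ (y : V) (_ : y = x) (ψ : EuclideanSpace ℝ (Fin n) →L[ℝ] ℝ),
        (⟨y, ψ⟩ : Cotangent n V) = ⟨x, ψ⟩ := by
      rintro _ rfl ψ
      rfl
    exact (h3 _ h1 _).trans (congrArg (TotalSpace.mk x) h2)
  right_inv' p _ := by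
    obtain ⟨A, hA'⟩ := hA p.1
    refine Prod.ext (c.apply_symm p.1) ?_
    refine ContinuousLinearMap.ext fun v ↦ ?_
    simp only [frameForm, ofFrameForm, covector, c.apply_symm, hA',
      ContinuousLinearMap.inverse_equiv]
    simp
  open_source := c.open_source.preimage (FiberBundle.continuous_proj _ _)
  open_target := isOpen_univ
  continuousOn_toFun a ha := ((ContinuousAt.comp (f := fun a : Cotangent n V ↦ a.1)
    (c.toOpenPartialHomeomorph.continuousAt ha)
    (FiberBundle.continuous_proj _ _).continuousAt).prodMk
      (c.contMDiffAt_frameForm hc ha).continuousAt).continuousWithinAt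
  continuousOn_invFun := (c.contMDiff_ofFrameForm hc hA).continuous.continuousOn

theorem isPartialDiffeo_cotangentChart
    (hc : IsPartialDiffeo (𝓡 n) ((𝓡 1).prod 𝓘(ℝ, F)) c.toOpenPartialHomeomorph)
    (hA : ∀ q, ∃ A : (ℝ × F) ≃L[ℝ] EuclideanSpace ℝ (Fin n),
      c.frame q = (A : (ℝ × F) →L[ℝ] EuclideanSpace ℝ (Fin n))) :
    IsPartialDiffeo (cotangentModel n) (((𝓡 1).prod 𝓘(ℝ, F)).prod 𝓘(ℝ, (ℝ × F) →L[ℝ] ℝ))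
      (c.cotangentChart hc hA) := by
  refine ⟨fun a ha ↦ ContMDiffAt.contMDiffWithinAt (ContMDiffAt.prodMk ?_
    (c.contMDiffAt_frameForm hc ha)), (c.contMDiff_ofFrameForm hc hA).contMDiffOn⟩
  exact ContMDiffAt.comp a (hc.contMDiffAt ha) (contMDiff_proj _ a)

end CircleChart

end Cotangent

/-! ### The line bundle associated to a principal circle bundle -/

theorem circle_mul_conj_mul (u : Circle) (z : ℂ) : (u : ℂ) * ((starRingEnd ℂ) (u : ℂ) * z) = z := by
  rw [← Circle.coe_inv_eq_conj, ← mul_assoc, ← Circle.coe_mul, mul_inv_cancel, Circle.coe_one,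
    one_mul]

theorem circle_conj_mul_mul (u : Circle) (z : ℂ) : (starRingEnd ℂ) (u : ℂ) * ((u : ℂ) * z) = z := by
  rw [← Circle.coe_inv_eq_conj, ← mul_assoc, ← Circle.coe_mul, inv_mul_cancel, Circle.coe_one,
    one_mul]

theorem contMDiff_circle_coe : ContMDiff (𝓡 1) 𝓘(ℝ, ℂ) ∞ (fun u : Circle ↦ (u : ℂ)) := by
  have := finrank_real_complex_fact'
  exact contMDiff_coe_sphere (E := ℂ) (n := 1)

theorem contMDiff_circle_conj :
    ContMDiff (𝓡 1) 𝓘(ℝ, ℂ) ∞ (fun u : Circle ↦ (starRingEnd ℂ) (u : ℂ)) :=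
  Complex.conjCLE.contDiff.contMDiff.comp contMDiff_circle_coe

theorem contMDiff_complex_mul {E H M : Type*} [NormedAddCommGroup E] [NormedSpace ℝ E]
    [TopologicalSpace H] {I : ModelWithCorners ℝ E H} [TopologicalSpace M] [ChartedSpace H M]
    {f g : M → ℂ} (hf : ContMDiff I 𝓘(ℝ, ℂ) ∞ f) (hg : ContMDiff I 𝓘(ℝ, ℂ) ∞ g) :
    ContMDiff I 𝓘(ℝ, ℂ) ∞ fun x ↦ f x * g x :=
  (contDiff_mul (𝕜 := ℝ) (𝔸 := ℂ)).contMDiff.comp (hf.prodMk_space hg)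

section RotationDiffeo

variable (G : Type*) [NormedAddCommGroup G] [NormedSpace ℝ G]

/-- The diffeomorphism `(u, y, z) ↦ (u, y, uz)`, which turns the action
`v · (u, y, z) = (vu, y, v̄z)` into the multiplication in the first factor. -/
def rotationDiffeo : Diffeomorph (((𝓡 1).prod 𝓘(ℝ, G)).prod 𝓘(ℝ, ℂ)) ((𝓡 1).prod 𝓘(ℝ, G × ℂ))
    ((Circle × G) × ℂ) (Circle × (G × ℂ)) ∞ where
  toFun p := (p.1.1, (p.1.2, (p.1.1 : ℂ) * p.2))
  invFun q := ((q.1, q.2.1), (starRingEnd ℂ) (q.1 : ℂ) * q.2.2)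
  left_inv p := by simp only [circle_conj_mul_mul, Prod.mk.eta]
  right_inv q := by simp only [circle_mul_conj_mul, Prod.mk.eta]
  contMDiff_toFun := (contMDiff_fst.comp contMDiff_fst).prodMk
    ((contMDiff_snd.comp contMDiff_fst).prodMk_space
      (contMDiff_complex_mul (contMDiff_circle_coe.comp (contMDiff_fst.comp contMDiff_fst))
        contMDiff_snd))
  contMDiff_invFun := (contMDiff_fst.prodMk (contDiff_fst.contMDiff.comp contMDiff_snd)).prodMk
    (contMDiff_complex_mul (contMDiff_circle_conj.comp contMDiff_fst)
      (contDiff_snd.contMDiff.comp contMDiff_snd))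

end RotationDiffeo

section Associated

variable {P : Type*} [TopologicalSpace P] {act : Circle → P → P}
  {G : Type*} [NormedAddCommGroup G] [NormedSpace ℝ G]

variable (act) in
/-- The action `u · (a, z) = (u · a, ū z)` on `P × ℂ`. -/
def assocAct (u : Circle) (p : P × ℂ) : P × ℂ := (act u p.1, (starRingEnd ℂ) (u : ℂ) * p.2)

/-- The equivariant chart of `P × ℂ` induced by an equivariant chart of `P`. -/
def CircleChart.assoc (c : CircleChart act G) : CircleChart (assocAct act) (G × ℂ) where
  toOpenPartialHomeomorph := c.toOpenPartialHomeomorph.prod (OpenPartialHomeomorph.refl ℂ) ≫ₕ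
    (rotationDiffeo G).toHomeomorph.toOpenPartialHomeomorph
  target_eq := by simp [c.target_eq]
  smul_mem u p hp := by
    simp only [mfld_simps] at hp ⊢
    exact c.smul_mem u _ hp
  map_smul u p hp := by
    simp only [mfld_simps] at hp
    have h := c.apply_smul u hp
    change (((c.toOpenPartialHomeomorph (act u p.1)).1, (c.toOpenPartialHomeomorph (act u p.1)).2,
      ((c.toOpenPartialHomeomorph (act u p.1)).1 : ℂ) * ((starRingEnd ℂ) (u : ℂ) * p.2)) :
      Circle × (G × ℂ)) = (u * (c.toOpenPartialHomeomorph p.1).1,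
      ((c.toOpenPartialHomeomorph p.1).2, ((c.toOpenPartialHomeomorph p.1).1 : ℂ) * p.2))
    rw [h, Circle.coe_mul, mul_comm (u : ℂ), mul_assoc, circle_mul_conj_mul]

theorem CircleChart.mem_assoc_source (c : CircleChart act G) {p : P × ℂ} :
    p ∈ c.assoc.source ↔ p.1 ∈ c.source := by
  simp [CircleChart.assoc]

theorem HasCircleCharts.assoc (h : HasCircleCharts act G) :
    HasCircleCharts (assocAct act) (G × ℂ) := fun p ↦ by
  obtain ⟨c, hc⟩ := h p.1
  exact ⟨c.assoc, c.mem_assoc_source.2 hc⟩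

theorem CircleChart.isPartialDiffeo_assoc {EJ HJ : Type*} [NormedAddCommGroup EJ]
    [NormedSpace ℝ EJ] [TopologicalSpace HJ] {J : ModelWithCorners ℝ EJ HJ} [ChartedSpace HJ P]
    {c : CircleChart act G}
    (hc : IsPartialDiffeo J ((𝓡 1).prod 𝓘(ℝ, G)) c.toOpenPartialHomeomorph) :
    IsPartialDiffeo (J.prod 𝓘(ℝ, ℂ)) ((𝓡 1).prod 𝓘(ℝ, G × ℂ)) c.assoc.toOpenPartialHomeomorph :=
  (hc.prod IsPartialDiffeo.refl).trans (IsPartialDiffeo.of_diffeomorph (rotationDiffeo G))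

variable (act) in
/-- The projection `[a, z] ↦ [a]`. -/
def assocOrbitProj : OrbitSpace (assocAct act) → OrbitSpace act :=
  Quot.lift (fun p ↦ orbitMk act p.1) fun _ _ ⟨u, hu⟩ ↦ Quot.sound ⟨u, congrArg Prod.fst hu⟩

variable (act) in
/-- The vector `[a, z]`, in the fibre over `[a]`. -/
def assocOrbitFiberMk (a : P) (z : ℂ) :
    (assocOrbitProj act ⁻¹' {orbitMk act a} : Set (OrbitSpace (assocAct act))) :=
  ⟨orbitMk (assocAct act) (a, z), rfl⟩

/-- As the action on `P` is free, every vector over `[a]` is `[a, z]` for exactly one `z`. -/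
theorem assocOrbitFiberMk_bijective (h : HasCircleCharts act G) (a : P) :
    Function.Bijective (assocOrbitFiberMk act a) := by
  constructor
  · intro z w hzw
    obtain ⟨u, hu⟩ := h.assoc.orbitMk_eq_iff.1 (congrArg Subtype.val hzw)
    have h1 : u = 1 := h.eq_one_of_smul_eq (congrArg Prod.fst hu)
    have h2 := congrArg Prod.snd hu
    subst h1
    simpa [assocAct] using h2
  · rintro ⟨q, hq⟩
    obtain ⟨⟨b, z⟩, rfl⟩ := Quot.mk_surjective q
    obtain ⟨u, hu⟩ := h.orbitMk_eq_iff.1 (show orbitMk act b = orbitMk act a from hq)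
    refine ⟨(starRingEnd ℂ) (u : ℂ) * z, Subtype.ext ?_⟩
    exact (h.assoc.orbitMk_eq_iff (a := (b, z))
      (b := (a, (starRingEnd ℂ) (u : ℂ) * z)).2 ⟨u, Prod.ext hu rfl⟩).symm

theorem assocOrbitFiberMk_smul (h : HasCircleCharts act G) (a : P) (u : Circle) (z : ℂ) :
    orbitMk (assocAct act) (act u a, z) = orbitMk (assocAct act) (a, (u : ℂ) * z) := by
  refine (h.assoc.orbitMk_eq_iff (a := (a, (u : ℂ) * z)) (b := (act u a, z)).2
    ⟨u, Prod.ext rfl ?_⟩).symm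
  exact circle_conj_mul_mul u z

/-- The fibres of the associated bundle carry complex vector space structures for which all maps
`z ↦ [a, z]` are linear: transport the structure of `ℂ` along one of these maps; the others differ
from it by a rotation of `ℂ`. -/
theorem exists_module_assocOrbit (h : HasCircleCharts act G) :
    ∃ (_ : ∀ q, AddCommGroup (assocOrbitProj act ⁻¹' {q} : Set (OrbitSpace (assocAct act))))
      (_ : ∀ q, Module ℂ (assocOrbitProj act ⁻¹' {q} : Set (OrbitSpace (assocAct act)))),
      ∀ a, IsLinearMap ℂ (assocOrbitFiberMk act a) := by
  have key : ∀ q, ∃ (_ : AddCommGroup (assocOrbitProj act ⁻¹' {q} :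
      Set (OrbitSpace (assocAct act))))
      (_ : Module ℂ (assocOrbitProj act ⁻¹' {q} : Set (OrbitSpace (assocAct act)))),
      ∀ (a : P) (ha : orbitMk act a = q), IsLinearMap ℂ (fun z ↦
        (⟨orbitMk (assocAct act) (a, z), ha⟩ :
          (assocOrbitProj act ⁻¹' {q} : Set (OrbitSpace (assocAct act))))) := by
    intro q
    obtain ⟨b, rfl⟩ := Quot.mk_surjective q
    let e := (Equiv.ofBijective _ (assocOrbitFiberMk_bijective h b)).symm
    let _ := e.addCommGroup
    let _ := e.module ℂ
    refine ⟨inferInstance, inferInstance, fun a ha ↦ ?_⟩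
    obtain ⟨u, rfl⟩ := h.orbitMk_eq_iff.1 ha.symm
    have h1 : (fun z ↦ (⟨orbitMk (assocAct act) (act u b, z), ha⟩ :
        (assocOrbitProj act ⁻¹' {orbitMk act b} : Set (OrbitSpace (assocAct act))))) =
        fun z ↦ (e.linearEquiv ℂ).symm ((u : ℂ) * z) := by
      funext z
      exact Subtype.ext (assocOrbitFiberMk_smul h b u z)
    rw [h1]
    exact ⟨fun z w ↦ by rw [mul_add, map_add], fun t z ↦ by
      rw [smul_eq_mul, mul_left_comm, ← smul_eq_mul, map_smul]⟩
  choose ag mod hlin using key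
  exact ⟨ag, mod, fun a ↦ hlin _ a rfl⟩

/-- The trivialization of the associated bundle defined by an equivariant chart of `P`. -/
def CircleChart.assocTrivialization (c : CircleChart act G) (h : HasCircleCharts act G) :
    Bundle.Trivialization ℂ (assocOrbitProj act) where
  toFun q := (assocOrbitProj act q, (c.assoc.orbitChart h.assoc q).2)
  invFun p := (c.assoc.orbitChart h.assoc).symm (c.orbitChart h p.1, p.2)
  source := (c.assoc.orbitChart h.assoc).source
  target := (c.orbitChart h).source ×ˢ univ
  baseSet := (c.orbitChart h).source
  map_source' q hq := by
    obtain ⟨p, rfl⟩ := Quot.mk_surjective q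
    rw [c.assoc.mk_mem_orbitChart_source, c.mem_assoc_source] at hq
    exact ⟨mem_image_of_mem _ hq, mem_univ _⟩
  map_target' p _ := (c.assoc.orbitChart h.assoc).map_target (mem_univ _)
  left_inv' q hq := by
    obtain ⟨p, rfl⟩ := Quot.mk_surjective q
    have hp := hq
    rw [c.assoc.mk_mem_orbitChart_source] at hp
    have h1 : c.orbitChart h (assocOrbitProj act (orbitMk (assocAct act) p)) =
        (c.assoc.orbitChart h.assoc (orbitMk (assocAct act) p)).1 := by
      rw [c.assoc.orbitChart_mk _ hp]
      exact c.orbitChart_mk h (c.mem_assoc_source.1 hp)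
    change (c.assoc.orbitChart h.assoc).symm
      (c.orbitChart h (assocOrbitProj act (orbitMk (assocAct act) p)),
        (c.assoc.orbitChart h.assoc (orbitMk (assocAct act) p)).2) = _
    rw [h1, Prod.mk.eta, (c.assoc.orbitChart h.assoc).left_inv hq]
  right_inv' p hp := by
    refine Prod.ext ?_ ?_
    · change (c.orbitChart h).symm (c.orbitChart h p.1) = p.1
      exact (c.orbitChart h).left_inv hp.1
    · change (c.assoc.orbitChart h.assoc ((c.assoc.orbitChart h.assoc).symm _)).2 = p.2
      rw [(c.assoc.orbitChart h.assoc).right_inv (mem_univ _)]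
  open_source := (c.assoc.orbitChart h.assoc).open_source
  open_target := (c.orbitChart h).open_source.prod isOpen_univ
  continuousOn_toFun := (Continuous.continuousOn (continuous_quot_lift _
    (continuous_quot_mk.comp continuous_fst))).prodMk
      (continuous_snd.comp_continuousOn (c.assoc.orbitChart h.assoc).continuousOn)
  continuousOn_invFun := (c.assoc.orbitChart h.assoc).continuousOn_symm.comp
    (((c.orbitChart h).continuousOn.comp continuousOn_fst fun _ hp ↦ hp.1).prodMk continuousOn_snd)
    fun _ _ ↦ mem_univ _
  open_baseSet := (c.orbitChart h).open_source
  source_eq := by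
    ext q
    obtain ⟨p, rfl⟩ := Quot.mk_surjective q
    rw [c.assoc.mk_mem_orbitChart_source, c.mem_assoc_source]
    exact (c.mk_mem_orbitChart_source h).symm
  target_eq := rfl
  proj_toFun _ _ := rfl

variable {EJ HJ : Type*} [NormedAddCommGroup EJ] [NormedSpace ℝ EJ] [TopologicalSpace HJ]
  {J : ModelWithCorners ℝ EJ HJ} [ChartedSpace HJ P] {ι : Type*} {C : ι → CircleChart act G}
  {d k : ℕ} [ChartedSpace (EuclideanSpace ℝ (Fin k)) (OrbitSpace act)]
  [ChartedSpace (EuclideanSpace ℝ (Fin d)) (OrbitSpace (assocAct act))]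
  [∀ q, AddCommGroup (assocOrbitProj act ⁻¹' {q} : Set (OrbitSpace (assocAct act)))]
  [∀ q, Module ℂ (assocOrbitProj act ⁻¹' {q} : Set (OrbitSpace (assocAct act)))]

/-- The associated bundle is a line bundle. In a trivialization, `z ↦ [a, z]` is the multiplication
by the circle coordinate of `a`, hence the trivialization is linear on the fibres. -/
theorem isComplexLineBundle_assocOrbitProj (h : HasCircleCharts act G)
    (hcov : ∀ a, ∃ i, a ∈ (C i).source)
    (hC : ∀ i, IsPartialDiffeo J ((𝓡 1).prod 𝓘(ℝ, G)) (C i).toOpenPartialHomeomorph)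
    (hmk : ContMDiff J (𝓡 k) ∞ (orbitMk act))
    (hQ : ∀ i, IsPartialDiffeo (𝓡 k) 𝓘(ℝ, G) ((C i).orbitChart h))
    (hQ' : ∀ i, IsPartialDiffeo (𝓡 d) 𝓘(ℝ, G × ℂ) ((C i).assoc.orbitChart h.assoc))
    (hlin : ∀ a, IsLinearMap ℂ (assocOrbitFiberMk act a)) :
    IsComplexLineBundle d k (assocOrbitProj act) := by
  have hproj : ContMDiff (𝓡 d) (𝓡 k) ∞ (assocOrbitProj act) :=
    contMDiff_of_comp_orbitMk (J := J.prod 𝓘(ℝ, ℂ)) (C := fun i ↦ (C i).assoc) h.assoc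
      (fun p ↦ (hcov p.1).imp fun i hi ↦ (C i).mem_assoc_source.2 hi)
      (fun i ↦ CircleChart.isPartialDiffeo_assoc (hC i)) hQ'
      (hmk.comp contMDiff_fst)
  intro q
  obtain ⟨a, rfl⟩ := Quot.mk_surjective q
  obtain ⟨i, hi⟩ := hcov a
  refine ⟨(C i).assocTrivialization h, mem_image_of_mem _ hi, ?_, ?_, fun b hb ↦ ?_⟩
  · exact hproj.contMDiffOn.prodMk (contDiff_snd.contMDiff.comp_contMDiffOn (hQ' i).1)
  · refine (hQ' i).2.comp (ContMDiffOn.prodMk_space ((hQ i).1.comp contMDiffOn_fst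
      fun p hp ↦ hp.1) contMDiffOn_snd) fun _ _ ↦ mem_univ _
  · obtain ⟨b, rfl⟩ := Quot.mk_surjective b
    have hb' : b ∈ (C i).source := ((C i).mk_mem_orbitChart_source h).1 hb
    have h1 : ∀ z, ((C i).assocTrivialization h (assocOrbitFiberMk act b z).1).2 =
        (((C i).toOpenPartialHomeomorph b).1 : ℂ) * z := fun z ↦
      congrArg Prod.snd ((C i).assoc.orbitChart_mk h.assoc (a := (b, z))
        ((C i).mem_assoc_source.2 hb'))
    have hs := (assocOrbitFiberMk_bijective h b).surjective
    refine ⟨fun v w ↦ ?_, fun t v ↦ ?_⟩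
    · obtain ⟨v, rfl⟩ := hs v
      obtain ⟨w, rfl⟩ := hs w
      change ((C i).assocTrivialization h
        (assocOrbitFiberMk act b v + assocOrbitFiberMk act b w).1).2 = _
      rw [← (hlin b).map_add, h1, h1, h1, mul_add]
    · obtain ⟨v, rfl⟩ := hs v
      change ((C i).assocTrivialization h (t • assocOrbitFiberMk act b v).1).2 = _
      rw [← (hlin b).map_smul, h1, h1, smul_eq_mul, smul_eq_mul, mul_left_comm]

end Associated

/-! ### Equivariant charts of the levels -/

section FrameDiffeo

variable (F : Type*) [NormedAddCommGroup F] [NormedSpace ℝ F]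

/-- The model space of `T*B`, where `B` is a manifold modelled on `F`; the reduced space is modelled
on it. -/
abbrev LevelModel : Type _ := F × (F →L[ℝ] ℝ)

variable {F} in
theorem fst_smul_add_comp_snd (ψ : (ℝ × F) →L[ℝ] ℝ) :
    ψ (1, 0) • ContinuousLinearMap.fst ℝ ℝ F +
      (ψ.comp (ContinuousLinearMap.inr ℝ ℝ F)).comp (ContinuousLinearMap.snd ℝ ℝ F) = ψ := by
  refine ContinuousLinearMap.ext fun v ↦ ?_
  have h : v = v.1 • ((1 : ℝ), (0 : F)) + (0, v.2) := by ext <;> simp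
  conv_rhs => rw [h, map_add, map_smul]
  simp [mul_comm]

/-- The splitting of a linear form `ψ` on `ℝ × F` into the number `ψ (1, 0) - ξ` and the
restriction of `ψ` to `F`, as a diffeomorphism. -/
def frameDiffeo (ξ : ℝ) : Diffeomorph
    (((𝓡 1).prod 𝓘(ℝ, F)).prod 𝓘(ℝ, (ℝ × F) →L[ℝ] ℝ))
    (((𝓡 1).prod 𝓘(ℝ, LevelModel F)).prod 𝓘(ℝ, ℝ))
    ((Circle × F) × ((ℝ × F) →L[ℝ] ℝ)) ((Circle × LevelModel F) × ℝ) ∞ where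
  toFun p := ((p.1.1, (p.1.2, p.2.comp (ContinuousLinearMap.inr ℝ ℝ F))), p.2 (1, 0) - ξ)
  invFun q := ((q.1.1, q.1.2.1), (q.2 + ξ) • ContinuousLinearMap.fst ℝ ℝ F +
    q.1.2.2.comp (ContinuousLinearMap.snd ℝ ℝ F))
  left_inv p := by simp only [sub_add_cancel, fst_smul_add_comp_snd]
  right_inv q := by
    refine Prod.ext (Prod.ext rfl (Prod.ext rfl ?_)) ?_
    · ext v
      simp
    · simp
  contMDiff_toFun := by
    have h1 : ContMDiff 𝓘(ℝ, (ℝ × F) →L[ℝ] ℝ) 𝓘(ℝ, F →L[ℝ] ℝ) ∞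
        (fun ψ : (ℝ × F) →L[ℝ] ℝ ↦ ψ.comp (ContinuousLinearMap.inr ℝ ℝ F)) :=
      (contDiff_id.clm_comp contDiff_const).contMDiff
    have h2 : ContMDiff 𝓘(ℝ, (ℝ × F) →L[ℝ] ℝ) 𝓘(ℝ, ℝ) ∞
        (fun ψ : (ℝ × F) →L[ℝ] ℝ ↦ ψ (1, 0) - ξ) :=
      ((contDiff_id.clm_apply contDiff_const).sub contDiff_const).contMDiff
    exact ((contMDiff_fst.comp contMDiff_fst).prodMk
      ((contMDiff_snd.comp contMDiff_fst).prodMk_space (h1.comp contMDiff_snd))).prodMk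
      (h2.comp contMDiff_snd)
  contMDiff_invFun := by
    have h1 : ContMDiff 𝓘(ℝ, LevelModel F) 𝓘(ℝ, (ℝ × F) →L[ℝ] ℝ) ∞
        (fun g : LevelModel F ↦ g.2.comp (ContinuousLinearMap.snd ℝ ℝ F)) :=
      (contDiff_snd.clm_comp contDiff_const).contMDiff
    have h2 : ContMDiff 𝓘(ℝ, ℝ) 𝓘(ℝ, (ℝ × F) →L[ℝ] ℝ) ∞
        (fun p : ℝ ↦ (p + ξ) • ContinuousLinearMap.fst ℝ ℝ F) :=
      ((contDiff_id.add contDiff_const).smul contDiff_const).contMDiff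
    exact ((contMDiff_fst.comp contMDiff_fst).prodMk
      (contDiff_fst.contMDiff.comp (contMDiff_snd.comp contMDiff_fst))).prodMk
      ((h2.comp contMDiff_snd).add (h1.comp (contMDiff_snd.comp contMDiff_fst)))

variable (G : Type*) [NormedAddCommGroup G] [NormedSpace ℝ G]

theorem contDiff_half_norm_sq : ContDiff ℝ ∞ fun z : ℂ ↦ 1 / 2 * ‖z‖ ^ 2 :=
  contDiff_const.mul (contDiff_norm_sq ℝ)

/-- The diffeomorphism `(u, y, p, z) ↦ (u, y, uz, p - |z|² / 2)`. -/
def cutDiffeo : Diffeomorph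
    ((((𝓡 1).prod 𝓘(ℝ, G)).prod 𝓘(ℝ, ℝ)).prod 𝓘(ℝ, ℂ))
    (((𝓡 1).prod 𝓘(ℝ, G × ℂ)).prod 𝓘(ℝ, ℝ))
    (((Circle × G) × ℝ) × ℂ) ((Circle × (G × ℂ)) × ℝ) ∞ where
  toFun p := (rotationDiffeo G (p.1.1, p.2), p.1.2 - 1 / 2 * ‖p.2‖ ^ 2)
  invFun q := ((((rotationDiffeo G).symm q.1).1,
    q.2 + 1 / 2 * ‖((rotationDiffeo G).symm q.1).2‖ ^ 2), ((rotationDiffeo G).symm q.1).2)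
  left_inv p := by simp
  right_inv q := by simp
  contMDiff_toFun := by
    have h1 := (rotationDiffeo G).contMDiff_toFun
    refine (h1.comp ((contMDiff_fst.comp contMDiff_fst).prodMk contMDiff_snd)).prodMk ?_
    exact (contMDiff_snd.comp contMDiff_fst).sub
      (contDiff_half_norm_sq.contMDiff.comp contMDiff_snd)
  contMDiff_invFun := by
    have h1 := (rotationDiffeo G).contMDiff_invFun.comp
      (contMDiff_fst (I := (𝓡 1).prod 𝓘(ℝ, G × ℂ)) (J := 𝓘(ℝ, ℝ)) (M := Circle × (G × ℂ)) (N := ℝ))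
    exact ((contMDiff_fst.comp h1).prodMk (contMDiff_snd.add
      (contDiff_half_norm_sq.contMDiff.comp (contMDiff_snd.comp h1)))).prodMk
      (contMDiff_snd.comp h1)

end FrameDiffeo

section SliceChart

variable (n : ℕ) (V : Type*) [TopologicalSpace V] [ChartedSpace (EuclideanSpace ℝ (Fin n)) V]
  [MulAction Circle V] (F : Type*) [NormedAddCommGroup F] [NormedSpace ℝ F]

/-- A smooth equivariant chart of `V` onto `Circle × F`, whose invariant frame consists of
isomorphisms. -/
structure SliceChart extends CircleChart (fun (u : Circle) (x : V) ↦ u • x) F where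
  isPartialDiffeo : IsPartialDiffeo (𝓡 n) ((𝓡 1).prod 𝓘(ℝ, F)) toOpenPartialHomeomorph
  exists_frame : ∀ q, ∃ A : (ℝ × F) ≃L[ℝ] EuclideanSpace ℝ (Fin n),
    toCircleChart.frame q = (A : (ℝ × F) →L[ℝ] EuclideanSpace ℝ (Fin n))

variable {n V F} [IsManifold (𝓡 n) ∞ V]

namespace SliceChart

variable (s : SliceChart n V F) (ξ : ℝ)

/-- Coordinates on `T*V` over the source of a slice chart: the last coordinate is `H - ξ`, the
others are invariant except for the one in `Circle`. -/
def adaptedChart : OpenPartialHomeomorph (Cotangent n V) ((Circle × LevelModel F) × ℝ) :=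
  s.cotangentChart s.isPartialDiffeo s.exists_frame ≫ₕ
    (frameDiffeo F ξ).toHomeomorph.toOpenPartialHomeomorph

variable {s ξ} in
theorem mem_adaptedChart_source {a : Cotangent n V} :
    a ∈ (s.adaptedChart ξ).source ↔ a.1 ∈ s.source := by
  simp only [adaptedChart, mfld_simps]
  exact Iff.rfl

theorem adaptedChart_target : (s.adaptedChart ξ).target = univ := by
  simp only [adaptedChart, mfld_simps]
  exact preimage_univ

theorem adaptedChart_apply (a : Cotangent n V) : s.adaptedChart ξ a =
    (((s.toOpenPartialHomeomorph a.1).1, ((s.toOpenPartialHomeomorph a.1).2,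
      (s.frameForm a).comp (ContinuousLinearMap.inr ℝ ℝ F))), s.frameForm a (1, 0) - ξ) := rfl

theorem adaptedChart_snd (a : Cotangent n V) (ha : a ∈ (s.adaptedChart ξ).source) :
    (s.adaptedChart ξ a).2 = hamiltonian a - ξ := by
  rw [s.hamiltonian_eq_frameForm s.isPartialDiffeo (mem_adaptedChart_source.1 ha)]
  rfl

theorem isPartialDiffeo_adaptedChart : IsPartialDiffeo (cotangentModel n)
    (((𝓡 1).prod 𝓘(ℝ, LevelModel F)).prod 𝓘(ℝ, ℝ)) (s.adaptedChart ξ) :=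
  (s.isPartialDiffeo_cotangentChart s.isPartialDiffeo s.exists_frame).trans
    (IsPartialDiffeo.of_diffeomorph (frameDiffeo F ξ))

/-- Coordinates on `T*V × ℂ` over the source of a slice chart: the last coordinate is
`H - |z|² / 2 - ξ`, the others are invariant except for the one in `Circle`. -/
def cutAdaptedChart :
    OpenPartialHomeomorph (Cotangent n V × ℂ) ((Circle × (LevelModel F × ℂ)) × ℝ) :=
  (s.adaptedChart ξ).prod (OpenPartialHomeomorph.refl ℂ) ≫ₕ
    (cutDiffeo (LevelModel F)).toHomeomorph.toOpenPartialHomeomorph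

variable {s ξ} in
theorem mem_cutAdaptedChart_source {a : Cotangent n V × ℂ} :
    a ∈ (s.cutAdaptedChart ξ).source ↔ a.1.1 ∈ s.source := by
  rw [← mem_adaptedChart_source (ξ := ξ)]
  simp only [cutAdaptedChart, mfld_simps]

theorem cutAdaptedChart_target : (s.cutAdaptedChart ξ).target = univ := by
  simp only [cutAdaptedChart, mfld_simps, adaptedChart_target]

theorem cutAdaptedChart_apply (a : Cotangent n V × ℂ) : s.cutAdaptedChart ξ a =
    (rotationDiffeo (LevelModel F) ((s.adaptedChart ξ a.1).1, a.2),
      (s.adaptedChart ξ a.1).2 - 1 / 2 * ‖a.2‖ ^ 2) := rfl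

theorem cutAdaptedChart_snd (a : Cotangent n V × ℂ) (ha : a ∈ (s.cutAdaptedChart ξ).source) :
    (s.cutAdaptedChart ξ a).2 = cutHamiltonian a - ξ := by
  rw [cutAdaptedChart_apply, s.adaptedChart_snd ξ a.1
    (mem_adaptedChart_source.2 (mem_cutAdaptedChart_source.1 ha)), cutHamiltonian, sub_right_comm]

theorem isPartialDiffeo_cutAdaptedChart : IsPartialDiffeo ((cotangentModel n).prod 𝓘(ℝ, ℂ))
    (((𝓡 1).prod 𝓘(ℝ, LevelModel F × ℂ)).prod 𝓘(ℝ, ℝ)) (s.cutAdaptedChart ξ) :=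
  ((s.isPartialDiffeo_adaptedChart ξ).prod IsPartialDiffeo.refl).trans
    (IsPartialDiffeo.of_diffeomorph (cutDiffeo (LevelModel F)))

variable [ContMDiffSMul (𝓡 1) (𝓡 n) ∞ Circle V]

theorem adaptedChart_smul (u : Circle) {a : Cotangent n V} (ha : a.1 ∈ s.source) :
    s.adaptedChart ξ (cotangentSMul u a) = ((u * (s.adaptedChart ξ a).1.1,
      (s.adaptedChart ξ a).1.2), (s.adaptedChart ξ a).2) := by
  have h : s.toOpenPartialHomeomorph (cotangentSMul u a).1 = _ := s.apply_smul u ha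
  rw [adaptedChart_apply, adaptedChart_apply, s.frameForm_smul s.isPartialDiffeo u ha, h]

/-- The equivariant chart of `H⁻¹(ξ)` defined by a slice chart. -/
def level : CircleChart (levelSMul : Circle → Level n V ξ → Level n V ξ) (LevelModel F) where
  toOpenPartialHomeomorph :=
    levelChart (s.adaptedChart ξ) (s.adaptedChart_snd ξ) (s.adaptedChart_target ξ)
  target_eq := rfl
  smul_mem u _ ha := mem_adaptedChart_source.2 (s.smul_mem u _ (mem_adaptedChart_source.1 ha))
  map_smul u _ ha := congrArg Prod.fst (s.adaptedChart_smul ξ u (mem_adaptedChart_source.1 ha))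

variable {s ξ} in
theorem mem_level_source {a : Level n V ξ} : a ∈ (s.level ξ).source ↔ a.1.1 ∈ s.source :=
  mem_adaptedChart_source

/-- The equivariant chart of `{H - |z|² / 2 = ξ}` defined by a slice chart. -/
def cut : CircleChart (cutSMul : Circle → CutLevel n V ξ → CutLevel n V ξ) (LevelModel F × ℂ) where
  toOpenPartialHomeomorph :=
    levelChart (s.cutAdaptedChart ξ) (s.cutAdaptedChart_snd ξ) (s.cutAdaptedChart_target ξ)
  target_eq := rfl
  smul_mem u a ha :=
    mem_cutAdaptedChart_source.2 (s.smul_mem u _ (mem_cutAdaptedChart_source.1 ha))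
  map_smul u a ha := by
    have h := s.adaptedChart_smul ξ u (mem_cutAdaptedChart_source.1 ha)
    change rotationDiffeo (LevelModel F) ((s.adaptedChart ξ (cotangentSMul u a.1.1)).1,
      (starRingEnd ℂ) (u : ℂ) * a.1.2) =
      (u * (rotationDiffeo (LevelModel F) ((s.adaptedChart ξ a.1.1).1, a.1.2)).1,
        (rotationDiffeo (LevelModel F) ((s.adaptedChart ξ a.1.1).1, a.1.2)).2)
    rw [h]
    refine Prod.ext rfl (Prod.ext rfl ?_)
    change ((u * (s.adaptedChart ξ a.1.1).1.1 : Circle) : ℂ) * ((starRingEnd ℂ) (u : ℂ) * a.1.2) =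
      ((s.adaptedChart ξ a.1.1).1.1 : ℂ) * a.1.2
    rw [Circle.coe_mul, mul_comm (u : ℂ), mul_assoc, circle_mul_conj_mul]

variable {s ξ} in
theorem mem_cut_source {a : CutLevel n V ξ} : a ∈ (s.cut ξ).source ↔ a.1.1.1 ∈ s.source :=
  mem_cutAdaptedChart_source

end SliceChart

end SliceChart

/-! ### An invariant connection form -/

section Connection

variable {n : ℕ} {V : Type*} [TopologicalSpace V] [ChartedSpace (EuclideanSpace ℝ (Fin n)) V]
  [IsManifold (𝓡 n) ∞ V] [MulAction Circle V]
  {F : Type*} [NormedAddCommGroup F] [NormedSpace ℝ F]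
  {ι : Type*} {s : ι → SliceChart n V F}

/-- There are partitions of unity of `V` by invariant functions, subordinate to any covering by
slice charts: they are pulled back from the orbit space. -/
theorem exists_invariant_partition [T2Space V] [SecondCountableTopology V]
    (hcov : ∀ x, ∃ i, x ∈ (s i).source) {k : ℕ} (L : F ≃L[ℝ] EuclideanSpace ℝ (Fin k))
    (L' : (EuclideanSpace ℝ (Fin 1) × F) ≃L[ℝ] EuclideanSpace ℝ (Fin n)) :
    ∃ ρ : SmoothPartitionOfUnity ι (𝓡 n) V univ, (∀ i, tsupport (ρ i) ⊆ (s i).source) ∧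
      ∀ i (u : Circle) x, ρ i (u • x) = ρ i x := by
  have h : HasCircleCharts (fun (u : Circle) (x : V) ↦ u • x) F := fun x ↦
    (hcov x).imp' (fun i ↦ (s i).toCircleChart) fun i hi ↦ hi
  obtain ⟨cs, hm, hsub, hQ⟩ := exists_chartedSpace_orbitSpace (J := 𝓡 n)
    (C := fun i ↦ (s i).toCircleChart) h hcov (fun i ↦ (s i).isPartialDiffeo) L L'
  have := h.t2Space
  have := h.secondCountableTopology
  have : LocallyCompactSpace (OrbitSpace (fun (u : Circle) (x : V) ↦ u • x)) :=
    ChartedSpace.locallyCompactSpace (EuclideanSpace ℝ (Fin k)) _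
  obtain ⟨f, hf⟩ := SmoothPartitionOfUnity.exists_isSubordinate (𝓡 k)
    (isClosed_univ (X := OrbitSpace (fun (u : Circle) (x : V) ↦ u • x)))
    (fun i ↦ ((s i).orbitChart h).source) (fun i ↦ ((s i).orbitChart h).open_source)
    (fun q _ ↦ by
      obtain ⟨x, rfl⟩ := Quot.mk_surjective q
      obtain ⟨i, hi⟩ := hcov x
      exact mem_iUnion.2 ⟨i, mem_image_of_mem _ hi⟩)
  have hπ : Continuous (orbitMk (fun (u : Circle) (x : V) ↦ u • x)) := continuous_quot_mk
  let ρ : SmoothPartitionOfUnity ι (𝓡 n) V univ :=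
    { toFun := fun i ↦ ⟨fun x ↦ f i (orbitMk _ x), (f i).contMDiff.comp hsub.contMDiff⟩
      locallyFinite' := f.locallyFinite.preimage_continuous hπ
      nonneg' := fun i x ↦ f.nonneg i _
      sum_eq_one' := fun x _ ↦ f.sum_eq_one (mem_univ (orbitMk _ x))
      sum_le_one' := fun x ↦ f.sum_le_one (orbitMk _ x) }
  refine ⟨ρ, fun i x hx ↦ ?_, fun i u x ↦ congrArg (f i) (h.orbitMk_smul u x)⟩
  exact ((s i).mk_mem_orbitChart_source h).1
    (hf i (tsupport_comp_subset_preimage (f i) hπ hx))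

variable (n) in
/-- The differential of `y ↦ u • y` at `x`, as a map of the model space. -/
def smulDeriv (u : Circle) (x : V) : EuclideanSpace ℝ (Fin n) →L[ℝ] EuclideanSpace ℝ (Fin n) :=
  mfderiv (𝓡 n) (𝓡 n) (fun y : V ↦ u • y) x

variable [ContMDiffSMul (𝓡 1) (𝓡 n) ∞ Circle V]

namespace SliceChart

variable (c : SliceChart n V F)

/-- The linear form on `T_x V` that is dual to the fundamental vector field in the invariant frame
of a slice chart. -/
def connection (x : V) : EuclideanSpace ℝ (Fin n) →L[ℝ] ℝ :=
  (ContinuousLinearMap.fst ℝ ℝ F).comp (c.frame (n := n) (c.toOpenPartialHomeomorph x)).inverse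

omit [IsManifold (𝓡 n) ∞ V] [ContMDiffSMul (𝓡 1) (𝓡 n) ∞ Circle V] in
theorem connection_fundamentalField {x : V} (hx : x ∈ c.source) :
    c.connection x (fundamentalField n x) = 1 := by
  have h := c.frame_fundamental c.isPartialDiffeo (c.toOpenPartialHomeomorph x)
  rw [c.toOpenPartialHomeomorph.left_inv hx] at h
  obtain ⟨A, hA⟩ := c.exists_frame (c.toOpenPartialHomeomorph x)
  rw [hA] at h
  rw [connection, hA, ContinuousLinearMap.inverse_equiv, ← h]
  change (A.symm (A (1, 0))).1 = 1
  rw [A.symm_apply_apply]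

omit [IsManifold (𝓡 n) ∞ V] in
theorem connection_smul (u : Circle) {x : V} (hx : x ∈ c.source) :
    c.connection (u • x) = (c.connection x).comp
      (smulDeriv n u x).inverse := by
  have h2 : (smulDeriv n u x).IsInvertible := isInvertible_mfderiv_smul (n := n) u x
  have h3 : c.toOpenPartialHomeomorph (u • x) = _ := c.apply_smul u hx
  have h4 : c.frame (n := n)
      (u * (c.toOpenPartialHomeomorph x).1, (c.toOpenPartialHomeomorph x).2) =
      (smulDeriv n u x).comp (c.frame (n := n) (c.toOpenPartialHomeomorph x)) := by
    rw [c.frame_smul c.isPartialDiffeo, c.toOpenPartialHomeomorph.left_inv hx]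
    rfl
  rw [connection, h3, h4, h2.inverse_comp_of_left]
  rfl

omit [ContMDiffSMul (𝓡 1) (𝓡 n) ∞ Circle V] in
theorem contMDiffAt_connection {x₀ : V} (hx₀ : x₀ ∈ c.source) :
    ContMDiffAt (𝓡 n) 𝓘(ℝ, EuclideanSpace ℝ (Fin n) →L[ℝ] ℝ) ∞
      (fun x ↦ (c.connection x).comp (tangentCoordSymm (n := n) x₀ x)) x₀ := by
  have h1 : ContMDiffAt (𝓡 n) (cotangentModel n) ∞ (fun x ↦ c.ofFrameForm
      (c.toOpenPartialHomeomorph x, ContinuousLinearMap.fst ℝ ℝ F)) x₀ :=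
    ContMDiffAt.comp x₀ (c.contMDiff_ofFrameForm c.isPartialDiffeo c.exists_frame _)
      ((c.isPartialDiffeo.contMDiffAt hx₀).prodMk contMDiffAt_const)
  refine ((contMDiffAt_cotangent_iff.1 h1).2).congr_of_eventuallyEq ?_
  filter_upwards [c.open_source.mem_nhds hx₀] with x hx
  have e1 : ∀ x ∈ c.source, (c.ofFrameForm (n := n)
      (c.toOpenPartialHomeomorph x, ContinuousLinearMap.fst ℝ ℝ F)).1 = x := fun x hx ↦
    c.toOpenPartialHomeomorph.left_inv hx
  rw [e1 x hx, e1 x₀ hx₀]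
  rfl

end SliceChart

/-- There is an invariant connection form: an invariant smooth `1`-form `θ` with `θ(X) = 1`.
Such forms exist locally, and an invariant partition of unity glues them. -/
theorem exists_connection [T2Space V] [SecondCountableTopology V]
    (hcov : ∀ x, ∃ i, x ∈ (s i).source) {k : ℕ} (L : F ≃L[ℝ] EuclideanSpace ℝ (Fin k))
    (L' : (EuclideanSpace ℝ (Fin 1) × F) ≃L[ℝ] EuclideanSpace ℝ (Fin n)) :
    ∃ θ : V → EuclideanSpace ℝ (Fin n) →L[ℝ] ℝ,
      (∀ x, θ x (fundamentalField n x) = 1) ∧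
      (∀ (u : Circle) (x : V), θ (u • x) = (θ x).comp
        (smulDeriv n u x).inverse) ∧
      ∀ x₀, ContMDiffAt (𝓡 n) 𝓘(ℝ, EuclideanSpace ℝ (Fin n) →L[ℝ] ℝ) ∞
        (fun x ↦ (θ x).comp (tangentCoordSymm (n := n) x₀ x)) x₀ := by
  obtain ⟨ρ, hρ, hinv⟩ := exists_invariant_partition hcov L L'
  have hmem : ∀ i x, ρ i x ≠ 0 → x ∈ (s i).source := fun i x h ↦ hρ i (subset_tsupport _ h)
  have hfin : ∀ x, (Function.support fun i ↦ ρ i x • (s i).connection x).Finite := fun x ↦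
    (ρ.locallyFinite.point_finite x).subset fun i hi ↦ by
      intro h0
      exact hi (by simp only [h0, zero_smul])
  -- a linear operation on the values of the form commutes with the locally finite sum
  have hmap : ∀ {W : Type _} [NormedAddCommGroup W] [NormedSpace ℝ W]
      (T : (EuclideanSpace ℝ (Fin n) →L[ℝ] ℝ) →L[ℝ] W) (x : V),
      T (∑ᶠ i, ρ i x • (s i).connection x) = ∑ᶠ i, ρ i x • T ((s i).connection x) := by
    intro W _ _ T x
    refine ((T : (EuclideanSpace ℝ (Fin n) →L[ℝ] ℝ) →+ W).map_finsum (hfin x)).trans ?_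
    exact finsum_congr fun i ↦ T.map_smul _ _
  refine ⟨fun x ↦ ∑ᶠ i, ρ i x • (s i).connection x, fun x ↦ ?_, fun u x ↦ ?_, fun x₀ ↦ ?_⟩
  · refine (hmap (ContinuousLinearMap.apply ℝ ℝ (fundamentalField n x : EuclideanSpace ℝ (Fin n)))
      x).trans ?_
    rw [← ρ.sum_eq_one (mem_univ x)]
    refine finsum_congr fun i ↦ ?_
    by_cases h0 : ρ i x = 0
    · rw [h0, zero_smul]
    · change ρ i x • (s i).connection x (fundamentalField n x) = ρ i x
      rw [(s i).connection_fundamentalField (hmem i x h0), smul_eq_mul, mul_one]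
  · refine Eq.trans ?_ (hmap ((ContinuousLinearMap.compL ℝ _ _ ℝ).flip
      (smulDeriv n u x).inverse) x).symm
    refine finsum_congr fun i ↦ ?_
    rw [hinv]
    by_cases h0 : ρ i x = 0
    · rw [h0, zero_smul, zero_smul]
    · rw [(s i).connection_smul u (hmem i x h0)]
      rfl
  · have h1 := ρ.contMDiffAt_finsum (n := ⊤) (x₀ := x₀)
      (g := fun i x ↦ ((s i).connection x).comp (tangentCoordSymm (n := n) x₀ x))
      fun i hi ↦ (s i).contMDiffAt_connection (hρ i hi)
    refine h1.congr_of_eventuallyEq (Eventually.of_forall fun x ↦ ?_)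
    exact hmap ((ContinuousLinearMap.compL ℝ _ _ ℝ).flip (tangentCoordSymm (n := n) x₀ x)) x

end Connection

/-! ### Translation along a connection form -/

section Translate

variable {n : ℕ} {V : Type*} [TopologicalSpace V] [ChartedSpace (EuclideanSpace ℝ (Fin n)) V]

/-- The translation `(x, φ) ↦ (x, φ + r θ_x)` of `T*V`, as a function of `((x, φ), r)`. -/
def translate (θ : V → EuclideanSpace ℝ (Fin n) →L[ℝ] ℝ) (p : Cotangent n V × ℝ) :
    Cotangent n V :=
  ⟨p.1.1, (covector p.1 + p.2 • θ p.1.1 : EuclideanSpace ℝ (Fin n) →L[ℝ] ℝ)⟩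

variable {θ : V → EuclideanSpace ℝ (Fin n) →L[ℝ] ℝ}

theorem translate_zero (a : Cotangent n V) : translate θ (a, 0) = a := by
  refine congrArg (Bundle.TotalSpace.mk a.1) ?_
  change covector a + (0 : ℝ) • θ a.1 = covector a
  rw [zero_smul, add_zero]

theorem translate_translate (a : Cotangent n V) (r t : ℝ) :
    translate θ (translate θ (a, r), t) = translate θ (a, r + t) := by
  refine congrArg (Bundle.TotalSpace.mk a.1) ?_
  change covector a + r • θ a.1 + t • θ a.1 = covector a + (r + t) • θ a.1
  rw [add_smul, add_assoc]

theorem contMDiff_translate [IsManifold (𝓡 n) ∞ V]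
    (hθ : ∀ x₀, ContMDiffAt (𝓡 n) 𝓘(ℝ, EuclideanSpace ℝ (Fin n) →L[ℝ] ℝ) ∞
      (fun x ↦ (θ x).comp (tangentCoordSymm (n := n) x₀ x)) x₀) :
    ContMDiff ((cotangentModel n).prod 𝓘(ℝ, ℝ)) (cotangentModel n) ∞ (translate θ) := by
  intro p₀
  have h1 : ContMDiffAt ((cotangentModel n).prod 𝓘(ℝ, ℝ)) (cotangentModel n) ∞
      (fun p : Cotangent n V × ℝ ↦ p.1) p₀ := contMDiffAt_fst
  obtain ⟨h2, h3⟩ := contMDiffAt_cotangent_iff.1 h1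
  refine contMDiffAt_cotangent_iff.2 ⟨h2, ?_⟩
  have h4 := ContMDiffAt.comp p₀ (hθ p₀.1.1) h2
  have h5 : ContMDiffAt ((cotangentModel n).prod 𝓘(ℝ, ℝ)) 𝓘(ℝ, ℝ) ∞
      (fun p : Cotangent n V × ℝ ↦ p.2) p₀ := contMDiffAt_snd
  exact h3.add (h5.smul h4)

variable [MulAction Circle V]

theorem hamiltonian_translate (hθ : ∀ x, θ x (fundamentalField n x) = 1) (a : Cotangent n V)
    (r : ℝ) : hamiltonian (translate θ (a, r)) = hamiltonian a + r := by
  change covector a (fundamentalField n a.1) + r * θ a.1 (fundamentalField n a.1) = _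
  rw [hθ, mul_one]
  rfl

theorem translate_smul (hθ : ∀ (u : Circle) (x : V),
      θ (u • x) = (θ x).comp (smulDeriv n u x).inverse) (u : Circle) (a : Cotangent n V) (r : ℝ) :
    translate θ (cotangentSMul u a, r) = cotangentSMul u (translate θ (a, r)) := by
  refine congrArg (Bundle.TotalSpace.mk (u • a.1)) ?_
  change (covector a).comp (smulDeriv n u a.1).inverse + r • θ (u • a.1) =
    (covector a + r • θ a.1).comp (smulDeriv n u a.1).inverse
  rw [hθ, ContinuousLinearMap.add_comp, ContinuousLinearMap.smul_comp]

variable {ξ : ℝ}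

/-- The map `(x, φ, z) ↦ (x, φ - |z|² / 2 θ_x, z)` of `{H - |z|² / 2 = ξ}` to `H⁻¹(ξ) × ℂ`. -/
def cutToAssoc (hθ : ∀ x, θ x (fundamentalField n x) = 1) (a : CutLevel n V ξ) :
    Level n V ξ × ℂ :=
  (⟨translate θ (a.1.1, -(1 / 2 * ‖a.1.2‖ ^ 2)), by
    rw [hamiltonian_translate hθ, ← sub_eq_add_neg]
    exact a.2⟩, a.1.2)

/-- The map `(x, φ, z) ↦ (x, φ + |z|² / 2 θ_x, z)`, inverse to `cutToAssoc`. -/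
def assocToCut (hθ : ∀ x, θ x (fundamentalField n x) = 1) (p : Level n V ξ × ℂ) :
    CutLevel n V ξ :=
  ⟨(translate θ (p.1.1, 1 / 2 * ‖p.2‖ ^ 2), p.2), by
    rw [cutHamiltonian, hamiltonian_translate hθ, add_sub_cancel_right, p.1.2]⟩

theorem assocToCut_cutToAssoc (hθ : ∀ x, θ x (fundamentalField n x) = 1) (a : CutLevel n V ξ) :
    assocToCut hθ (cutToAssoc hθ a) = a := by
  refine Subtype.ext (Prod.ext ?_ rfl)
  change translate θ (translate θ (a.1.1, -(1 / 2 * ‖a.1.2‖ ^ 2)), 1 / 2 * ‖a.1.2‖ ^ 2) = a.1.1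
  rw [translate_translate, neg_add_cancel, translate_zero]

theorem cutToAssoc_assocToCut (hθ : ∀ x, θ x (fundamentalField n x) = 1)
    (p : Level n V ξ × ℂ) : cutToAssoc hθ (assocToCut hθ p) = p := by
  refine Prod.ext (Subtype.ext ?_) rfl
  change translate θ (translate θ (p.1.1, 1 / 2 * ‖p.2‖ ^ 2), -(1 / 2 * ‖p.2‖ ^ 2)) = p.1.1
  rw [translate_translate, add_neg_cancel, translate_zero]

theorem cutToAssoc_levelInclusion (hθ : ∀ x, θ x (fundamentalField n x) = 1)
    (a : Level n V ξ) : cutToAssoc hθ (levelInclusion a) = (a, 0) := by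
  refine Prod.ext (Subtype.ext ?_) rfl
  change translate θ (a.1, -(1 / 2 * ‖(0 : ℂ)‖ ^ 2)) = a.1
  rw [norm_zero, zero_pow two_ne_zero, mul_zero, neg_zero, translate_zero]

section Equivariance

variable [ContMDiffSMul (𝓡 1) (𝓡 n) ∞ Circle V]

theorem cutToAssoc_smul (hθ : ∀ x, θ x (fundamentalField n x) = 1)
    (hθ' : ∀ (u : Circle) (x : V), θ (u • x) = (θ x).comp (smulDeriv n u x).inverse)
    (u : Circle) (a : CutLevel n V ξ) :
    cutToAssoc hθ (cutSMul u a) = assocSMul u (cutToAssoc hθ a) := by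
  refine Prod.ext (Subtype.ext ?_) rfl
  change translate θ (cotangentSMul u a.1.1, -(1 / 2 * ‖(starRingEnd ℂ) (u : ℂ) * a.1.2‖ ^ 2)) =
    cotangentSMul u (translate θ (a.1.1, -(1 / 2 * ‖a.1.2‖ ^ 2)))
  rw [norm_mul, RCLike.norm_conj, Circle.norm_coe, one_mul, translate_smul hθ']

end Equivariance

variable [IsManifold (𝓡 n) ∞ V] {EL EC : Type*} [NormedAddCommGroup EL] [NormedSpace ℝ EL]
  [NormedAddCommGroup EC] [NormedSpace ℝ EC] [ChartedSpace EL (Level n V ξ)]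
  [ChartedSpace EC (CutLevel n V ξ)]

theorem contMDiff_cutToAssoc (hθ : ∀ x, θ x (fundamentalField n x) = 1)
    (hθs : ContMDiff ((cotangentModel n).prod 𝓘(ℝ, ℝ)) (cotangentModel n) ∞ (translate θ))
    [IsManifold 𝓘(ℝ, EL) ∞ (Level n V ξ)]
    (hL : IsSmoothEmbedding 𝓘(ℝ, EL) (cotangentModel n) ∞
      (Subtype.val : Level n V ξ → Cotangent n V))
    (hC : IsSmoothEmbedding 𝓘(ℝ, EC) ((cotangentModel n).prod 𝓘(ℝ, ℂ)) ∞
      (Subtype.val : CutLevel n V ξ → Cotangent n V × ℂ)) :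
    ContMDiff 𝓘(ℝ, EC) (𝓘(ℝ, EL).prod 𝓘(ℝ, ℂ)) ∞
      (cutToAssoc hθ : CutLevel n V ξ → Level n V ξ × ℂ) := by
  have h1 := hC.isImmersion.contMDiff
  have h2 : ContMDiff 𝓘(ℝ, EC) (cotangentModel n) ∞ fun a : CutLevel n V ξ ↦
      translate θ (a.1.1, -(1 / 2 * ‖a.1.2‖ ^ 2)) :=
    hθs.comp ((contMDiff_fst.comp h1).prodMk
      (contDiff_half_norm_sq.neg.contMDiff.comp (contMDiff_snd.comp h1)))
  refine ContMDiff.prodMk ?_ (contMDiff_snd.comp h1)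
  exact (ContMDiff.iff_comp_isImmersion hL.isImmersion).2 ⟨h2.continuous.subtype_mk _, h2⟩

theorem contMDiff_assocToCut (hθ : ∀ x, θ x (fundamentalField n x) = 1)
    (hθs : ContMDiff ((cotangentModel n).prod 𝓘(ℝ, ℝ)) (cotangentModel n) ∞ (translate θ))
    [IsManifold 𝓘(ℝ, EC) ∞ (CutLevel n V ξ)]
    (hL : IsSmoothEmbedding 𝓘(ℝ, EL) (cotangentModel n) ∞
      (Subtype.val : Level n V ξ → Cotangent n V))
    (hC : IsSmoothEmbedding 𝓘(ℝ, EC) ((cotangentModel n).prod 𝓘(ℝ, ℂ)) ∞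
      (Subtype.val : CutLevel n V ξ → Cotangent n V × ℂ)) :
    ContMDiff (𝓘(ℝ, EL).prod 𝓘(ℝ, ℂ)) 𝓘(ℝ, EC) ∞
      (assocToCut hθ : Level n V ξ × ℂ → CutLevel n V ξ) := by
  have h1 := hL.isImmersion.contMDiff
  have h2 : ContMDiff (𝓘(ℝ, EL).prod 𝓘(ℝ, ℂ)) ((cotangentModel n).prod 𝓘(ℝ, ℂ)) ∞
      fun p : Level n V ξ × ℂ ↦ (translate θ (p.1.1, 1 / 2 * ‖p.2‖ ^ 2), p.2) :=
    (hθs.comp ((h1.comp contMDiff_fst).prodMk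
      (contDiff_half_norm_sq.contMDiff.comp contMDiff_snd))).prodMk contMDiff_snd
  exact (ContMDiff.iff_comp_isImmersion hC.isImmersion).2 ⟨h2.continuous.subtype_mk _, h2⟩

end Translate

section OrbitDiffeo

variable {P P' G G' : Type*} [TopologicalSpace P] [TopologicalSpace P']
  {act : Circle → P → P} {act' : Circle → P' → P'}
  [NormedAddCommGroup G] [NormedSpace ℝ G] [NormedAddCommGroup G'] [NormedSpace ℝ G']
  {E H E' H' : Type*} [NormedAddCommGroup E] [NormedSpace ℝ E] [TopologicalSpace H]
  [NormedAddCommGroup E'] [NormedSpace ℝ E'] [TopologicalSpace H']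
  {J : ModelWithCorners ℝ E H} {J' : ModelWithCorners ℝ E' H'} [ChartedSpace H P]
  [ChartedSpace H' P'] {ι ι' : Type*} {C : ι → CircleChart act G} {C' : ι' → CircleChart act' G'}
  {k k' : ℕ} [ChartedSpace (EuclideanSpace ℝ (Fin k)) (OrbitSpace act)]
  [ChartedSpace (EuclideanSpace ℝ (Fin k')) (OrbitSpace act')]

/-- An equivariant diffeomorphism induces a diffeomorphism of the orbit spaces. -/
theorem exists_diffeomorph_orbitSpace (h : HasCircleCharts act G) (h' : HasCircleCharts act' G')
    (hcov : ∀ a, ∃ i, a ∈ (C i).source) (hcov' : ∀ a, ∃ i, a ∈ (C' i).source)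
    (hC : ∀ i, IsPartialDiffeo J ((𝓡 1).prod 𝓘(ℝ, G)) (C i).toOpenPartialHomeomorph)
    (hC' : ∀ i, IsPartialDiffeo J' ((𝓡 1).prod 𝓘(ℝ, G')) (C' i).toOpenPartialHomeomorph)
    (hQ : ∀ i, IsPartialDiffeo (𝓡 k) 𝓘(ℝ, G) ((C i).orbitChart h))
    (hQ' : ∀ i, IsPartialDiffeo (𝓡 k') 𝓘(ℝ, G') ((C' i).orbitChart h'))
    (hmk : ContMDiff J (𝓡 k) ∞ (orbitMk act)) (hmk' : ContMDiff J' (𝓡 k') ∞ (orbitMk act'))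
    {f : P → P'} {g : P' → P} (hf : ContMDiff J J' ∞ f) (hg : ContMDiff J' J ∞ g)
    (hfu : ∀ u a, f (act u a) = act' u (f a)) (hgf : ∀ a, g (f a) = a) (hfg : ∀ b, f (g b) = b) :
    ∃ Φ : OrbitSpace act ≃ₘ^∞⟮𝓡 k, 𝓡 k'⟯ OrbitSpace act',
      ∀ a, Φ (orbitMk act a) = orbitMk act' (f a) := by
  have hgu : ∀ u b, g (act' u b) = act u (g b) := fun u b ↦ by
    rw [← hgf (act u (g b)), hfu, hfg]
  let F : OrbitSpace act → OrbitSpace act' :=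
    Quot.lift (fun a ↦ orbitMk act' (f a)) fun a _ ⟨u, hu⟩ ↦ Quot.sound ⟨u, by rw [← hfu, hu]⟩
  let F' : OrbitSpace act' → OrbitSpace act :=
    Quot.lift (fun b ↦ orbitMk act (g b)) fun b _ ⟨u, hu⟩ ↦ Quot.sound ⟨u, by rw [← hgu, hu]⟩
  exact ⟨{
    toFun := F
    invFun := F'
    left_inv := by
      rintro ⟨a⟩
      exact congrArg (orbitMk act) (hgf a)
    right_inv := by
      rintro ⟨b⟩
      exact congrArg (orbitMk act') (hfg b)
    contMDiff_toFun := contMDiff_of_comp_orbitMk h hcov hC hQ (hmk'.comp hf)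
    contMDiff_invFun := contMDiff_of_comp_orbitMk h' hcov' hC' hQ' (hmk.comp hg) }, fun _ ↦ rfl⟩

end OrbitDiffeo

/-! ### Existence of slice charts, the empty case, and dimension counts -/

section Existence

variable {n : ℕ} {V : Type*} [TopologicalSpace V] [ChartedSpace (EuclideanSpace ℝ (Fin n)) V]
  [IsManifold (𝓡 n) ∞ V] [MulAction Circle V] [ContMDiffSMul (𝓡 1) (𝓡 n) ∞ Circle V]

theorem exists_sliceChart [T2Space V] (hn : 1 ≤ n)
    (hfree : ∀ (u : Circle) (x : V), u • x = x → u = 1) (x₀ : V) :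
    ∃ s : SliceChart n V (EuclideanSpace ℝ (Fin (n - 1))), x₀ ∈ s.source := by
  obtain ⟨c, hx, hc, hd⟩ := exists_circleChart hn hfree x₀
  exact ⟨⟨c, hc, fun q ↦ c.exists_frame_equiv (hd q)⟩, hx⟩

/-- The fundamental vector field does not vanish, hence the dimension is positive. -/
theorem one_le_dim (hfree : ∀ (u : Circle) (x : V), u • x = x → u = 1) (x : V) : 1 ≤ n := by
  by_contra! h
  obtain rfl : n = 0 := by omega
  exact fundamentalField_ne_zero hfree x
    (Subsingleton.elim (α := EuclideanSpace ℝ (Fin 0)) _ _)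

end Existence

section Empty

variable {E H M E' H' M' : Type*} [NormedAddCommGroup E] [NormedSpace ℝ E] [TopologicalSpace H]
  [NormedAddCommGroup E'] [NormedSpace ℝ E'] [TopologicalSpace H'] {I : ModelWithCorners ℝ E H}
  {I' : ModelWithCorners ℝ E' H'} [TopologicalSpace M] [ChartedSpace H M] [TopologicalSpace M']
  [ChartedSpace H' M'] [IsEmpty M]

theorem isImmersion_of_isEmpty (f : M → M') : IsImmersion I I' ∞ f :=
  IsImmersionOfComplement.isImmersion (F := ℝ) fun x ↦ isEmptyElim x

theorem isSubmersion_of_isEmpty (f : M → M') : IsSubmersion I I' ∞ f :=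
  IsSubmersionOfComplement.isSubmersion (F := ℝ) fun x ↦ isEmptyElim x

end Empty

section Dimensions

theorem nonempty_equiv_of_finrank_eq {E E' : Type*} [NormedAddCommGroup E] [NormedSpace ℝ E]
    [NormedAddCommGroup E'] [NormedSpace ℝ E'] [FiniteDimensional ℝ E] [FiniteDimensional ℝ E']
    (h : Module.finrank ℝ E = Module.finrank ℝ E') : Nonempty (E ≃L[ℝ] E') :=
  ⟨ContinuousLinearEquiv.ofFinrankEq h⟩

theorem finrank_levelModel (m : ℕ) :
    Module.finrank ℝ (LevelModel (EuclideanSpace ℝ (Fin m))) = 2 * m := by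
  have h : Module.finrank ℝ (EuclideanSpace ℝ (Fin m) →L[ℝ] ℝ) = m := by
    rw [← (LinearMap.toContinuousLinearMap (𝕜 := ℝ) (E := EuclideanSpace ℝ (Fin m))
      (F' := ℝ)).finrank_eq, Module.finrank_linearMap]
    simp
  rw [Module.finrank_prod, h, finrank_euclideanSpace_fin, two_mul]

variable {n : ℕ}

theorem nonempty_equiv_slice (hn : 1 ≤ n) : Nonempty ((EuclideanSpace ℝ (Fin 1) ×
    EuclideanSpace ℝ (Fin (n - 1))) ≃L[ℝ] EuclideanSpace ℝ (Fin n)) := by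
  refine nonempty_equiv_of_finrank_eq ?_
  simp only [Module.finrank_prod, finrank_euclideanSpace_fin]
  omega

theorem nonempty_equiv_level (hn : 1 ≤ n) : Nonempty ((EuclideanSpace ℝ (Fin 1) ×
    LevelModel (EuclideanSpace ℝ (Fin (n - 1)))) ≃L[ℝ] EuclideanSpace ℝ (Fin (2 * n - 1))) := by
  refine nonempty_equiv_of_finrank_eq ?_
  rw [Module.finrank_prod, finrank_levelModel, finrank_euclideanSpace_fin,
    finrank_euclideanSpace_fin]
  omega

theorem nonempty_equiv_level_prod (hn : 1 ≤ n) : Nonempty ((EuclideanSpace ℝ (Fin (2 * n - 1)) ×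
    ℝ) ≃L[ℝ] LevelModel (EuclideanSpace ℝ (Fin n))) := by
  refine nonempty_equiv_of_finrank_eq ?_
  rw [Module.finrank_prod, finrank_levelModel, finrank_euclideanSpace_fin, Module.finrank_self]
  omega

theorem nonempty_equiv_cut (hn : 1 ≤ n) : Nonempty ((EuclideanSpace ℝ (Fin 1) ×
    (LevelModel (EuclideanSpace ℝ (Fin (n - 1))) × ℂ)) ≃L[ℝ]
      EuclideanSpace ℝ (Fin (2 * n + 1))) := by
  refine nonempty_equiv_of_finrank_eq ?_
  rw [Module.finrank_prod, Module.finrank_prod, finrank_levelModel, finrank_euclideanSpace_fin,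
    finrank_euclideanSpace_fin, Complex.finrank_real_complex]
  omega

theorem nonempty_equiv_cut_prod : Nonempty ((EuclideanSpace ℝ (Fin (2 * n + 1)) ×
    ℝ) ≃L[ℝ] (LevelModel (EuclideanSpace ℝ (Fin n)) × ℂ)) := by
  refine nonempty_equiv_of_finrank_eq ?_
  rw [Module.finrank_prod, Module.finrank_prod, finrank_levelModel, finrank_euclideanSpace_fin,
    Module.finrank_self, Complex.finrank_real_complex]

theorem nonempty_equiv_reduced (hn : 1 ≤ n) :
    Nonempty (LevelModel (EuclideanSpace ℝ (Fin (n - 1))) ≃L[ℝ]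
      EuclideanSpace ℝ (Fin (2 * n - 2))) := by
  refine nonempty_equiv_of_finrank_eq ?_
  rw [finrank_levelModel, finrank_euclideanSpace_fin]
  omega

theorem nonempty_equiv_bundle (hn : 1 ≤ n) :
    Nonempty ((LevelModel (EuclideanSpace ℝ (Fin (n - 1))) × ℂ) ≃L[ℝ]
      EuclideanSpace ℝ (Fin (2 * n))) := by
  refine nonempty_equiv_of_finrank_eq ?_
  rw [Module.finrank_prod, finrank_levelModel, finrank_euclideanSpace_fin,
    Complex.finrank_real_complex]
  omega

theorem nonempty_equiv_assoc (hn : 1 ≤ n) : Nonempty ((EuclideanSpace ℝ (Fin 1) ×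
    (LevelModel (EuclideanSpace ℝ (Fin (n - 1))) × ℂ)) ≃L[ℝ]
      (EuclideanSpace ℝ (Fin (2 * n - 1)) × ℂ)) := by
  refine nonempty_equiv_of_finrank_eq ?_
  rw [Module.finrank_prod, Module.finrank_prod, finrank_levelModel, Module.finrank_prod,
    finrank_euclideanSpace_fin, finrank_euclideanSpace_fin, Complex.finrank_real_complex]
  omega

end Dimensions

end CircleCut

end

open CircleCut Manifold
set_option maxHeartbeats 1600000 in
theorem mainTheorem4 (n : ℕ) (V : Type*) [TopologicalSpace V] [T2Space V]
    [SecondCountableTopology V] [ChartedSpace (EuclideanSpace ℝ (Fin n)) V]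
    [IsManifold (𝓡 n) ∞ V] [MulAction Circle V] [ContMDiffSMul (𝓡 1) (𝓡 n) ∞ Circle V]
    (hfree : ∀ (u : Circle) (x : V), u • x = x → u = 1) (ξ : ℝ) :
    -- smooth structures on the two levels and on the three quotients
    ∃ (_ : ChartedSpace (EuclideanSpace ℝ (Fin (2 * n - 1))) (Level n V ξ))
      (_ : ChartedSpace (EuclideanSpace ℝ (Fin (2 * n + 1))) (CutLevel n V ξ))
      (_ : ChartedSpace (EuclideanSpace ℝ (Fin (2 * n - 2))) (ReducedSpace n V ξ))
      (_ : ChartedSpace (EuclideanSpace ℝ (Fin (2 * n))) (CutSpace n V ξ))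
      (_ : ChartedSpace (EuclideanSpace ℝ (Fin (2 * n))) (AssocBundle n V ξ)),
      -- the levels are embedded submanifolds
      (IsManifold (𝓡 (2 * n - 1)) ∞ (Level n V ξ) ∧
        IsSmoothEmbedding (𝓡 (2 * n - 1)) (cotangentModel n) ∞
          (Subtype.val : Level n V ξ → Cotangent n V)) ∧
      (IsManifold (𝓡 (2 * n + 1)) ∞ (CutLevel n V ξ) ∧
        IsSmoothEmbedding (𝓡 (2 * n + 1)) ((cotangentModel n).prod 𝓘(ℝ, ℂ)) ∞
          (Subtype.val : CutLevel n V ξ → Cotangent n V × ℂ)) ∧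
      -- the quotients are quotient manifolds
      (T2Space (ReducedSpace n V ξ) ∧ SecondCountableTopology (ReducedSpace n V ξ) ∧
        IsManifold (𝓡 (2 * n - 2)) ∞ (ReducedSpace n V ξ) ∧
        IsSubmersion (𝓡 (2 * n - 1)) (𝓡 (2 * n - 2)) ∞
          (levelMk : Level n V ξ → ReducedSpace n V ξ)) ∧
      (T2Space (CutSpace n V ξ) ∧ SecondCountableTopology (CutSpace n V ξ) ∧
        IsManifold (𝓡 (2 * n)) ∞ (CutSpace n V ξ) ∧
        IsSubmersion (𝓡 (2 * n + 1)) (𝓡 (2 * n)) ∞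
          (cutMk : CutLevel n V ξ → CutSpace n V ξ)) ∧
      (T2Space (AssocBundle n V ξ) ∧ SecondCountableTopology (AssocBundle n V ξ) ∧
        IsManifold (𝓡 (2 * n)) ∞ (AssocBundle n V ξ) ∧
        IsSubmersion ((𝓡 (2 * n - 1)).prod 𝓘(ℝ, ℂ)) (𝓡 (2 * n)) ∞
          (assocMk : Level n V ξ × ℂ → AssocBundle n V ξ)) ∧
      -- `H⁻¹(ξ) → Q_ξ` is a principal circle bundle
      IsPrincipalCircleBundle (2 * n - 1) (2 * n - 2) levelSMul
        (levelMk : Level n V ξ → ReducedSpace n V ξ) ∧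
      -- `H⁻¹(ξ) ×_{S¹} ℂ → Q_ξ` is a complex line bundle, each `z ↦ [a, z]` being linear
      (∃ (_ : ∀ q : ReducedSpace n V ξ,
            AddCommGroup (assocProj ⁻¹' {q} : Set (AssocBundle n V ξ)))
          (_ : ∀ q : ReducedSpace n V ξ, Module ℂ (assocProj ⁻¹' {q} : Set (AssocBundle n V ξ))),
        (∀ a : Level n V ξ, IsLinearMap ℂ (assocFiberMk a)) ∧
        IsComplexLineBundle (2 * n) (2 * n - 2)
          (assocProj : AssocBundle n V ξ → ReducedSpace n V ξ)) ∧
      -- `W_ξ` is its total space, `Q_ξ ⊆ W_ξ` being the zero section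
      ∃ Φ : CutSpace n V ξ ≃ₘ^∞⟮𝓡 (2 * n), 𝓡 (2 * n)⟯ AssocBundle n V ξ,
        ∀ a : Level n V ξ, Φ (reducedInclusion (levelMk a)) = assocMk (a, 0) := by
  rcases isEmpty_or_nonempty V with hV | ⟨⟨x₀⟩⟩
  · -- all spaces are empty; this includes the case `n = 0`
    have hT : IsEmpty (Cotangent n V) := ⟨fun a ↦ isEmptyElim a.1⟩
    have hL : IsEmpty (Level n V ξ) := ⟨fun a ↦ isEmptyElim a.1⟩
    have hC : IsEmpty (CutLevel n V ξ) := ⟨fun a ↦ isEmptyElim a.1.1⟩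
    have hQ : IsEmpty (ReducedSpace n V ξ) := ⟨by rintro ⟨a⟩; exact hL.false a⟩
    have hW : IsEmpty (CutSpace n V ξ) := ⟨by rintro ⟨a⟩; exact hC.false a⟩
    have hA : IsEmpty (AssocBundle n V ξ) := ⟨by rintro ⟨a⟩; exact hL.false a.1⟩
    let csL := ChartedSpace.empty (EuclideanSpace ℝ (Fin (2 * n - 1))) (Level n V ξ)
    let csC := ChartedSpace.empty (EuclideanSpace ℝ (Fin (2 * n + 1))) (CutLevel n V ξ)
    let csQ := ChartedSpace.empty (EuclideanSpace ℝ (Fin (2 * n - 2))) (ReducedSpace n V ξ)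
    let csW := ChartedSpace.empty (EuclideanSpace ℝ (Fin (2 * n))) (CutSpace n V ξ)
    let csA := ChartedSpace.empty (EuclideanSpace ℝ (Fin (2 * n))) (AssocBundle n V ξ)
    refine ⟨csL, csC, csQ, csW, csA,
      ⟨inferInstance, isImmersion_of_isEmpty _, Topology.IsEmbedding.subtypeVal⟩,
      ⟨inferInstance, isImmersion_of_isEmpty _, Topology.IsEmbedding.subtypeVal⟩,
      ⟨⟨fun x ↦ isEmptyElim x⟩, inferInstance, inferInstance, isSubmersion_of_isEmpty _⟩,
      ⟨⟨fun x ↦ isEmptyElim x⟩, inferInstance, inferInstance, isSubmersion_of_isEmpty _⟩,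
      ⟨⟨fun x ↦ isEmptyElim x⟩, inferInstance, inferInstance, isSubmersion_of_isEmpty _⟩,
      fun q ↦ isEmptyElim q,
      ⟨fun q ↦ isEmptyElim q, fun q ↦ isEmptyElim q, fun a ↦ isEmptyElim a,
        fun q ↦ isEmptyElim q⟩, ?_⟩
    exact ⟨⟨Equiv.equivOfIsEmpty _ _, fun q ↦ isEmptyElim q, fun q ↦ isEmptyElim q⟩,
      fun a ↦ isEmptyElim a⟩
  have hn : 1 ≤ n := one_le_dim hfree x₀
  choose s hs using exists_sliceChart (n := n) (V := V) hn hfree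
  have hcov : ∀ x, ∃ i, x ∈ (s i).source := fun x ↦ ⟨x, hs x⟩
  have hT : T2Space (Cotangent n V) := t2Space_totalSpace _
  have hSC : SecondCountableTopology (Cotangent n V) := secondCountableTopology_totalSpace _
  have hSL : SecondCountableTopology (Level n V ξ) :=
    Topology.IsEmbedding.subtypeVal.secondCountableTopology
  have hSC' : SecondCountableTopology (CutLevel n V ξ) :=
    Topology.IsEmbedding.subtypeVal.secondCountableTopology
  obtain ⟨L₀⟩ := nonempty_equiv_slice hn
  obtain ⟨L₁⟩ := nonempty_equiv_level hn
  obtain ⟨L₂⟩ := nonempty_equiv_level_prod hn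
  obtain ⟨L₃⟩ := nonempty_equiv_cut hn
  obtain ⟨L₄⟩ := nonempty_equiv_cut_prod (n := n)
  obtain ⟨L₅⟩ := nonempty_equiv_reduced hn
  obtain ⟨L₆⟩ := nonempty_equiv_bundle hn
  obtain ⟨L₇⟩ := nonempty_equiv_assoc hn
  obtain ⟨θ, hθ, hθu, hθs⟩ := exists_connection hcov (ContinuousLinearEquiv.refl ℝ _) L₀
  -- the levels
  obtain ⟨csL, hmL, heL, hdL⟩ := exists_chartedSpace_levelSet
    (I₀ := (𝓡 1).prod 𝓘(ℝ, LevelModel (EuclideanSpace ℝ (Fin (n - 1)))))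
    (J := cotangentModel n) (fun i ↦ (s i).adaptedChart ξ)
    (fun i ↦ (s i).adaptedChart_snd ξ) (fun i ↦ (s i).adaptedChart_target ξ)
    (fun i ↦ (s i).isPartialDiffeo_adaptedChart ξ)
    (fun a ↦ ⟨a.1, SliceChart.mem_adaptedChart_source.2 (hs a.1)⟩) L₁ L₂
  obtain ⟨csC, hmC, heC, hdC⟩ := exists_chartedSpace_levelSet
    (I₀ := (𝓡 1).prod 𝓘(ℝ, LevelModel (EuclideanSpace ℝ (Fin (n - 1))) × ℂ))
    (J := (cotangentModel n).prod 𝓘(ℝ, ℂ)) (fun i ↦ (s i).cutAdaptedChart ξ)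
    (fun i ↦ (s i).cutAdaptedChart_snd ξ) (fun i ↦ (s i).cutAdaptedChart_target ξ)
    (fun i ↦ (s i).isPartialDiffeo_cutAdaptedChart ξ)
    (fun a ↦ ⟨a.1.1, SliceChart.mem_cutAdaptedChart_source.2 (hs a.1.1)⟩) L₃ L₄
  -- the quotients
  have hcovL : ∀ a : Level n V ξ, ∃ i, a ∈ ((s i).level ξ).source := fun a ↦
    ⟨a.1.1, SliceChart.mem_level_source.2 (hs a.1.1)⟩
  have hcovC : ∀ a : CutLevel n V ξ, ∃ i, a ∈ ((s i).cut ξ).source := fun a ↦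
    ⟨a.1.1.1, SliceChart.mem_cut_source.2 (hs a.1.1.1)⟩
  have hcovA : ∀ a : Level n V ξ × ℂ, ∃ i, a ∈ ((s i).level ξ).assoc.source := fun a ↦
    (hcovL a.1).imp fun i hi ↦ ((s i).level ξ).mem_assoc_source.2 hi
  have hccL : HasCircleCharts levelSMul (LevelModel (EuclideanSpace ℝ (Fin (n - 1)))) :=
    fun a : Level n V ξ ↦ (hcovL a).imp' _ fun i hi ↦ hi
  have hccC : HasCircleCharts cutSMul (LevelModel (EuclideanSpace ℝ (Fin (n - 1))) × ℂ) :=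
    fun a : CutLevel n V ξ ↦ (hcovC a).imp' _ fun i hi ↦ hi
  have hdA : ∀ i, IsPartialDiffeo ((𝓡 (2 * n - 1)).prod 𝓘(ℝ, ℂ)) _
      ((s i).level ξ).assoc.toOpenPartialHomeomorph := fun i ↦
    CircleChart.isPartialDiffeo_assoc (hdL i)
  obtain ⟨csQ, hmQ, hsQ, hdQ⟩ := exists_chartedSpace_orbitSpace (J := 𝓡 (2 * n - 1))
    (C := fun i ↦ (s i).level ξ) hccL hcovL hdL L₅ L₁
  obtain ⟨csW, hmW, hsW, hdW⟩ := exists_chartedSpace_orbitSpace (J := 𝓡 (2 * n + 1))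
    (C := fun i ↦ (s i).cut ξ) hccC hcovC hdC L₆ L₃
  obtain ⟨csA, hmA, hsA, hdA'⟩ := exists_chartedSpace_orbitSpace
    (J := (𝓡 (2 * n - 1)).prod 𝓘(ℝ, ℂ))
    (C := fun i ↦ ((s i).level ξ).assoc) hccL.assoc hcovA hdA L₆ L₇
  refine ⟨csL, csC, csQ, csW, csA, ⟨hmL, heL⟩, ⟨hmC, heC⟩,
    ⟨hccL.t2Space, hccL.secondCountableTopology, hmQ, hsQ⟩,
    ⟨hccC.t2Space, hccC.secondCountableTopology, hmW, hsW⟩,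
    ⟨hccL.assoc.t2Space, hccL.assoc.secondCountableTopology, hmA, hsA⟩, ?_, ?_, ?_⟩
  · exact isPrincipalCircleBundle_orbitMk (C := fun i ↦ (s i).level ξ) hccL hcovL hdL
      hsQ.contMDiff hdQ
  · obtain ⟨ag, mod, hlin⟩ := exists_module_assocOrbit hccL
    exact ⟨ag, mod, hlin, isComplexLineBundle_assocOrbitProj (C := fun i ↦ (s i).level ξ)
      hccL hcovL hdL hsQ.contMDiff hdQ hdA' hlin⟩
  · have hθs' := contMDiff_translate hθs
    obtain ⟨Φ, hΦ⟩ := exists_diffeomorph_orbitSpace (C := fun i ↦ (s i).cut ξ)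
      (C' := fun i ↦ ((s i).level ξ).assoc) hccC hccL.assoc hcovC hcovA hdC hdA hdW hdA'
      hsW.contMDiff hsA.contMDiff (contMDiff_cutToAssoc hθ hθs' heL heC)
      (contMDiff_assocToCut hθ hθs' heL heC) (cutToAssoc_smul hθ hθu)
      (assocToCut_cutToAssoc hθ) (cutToAssoc_assocToCut hθ)
    refine ⟨Φ, fun a ↦ ?_⟩
    exact (hΦ (levelInclusion a)).trans (congrArg assocMk (cutToAssoc_levelInclusion hθ a))
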